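/- Let $k\ge 2$, $d_1,\dots,d_k\ge 1$, $d=d_1+\cdots+d_k$, $s>0$, $M_1,\dots,M_k>0$, $M=\prod_j M_j$, and let $(\Delta_n)$ be a sequence of real numbers. For a dimension $m$ and $R>0$ let $\mathcal W^{s,2}_m(R)$ be the set of almost everywhere continuous $f:\mathbb R^m\to\mathbb R$ with $\int(1+\|\omega\|^2)^s|\mathcal Ff(\omega)|^2d\omega\le R^2$, where $\mathcal Ff(\omega)=(2\pi)^{-m/2}\int f(x)e^{-ix^\top\omega}dx$. For a random vector $X=(X^1,\dots,X^k)\in\mathbb R^d$, $X^j\in\mathbb R^{d_j}$, with density $p$ and marginal densities $p_j$ of $X^j$, consider $$H_0:\ p=p_1\otimes\cdots\otimes p_k,\quad p_j\in\mathcal W^{s,2}_{d_j}(M_j)\ (1\le j\le k),$$ $$H_1(\Delta):\ p\in\mathcal W^{s,2}_d(M),\quad p_j\in\mathcal W^{s,2}_{d_j}(M_j)\ (1\le j\le k),\quad \|p-p_1\otimes\cdots\otimes p_k\|_{L_2}\ge\Delta .$$ The data are i.i.d. copies $X_1,\dots,X_n$ of $X$; a test may be randomized. The power of a test $\Phi$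 against $H_1(\Delta)$ is the infimum over $H_1(\Delta)$ of the probability that $\Phi$ rejects (an infimum in $[0,1]$, equal to $1$ if $H_1(\Delta)$ is empty). A sequence of tests $\Phi_n$ has asymptotic level $\alpha$ if $\limsup_n\mathbb P\{\Phi_n\text{ rejects}\}\le\alpha$ for every distribution in $H_0$. Write $G_\nu(x,y)=\exp(-\nu\|x-y\|^2)$, and let $$\widehat{\gamma^2_\nu}=\frac{1}{n(n-1)}\sum_{i\ne j}G_\nu(X_i,X_j)+\frac{(n-2k)!}{n!}\sum G_\nu\big((X^1_{i_1},\dots,X^k_{i_k}),(X^1_{j_1},\dots,X^k_{j_k})\big)-\frac{2(n-k-1)!}{n!}\sum G_\nu\big(X_i,(X^1_{j_1},\dots,X^k_{j_k})\big),$$ the sums running over pairwise distinct indices $i_1,\dots,i_k,j_1,\dots,j_k$, respectively $i,j_1,\dots,j_k$, in $\{1,\dots,n\}$. For $1\le l\le k$ put, with sums again over pairwise distinct indices, $$a_l=\frac{(n-2)!}{n!}\sum G_{2\nu}(X^l_{i},X^l_{j}),\quad b_l=\frac{(n-3)!}{n!}\sum G_\nu(X^l_i,X^l_{j_1})G_\nu(X^l_i,X^l_{j_2}),\quad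 c_l=\frac{(n-4)!}{n!}\sum G_\nu(X^l_{i_1},X^l_{j_1})G_\nu(X^l_{i_2},X^l_{j_2}),$$ $$\tilde s^2_{n,\nu}=\prod_l a_l-2\prod_l b_l+\prod_l c_l-2\sum_{j}\Big(a_j\prod_{l\ne j}b_l-\prod_l b_l-b_j\prod_{l\ne j}c_l+\prod_l c_l\Big)+\sum_j(a_j-2b_j+c_j)\prod_{l\ne j}c_l+\sum_{j_1\ne j_2}(b_{j_1}-c_{j_1})(b_{j_2}-c_{j_2})\prod_{l\ne j_1,j_2}c_l$$ (for $k=2$ this equals $\prod_{l=1}^2(a_l-2b_l+c_l)$), $\widehat s^2_{n,\nu}=\max\{\tilde s^2_{n,\nu},1/n^2\}$ and $T_{n,\nu}=\frac{n}{\sqrt2}\,\widehat s_{n,\nu}^{-1}\,\widehat{\gamma^2_\nu}$. For $\alpha\in(0,1)$ let $\Phi_{n,\nu,\alpha}$ be the Gaussian kernel dHSIC test that rejects if and only if $T_{n,\nu}>z_\alpha$, where $z_\alpha$ is the upper $\alpha$ quantile of $N(0,1)$. (i) If $n^{2s/(d+4s)}\Delta_n\to\infty$, then for every sequence $\nu_n>0$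 with $\nu_n\asymp n^{4/(d+4s)}$ and every $\alpha\in(0,1)$, the power of $\Phi_{n,\nu_n,\alpha}$ against $H_1(\Delta_n)$ tends to $1$ as $n\to\infty$. (ii) Conversely, if $\liminf_{n\to\infty}n^{2s/(d+4s)}\Delta_n<\infty$, then there is an $\alpha\in(0,1)$ such that for every sequence of tests $\Phi_n$, based on $X_1,\dots,X_n$, of asymptotic level $\alpha$, the $\liminf_{n\to\infty}$ of the power of $\Phi_n$ against $H_1(\Delta_n)$ is strictly less than $1$. -/

import Mathlib

open MeasureTheory ProbabilityTheory Filter Topology Asymptotics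
open scoped ENNReal BigOperators

noncomputable section

namespace IndepTest

/-! ### Densities and Sobolev balls on Euclidean space -/

section Sobolev

variable {ι : Type} [Fintype ι]

/-- The Fourier transform `(2π)^(-d/2) ∫ f(x) exp(-i ⟨x, ω⟩) dx` of an integrable function
on the Euclidean space of dimension `d = card ι`. -/
def fourierT (f : EuclideanSpace ℝ ι → ℝ) (ω : EuclideanSpace ℝ ι) : ℂ :=
  (((2 * Real.pi) ^ (-(Fintype.card ι : ℝ) / 2) : ℝ) : ℂ) *
    ∫ x : EuclideanSpace ℝ ι, (f x : ℂ) * Complex.exp (-((inner ℝ x ω : ℝ) : ℂ) * Complex.I)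

/-- The squared Sobolev norm `∫ (1 + ‖ω‖²)^s |F f(ω)|² dω`, possibly infinite. -/
def sobolevNormSq (s : ℝ) (f : EuclideanSpace ℝ ι → ℝ) : ℝ≥0∞ :=
  ∫⁻ ω : EuclideanSpace ℝ ι, ENNReal.ofReal ((1 + ‖ω‖ ^ 2) ^ s * ‖fourierT f ω‖ ^ 2)

/-- The integrable members of the Sobolev ball of order `s` and radius `M`: almost everywhere
continuous functions whose Sobolev norm is at most `M`. (Only probability densities, which are
integrable, are ever tested for membership; for them the Fourier integral converges.) -/
def sobolevBall (s M : ℝ) : Set (EuclideanSpace ℝ ι → ℝ) :=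
  {f | Integrable f ∧ (∀ᵐ x, ContinuousAt f x) ∧ sobolevNormSq s f ≤ ENNReal.ofReal M ^ 2}

/-- `f` is a (version of the) density of the law `P` with respect to Lebesgue measure. -/
structure IsDensityOf (f : EuclideanSpace ℝ ι → ℝ) (P : Measure (EuclideanSpace ℝ ι)) : Prop where
  nonneg : ∀ x, 0 ≤ f x
  aemeasurable : AEMeasurable f
  eq_withDensity : P = volume.withDensity (fun x => ENNReal.ofReal (f x))

/-- The Gaussian kernel `G_ν(x, y) = exp(-ν ‖x - y‖²)`. -/
def gaussKernel (ν : ℝ) (x y : EuclideanSpace ℝ ι) : ℝ :=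
  Real.exp (-ν * ‖x - y‖ ^ 2)

end Sobolev

/-! ### Vectors made of `k` blocks -/

section Blocks

variable {k : ℕ}

/-- The space `ℝ^d`, `d = d_1 + ⋯ + d_k`, whose coordinates are grouped into `k` blocks
of sizes `d_1, …, d_k`. -/
abbrev Joint (d : Fin k → ℕ) : Type := EuclideanSpace ℝ ((j : Fin k) × Fin (d j))

variable {d : Fin k → ℕ}

/-- The `j`-th block `x^j` of `x`. -/
def block (j : Fin k) (x : Joint d) : EuclideanSpace ℝ (Fin (d j)) :=
  WithLp.toLp 2 (fun a => x ⟨j, a⟩)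

/-- The vector `(X^1_{i_1}, …, X^k_{i_k})` whose `j`-th block is that of the `i_j`-th
observation. -/
def mix {n : ℕ} (X : Fin n → Joint d) (i : Fin k → Fin n) : Joint d :=
  WithLp.toLp 2 (fun a => X (i a.1) a)

/-- The tensor product `q_1 ⊗ ⋯ ⊗ q_k`. -/
def tensor (q : (j : Fin k) → EuclideanSpace ℝ (Fin (d j)) → ℝ) (x : Joint d) : ℝ :=
  ∏ j, q j (block j x)

/-- The law of the `j`-th block under `P`. -/
def marginal (P : Measure (Joint d)) (j : Fin k) : Measure (EuclideanSpace ℝ (Fin (d j))) :=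
  P.map (block j)

/-- Null hypothesis: the joint density is the product of the marginal densities `q_j`, and
each `q_j` belongs to the Sobolev ball of radius `M_j`. -/
def nullHyp (d : Fin k → ℕ) (s : ℝ) (M : Fin k → ℝ) : Set (Measure (Joint d)) :=
  {P | IsProbabilityMeasure P ∧
    ∃ q : (j : Fin k) → EuclideanSpace ℝ (Fin (d j)) → ℝ,
      (∀ j, IsDensityOf (q j) (marginal P j) ∧ q j ∈ sobolevBall s (M j)) ∧
      IsDensityOf (tensor q) P}

/-- Alternative hypothesis: the joint density `p` belongs to the Sobolev ball of radius
`M_1 ⋯ M_k`, each marginal density `q_j` to that of radius `M_j`, and the `L²` distance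
between `p` and `q_1 ⊗ ⋯ ⊗ q_k` is at least `δ`. -/
def altHyp (d : Fin k → ℕ) (s : ℝ) (M : Fin k → ℝ) (δ : ℝ) : Set (Measure (Joint d)) :=
  {P | IsProbabilityMeasure P ∧
    ∃ (p : Joint d → ℝ) (q : (j : Fin k) → EuclideanSpace ℝ (Fin (d j)) → ℝ),
      IsDensityOf p P ∧ p ∈ sobolevBall s (∏ j, M j) ∧
      (∀ j, IsDensityOf (q j) (marginal P j) ∧ q j ∈ sobolevBall s (M j)) ∧
      ENNReal.ofReal δ ≤ eLpNorm (fun x => p x - tensor q x) 2 volume}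

end Blocks

/-! ### Tests, level and power -/

section Tests

variable {E : Type} [MeasurableSpace E]

/-- A (possibly randomized) test based on `n` observations, given by the probability `φ x` of
rejecting the null hypothesis when the sample is `x`. A nonrandomized test is an indicator
function. -/
def IsTest {n : ℕ} (φ : (Fin n → E) → ℝ≥0∞) : Prop :=
  Measurable φ ∧ ∀ x, φ x ≤ 1

/-- The probability that the test rejects when `X_1, …, X_n` are i.i.d. with law `P`. -/
def rejectProb {n : ℕ} (φ : (Fin n → E) → ℝ≥0∞) (P : Measure E) : ℝ≥0∞ :=
  ∫⁻ x, φ x ∂(Measure.pi (fun _ : Fin n => P))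

/-- The power against the composite hypothesis `H`: the infimum over `H`, taken in `[0, 1]`, of
the probability of rejection (so that it is `1` if `H` is empty). -/
def power {n : ℕ} (φ : (Fin n → E) → ℝ≥0∞) (H : Set (Measure E)) : ℝ≥0∞ :=
  min 1 (⨅ P ∈ H, rejectProb φ P)

/-- The sequence of tests `φ` has asymptotic level `α` for the null hypothesis `H`. -/
def HasAsymptoticLevel (φ : (n : ℕ) → (Fin n → E) → ℝ≥0∞) (H : Set (Measure E)) (α : ℝ) : Prop :=
  ∀ P ∈ H, limsup (fun n => rejectProb (φ n) P) atTop ≤ ENNReal.ofReal α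

end Tests

/-- The upper `α` quantile `z_α` of the standard normal distribution. -/
def upperQuantile (α : ℝ) : ℝ :=
  sInf {z : ℝ | gaussianReal 0 1 (Set.Ioi z) ≤ ENNReal.ofReal α}

/-! ### The Gaussian kernel independence test -/

section Statistic

/-- The average of `f` over all tuples of distinct indices in `{1, …, n}`, the entries of the
tuple being labelled by `τ`: the sum of `f`, multiplied by `(n - m)! / n!` with `m = card τ`. -/
def uAverage {τ : Type} [Fintype τ] [DecidableEq τ] {n : ℕ} (f : (τ ↪ Fin n) → ℝ) : ℝ :=
  (∑ e : τ ↪ Fin n, f e) / (n.descFactorial (Fintype.card τ) : ℝ)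

variable {k : ℕ} {d : Fin k → ℕ} {n : ℕ}

/-- The bias-corrected estimate of the squared maximum mean discrepancy between the joint law
and the product of the marginal laws. -/
def dHSIC (ν : ℝ) (X : Fin n → Joint d) : ℝ :=
  uAverage (fun e : Fin 2 ↪ Fin n => gaussKernel ν (X (e 0)) (X (e 1)))
  + uAverage (fun e : (Fin k ⊕ Fin k) ↪ Fin n =>
      gaussKernel ν (mix X (fun j => e (Sum.inl j))) (mix X (fun j => e (Sum.inr j))))
  - 2 * uAverage (fun e : (Unit ⊕ Fin k) ↪ Fin n =>
      gaussKernel ν (X (e (Sum.inl ()))) (mix X (fun j => e (Sum.inr j))))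

/-- Unbiased estimate of `E G_{2ν}(X_1^l, X_2^l)`. -/
def estA (ν : ℝ) (X : Fin n → Joint d) (l : Fin k) : ℝ :=
  uAverage (fun e : Fin 2 ↪ Fin n =>
    gaussKernel (2 * ν) (block l (X (e 0))) (block l (X (e 1))))

/-- Unbiased estimate of `E G_ν(X_1^l, X_2^l) G_ν(X_1^l, X_3^l)`. -/
def estB (ν : ℝ) (X : Fin n → Joint d) (l : Fin k) : ℝ :=
  uAverage (fun e : Fin 3 ↪ Fin n =>
    gaussKernel ν (block l (X (e 0))) (block l (X (e 1)))
      * gaussKernel ν (block l (X (e 0))) (block l (X (e 2))))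

/-- Unbiased estimate of `(E G_ν(X_1^l, X_2^l))²`. -/
def estC (ν : ℝ) (X : Fin n → Joint d) (l : Fin k) : ℝ :=
  uAverage (fun e : Fin 4 ↪ Fin n =>
    gaussKernel ν (block l (X (e 0))) (block l (X (e 2)))
      * gaussKernel ν (block l (X (e 1))) (block l (X (e 3))))

/-- With `a_l = E G_{2ν}(X_1^l, X_2^l)`, `b_l = E G_ν(X_1^l, X_2^l) G_ν(X_1^l, X_3^l)` and
`c_l = (E G_ν(X_1^l, X_2^l))²`, this is the leading term
`E Ḡ² - 2 ∑_j E g_j² + ∑_{j₁, j₂} E g_{j₁, j₂}²` of `n (n - 1) / 2` times the variance of `dHSIC`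
under independence. The three lines are the three terms. -/
def varianceForm (a b c : Fin k → ℝ) : ℝ :=
  (∏ l, a l - 2 * ∏ l, b l + ∏ l, c l)
  - 2 * ∑ j, (a j * ∏ l ∈ Finset.univ.erase j, b l - ∏ l, b l
      - b j * ∏ l ∈ Finset.univ.erase j, c l + ∏ l, c l)
  + ∑ j₁, ∑ j₂, (if j₁ = j₂ then
        (a j₁ - 2 * b j₁ + c j₁) * ∏ l ∈ Finset.univ.erase j₁, c l
      else (b j₁ - c j₁) * (b j₂ - c j₂) * ∏ l ∈ (Finset.univ.erase j₁).erase j₂, c l)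

/-- The variance estimate `max (s̃², 1/n²)`. -/
def varianceEst (ν : ℝ) (X : Fin n → Joint d) : ℝ :=
  max (varianceForm (estA ν X) (estB ν X) (estC ν X)) (1 / (n : ℝ) ^ 2)

/-- The studentized test statistic. -/
def testStat (ν : ℝ) (X : Fin n → Joint d) : ℝ :=
  (n : ℝ) / Real.sqrt 2 * (Real.sqrt (varianceEst ν X))⁻¹ * dHSIC ν X

/-- The Gaussian kernel independence test with scaling parameter `ν`, which rejects if and only
if the test statistic exceeds `z_α`. -/
def gaussTest (d : Fin k → ℕ) (n : ℕ) (ν α : ℝ) : (Fin n → Joint d) → ℝ≥0∞ :=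
  Set.indicator {X | upperQuantile α < testStat ν X} (fun _ => 1)

end Statistic

end IndepTest

end

/-!
Both parts compare a signal with a noise level, and the rates of the two balance at
`Δ ≍ n ^ (-2 s / (D + 4 s))`, where `D` is the dimension.

**Consistency.** A feature map `φ` of the Gaussian kernel turns the discrepancy between a law `P`
and the product of its marginals into `g = ‖meanContrast φ P‖²`. In the Fourier domain
(`integral_gaussKernel_mul`) the number `g` is, up to the factor `(π / ν) ^ (D / 2)`, the squared
`L²` norm of `p - p₁ ⊗ ⋯ ⊗ p_k` with a Gaussian weight on the frequencies. Frequencies with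
`‖ω‖² ≤ ν` are weighted by a constant at least, and the higher ones carry at most a multiple of
`ν ^ (-s)` because the densities lie in Sobolev balls (`sq_le_of_sobolevNormSq_le`,
`altHyp_bounds`). Hence `g` is at least of order `ν ^ (-D / 2) Δ²` as soon as `ν ^ s Δ²` is large.
The discrepancy estimate is an average, over tuples of distinct indices, of inner products of two
contrasts without common observation (`dHSIC_eq_uAverage`). Splitting off the mean of each
contrast leaves a degenerate part and a linear part, and the mean square error is of order
`g √B / n + B / n²`, where `B`, of order `ν ^ (-D / 2)`, bounds the second moment of the kernel
(`integral_dHSIC_sub_sq_le`). The variance estimate is at most a constant times the product of the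
`estA` (`varianceForm_le`), whose means multiply to at most `B`. Thus the studentized statistic
exceeds a fixed multiple of `n g / √B` with high probability (`le_rejectProb_gaussTest`), and for
`ν ≍ n ^ (4 / (D + 4 s))` this ratio diverges under the assumption on `Δ` (`tendsto_signal`,
`tendsto_power_gaussTest`). The limiting normal law plays no role for the power: any fixed
threshold is exceeded.

**Lower bound.** The null law is a centered Gaussian so flat that its density is deep inside the
Sobolev balls (`tendsto_sobolevNormSq_gaussDensity`). It is perturbed by
`δ ∑ m, ε m * cell m`, where `ε` are random signs and the cells are copies of one oscillating
function on the `b ^ D` cubes of side `1 / b` in the unit cube. Each cell integrates to zero over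
all cylinders based on one block (`setIntegral_cell`), so the marginals do not change, while the
`L²` distance from the product of the marginals is a multiple of `δ`. On average over the signs
the cross terms in the Sobolev norm cancel, which leaves a multiple of `δ² b ^ (2 s)`
(`sum_sobolevNormSq_le`); by Markov's inequality at least half of the perturbed laws then belong to
the alternative. By the Cauchy-Schwarz inequality, the averaged probability of rejection is at
most the square root of the level times the second moment of the mixed likelihood ratio
(`sum_rejectProb_le`), and this moment is at most the exponential of a multiple of
`n² δ⁴ / b ^ D`. With `δ ≍ n ^ (-2 s / (D + 4 s))` and `b ≍ n ^ (2 / (D + 4 s))` both quantities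
stay bounded (`exists_resolution`), so a small level keeps the power away from one
(`power_altHyp_le`, `exists_level_liminf_power_lt`).
-/

noncomputable section

namespace IndepTest

/-! ### Products of measures and block coordinates -/

theorem lintegral_fin_prod_eq_prod {n : ℕ} {E : Fin n → Type*} [∀ i, MeasurableSpace (E i)]
    (μ : (i : Fin n) → Measure (E i)) [∀ i, SigmaFinite (μ i)] (f : (i : Fin n) → E i → ℝ≥0∞)
    (hf : ∀ i, AEMeasurable (f i) (μ i)) :
    ∫⁻ x, ∏ i, f i (x i) ∂(Measure.pi μ) = ∏ i, ∫⁻ x, f i x ∂(μ i) := by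
  induction n with
  | zero => simp
  | succ n ih =>
    have hm := ((measurePreserving_piFinSuccAbove (fun i => μ i) 0).symm)
    rw [← hm.lintegral_comp_emb (MeasurableEquiv.measurableEmbedding _), Fin.prod_univ_succ]
    simp only [MeasurableEquiv.piFinSuccAbove_symm_apply, Fin.insertNthEquiv,
      Fin.prod_univ_succ, Fin.insertNth_zero, Equiv.coe_fn_mk, Fin.cons_succ, Fin.cons_zero]
    rw [← ih (fun i => μ i.succ) (fun i => f i.succ) (fun i => hf _)]
    have h2 : AEMeasurable (fun x : (i : Fin n) → E i.succ => ∏ i, f i.succ (x i))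
        (Measure.pi fun i => μ i.succ) :=
      Finset.aemeasurable_fun_prod _ fun i _ =>
        (hf i.succ).comp_quasiMeasurePreserving (Measure.quasiMeasurePreserving_eval _ i)
    exact lintegral_prod_mul (hf 0) h2

section Blocks

variable {k : ℕ} {d : Fin k → ℕ}

/-- Splitting a vector into its blocks, as a measurable equivalence. -/
def blockEquiv (d : Fin k → ℕ) :
    Joint d ≃ᵐ ((j : Fin k) → EuclideanSpace ℝ (Fin (d j))) where
  toFun x j := block j x
  invFun y := WithLp.toLp 2 (fun a => y a.1 a.2)
  left_inv x := rfl
  right_inv y := rfl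
  measurable_toFun := by
    refine measurable_pi_lambda _ fun j => ?_
    unfold block
    dsimp
    fun_prop
  measurable_invFun := by
    change Measurable fun y : (j : Fin k) → EuclideanSpace ℝ (Fin (d j)) =>
      (WithLp.toLp 2 (fun a => y a.1 a.2) : Joint d)
    fun_prop

@[simp] theorem blockEquiv_apply (x : Joint d) (j : Fin k) : blockEquiv d x j = block j x := rfl

theorem continuous_block (j : Fin k) : Continuous (block j : Joint d → _) := by
  unfold block
  fun_prop

theorem measurable_block (j : Fin k) : Measurable (block j : Joint d → _) :=
  (continuous_block j).measurable

theorem measurePreserving_blockEquiv_symm : MeasurePreserving (blockEquiv d).symm := by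
  have h : MeasurePreserving (fun y : (j : Fin k) → EuclideanSpace ℝ (Fin (d j)) =>
      (fun a => y a.1 a.2 : ((j : Fin k) × Fin (d j)) → ℝ)) := by
    refine ⟨by fun_prop, ?_⟩
    refine (Measure.pi_eq fun s hs => ?_).symm
    rw [Measure.map_apply (by fun_prop) (MeasurableSet.univ_pi hs)]
    have : ((fun y : (j : Fin k) → EuclideanSpace ℝ (Fin (d j)) =>
        (fun a => y a.1 a.2 : ((j : Fin k) × Fin (d j)) → ℝ)) ⁻¹' (Set.univ.pi s)) =
        Set.univ.pi (fun j => (WithLp.ofLp : EuclideanSpace ℝ (Fin (d j)) → _) ⁻¹'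
          (Set.univ.pi fun b => s ⟨j, b⟩)) := by
      ext y
      simp only [Set.mem_preimage, Set.mem_pi, Set.mem_univ, true_imp_iff, Sigma.forall]
    rw [this, volume_pi, Measure.pi_pi, Fintype.prod_sigma]
    refine Finset.prod_congr rfl fun j _ => ?_
    rw [(PiLp.volume_preserving_ofLp (Fin (d j))).measure_preimage
      (MeasurableSet.univ_pi fun b => hs _).nullMeasurableSet, volume_pi_pi]
  exact (PiLp.volume_preserving_toLp ((j : Fin k) × Fin (d j))).comp h

theorem measurePreserving_blockEquiv : MeasurePreserving (blockEquiv d) :=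
  measurePreserving_blockEquiv_symm.symm

theorem lintegral_block_prod (f : (j : Fin k) → EuclideanSpace ℝ (Fin (d j)) → ℝ≥0∞)
    (hf : ∀ j, AEMeasurable (f j)) :
    ∫⁻ x : Joint d, ∏ j, f j (block j x) = ∏ j, ∫⁻ x, f j x := by
  rw [← lintegral_fin_prod_eq_prod _ _ hf]
  exact measurePreserving_blockEquiv.lintegral_comp_emb
    (MeasurableEquiv.measurableEmbedding _) (fun y => ∏ j, f j (y j))

theorem integral_block_prod {𝕜 : Type*} [RCLike 𝕜]
    (f : (j : Fin k) → EuclideanSpace ℝ (Fin (d j)) → 𝕜) :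
    ∫ x : Joint d, ∏ j, f j (block j x) = ∏ j, ∫ x, f j x := by
  rw [← integral_fintype_prod_volume_eq_prod f]
  exact measurePreserving_blockEquiv.integral_comp
    (MeasurableEquiv.measurableEmbedding _) (fun y => ∏ j, f j (y j))

theorem integrable_block_prod {𝕜 : Type*} [RCLike 𝕜]
    {f : (j : Fin k) → EuclideanSpace ℝ (Fin (d j)) → 𝕜} (hf : ∀ j, Integrable (f j)) :
    Integrable (fun x : Joint d => ∏ j, f j (block j x)) :=
  measurePreserving_blockEquiv.integrable_comp_of_integrable (Integrable.fintype_prod_dep hf)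

theorem quasiMeasurePreserving_block (j : Fin k) :
    Measure.QuasiMeasurePreserving (block j : Joint d → _) :=
  (Measure.quasiMeasurePreserving_eval _ j).comp
    (measurePreserving_blockEquiv (d := d)).quasiMeasurePreserving

theorem inner_eq_sum_block (x y : Joint d) :
    (inner ℝ x y : ℝ) = ∑ j, inner ℝ (block j x) (block j y) := by
  simp [PiLp.inner_apply, block, Fintype.sum_sigma]

theorem norm_sq_eq_sum_block (x : Joint d) : ‖x‖ ^ 2 = ∑ j, ‖block j x‖ ^ 2 := by
  simp only [← real_inner_self_eq_norm_sq, inner_eq_sum_block]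

theorem card_joint : Fintype.card ((j : Fin k) × Fin (d j)) = ∑ j, d j := by simp

/-- The law of independent blocks, each distributed as the corresponding block under `P`. -/
def productLaw (P : Measure (Joint d)) : Measure (Joint d) :=
  (Measure.pi fun j => marginal P j).map (blockEquiv d).symm

instance isProbabilityMeasure_marginal (P : Measure (Joint d)) [IsProbabilityMeasure P]
    (j : Fin k) : IsProbabilityMeasure (marginal P j) :=
  Measure.isProbabilityMeasure_map (measurable_block j).aemeasurable

instance isProbabilityMeasure_productLaw (P : Measure (Joint d)) [IsProbabilityMeasure P] :
    IsProbabilityMeasure (productLaw P) :=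
  Measure.isProbabilityMeasure_map (MeasurableEquiv.measurable _).aemeasurable

theorem measurable_mix {n : ℕ} (i : Fin k → Fin n) :
    Measurable (fun X : Fin n → Joint d => mix X i) := by
  unfold mix
  fun_prop

/-- Picking the blocks from distinct observations makes them independent. -/
theorem measurePreserving_mix {n : ℕ} (P : Measure (Joint d)) [IsProbabilityMeasure P]
    (i : Fin k → Fin n) (hi : Function.Injective i) :
    MeasurePreserving (fun X : Fin n → Joint d => mix X i)
      (Measure.pi fun _ => P) (productLaw P) := by
  have h1 : iIndepFun (fun (m : Fin n) (X : Fin n → Joint d) => X m) (Measure.pi fun _ => P) :=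
    iIndepFun_pi (X := fun _ => id) fun _ => aemeasurable_id
  have h2 := (h1.precomp hi).comp (fun j => (block j : Joint d → _)) fun j => measurable_block j
  have h0 : ∀ j, Measurable (block j ∘ fun X : Fin n → Joint d => X (i j)) :=
    fun j => (measurable_block j).comp (measurable_pi_apply _)
  have h3 := h2.map_fun_eq_pi_map fun j => (h0 j).aemeasurable
  have h4 : ∀ j, (Measure.pi fun _ : Fin n => P).map
      (block j ∘ fun X : Fin n → Joint d => X (i j)) = marginal P j := by
    intro j
    have := (measurePreserving_eval (fun _ : Fin n => P) (i j)).map_eq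
    rw [marginal]
    conv_rhs => rw [← this]
    exact (Measure.map_map (measurable_block j) (measurable_pi_apply (i j))).symm
  refine ⟨measurable_mix i, ?_⟩
  simp only [Function.comp_def] at h3 h4
  simp only [h4] at h3
  rw [productLaw, ← h3, Measure.map_map (MeasurableEquiv.measurable _)]
  · rfl
  · exact measurable_pi_lambda _ fun j => (measurable_block j).comp (measurable_pi_apply _)

theorem aemeasurable_tensor {q : (j : Fin k) → EuclideanSpace ℝ (Fin (d j)) → ℝ}
    (hq : ∀ j, AEMeasurable (q j)) : AEMeasurable (tensor q) :=
  Finset.aemeasurable_fun_prod _ fun j _ =>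
    (hq j).comp_quasiMeasurePreserving (quasiMeasurePreserving_block j)

/-- If the marginals have densities `q j`, then the product law has density `tensor q`. -/
theorem productLaw_eq_withDensity {P : Measure (Joint d)} [IsProbabilityMeasure P]
    {q : (j : Fin k) → EuclideanSpace ℝ (Fin (d j)) → ℝ}
    (hq : ∀ j, IsDensityOf (q j) (marginal P j)) :
    productLaw P = volume.withDensity (fun x => ENNReal.ofReal (tensor q x)) := by
  have key : (volume.withDensity (fun x => ENNReal.ofReal (tensor q x))).map (blockEquiv d) =
      Measure.pi fun j => marginal P j := by
    refine (Measure.pi_eq fun s hs => ?_).symm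
    rw [MeasurableEquiv.map_apply, withDensity_apply _
      ((blockEquiv d).measurable (MeasurableSet.univ_pi hs)), ← lintegral_indicator
      ((blockEquiv d).measurable (MeasurableSet.univ_pi hs))]
    have : ∀ x : Joint d, ((blockEquiv d) ⁻¹' (Set.univ.pi s)).indicator
        (fun x => ENNReal.ofReal (tensor q x)) x =
        ∏ j, (s j).indicator (fun y => ENNReal.ofReal (q j y)) (block j x) := by
      intro x
      by_cases hx : ∀ j, block j x ∈ s j
      · rw [Set.indicator_of_mem (by simpa using hx), tensor,
          ENNReal.ofReal_prod_of_nonneg fun j _ => (hq j).nonneg _]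
        exact Finset.prod_congr rfl fun j _ => by rw [Set.indicator_of_mem (hx j)]
      · rw [Set.indicator_of_notMem (by simpa using hx)]
        push Not at hx
        obtain ⟨j, hj⟩ := hx
        rw [Finset.prod_eq_zero (Finset.mem_univ j) (by rw [Set.indicator_of_notMem hj])]
    simp_rw [this]
    rw [lintegral_block_prod (fun j => (s j).indicator (fun y => ENNReal.ofReal (q j y)))
      fun j => ((hq j).aemeasurable.ennreal_ofReal).indicator (hs j)]
    refine Finset.prod_congr rfl fun j _ => ?_
    rw [lintegral_indicator (hs j), (hq j).eq_withDensity, withDensity_apply _ (hs j)]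
  rw [productLaw, ← key, Measure.map_map (MeasurableEquiv.measurable _)
    (MeasurableEquiv.measurable _)]
  simp

/-- Replacing the coordinates in `S` of an i.i.d. sample by those of an independent copy does not
change its law. -/
theorem measurePreserving_resample {n : ℕ} {E : Type*} [MeasurableSpace E] (P : Measure E)
    [IsProbabilityMeasure P] (S : Finset (Fin n)) :
    MeasurePreserving (fun z : (Fin n → E) × (Fin n → E) => S.piecewise z.1 z.2)
      ((Measure.pi fun _ => P).prod (Measure.pi fun _ => P)) (Measure.pi fun _ => P) := by
  have hm : Measurable (fun z : (Fin n → E) × (Fin n → E) => S.piecewise z.1 z.2) := by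
    refine measurable_pi_lambda _ fun i => ?_
    by_cases hi : i ∈ S
    · simp only [Finset.piecewise, hi, if_true]; fun_prop
    · simp only [Finset.piecewise, hi, if_false]; fun_prop
  refine ⟨hm, (Measure.pi_eq fun s hs => ?_).symm⟩
  rw [Measure.map_apply hm (MeasurableSet.univ_pi hs)]
  have : (fun z : (Fin n → E) × (Fin n → E) => S.piecewise z.1 z.2) ⁻¹' (Set.univ.pi s) =
      (Set.univ.pi (S.piecewise s fun _ => Set.univ)) ×ˢ
        (Set.univ.pi (S.piecewise (fun _ => Set.univ) s)) := by
    ext z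
    simp only [Set.mem_preimage, Set.mem_pi, Set.mem_univ, true_imp_iff, Set.mem_prod,
      Finset.piecewise, ← forall_and]
    refine forall_congr' fun i => ?_
    split_ifs <;> simp
  rw [this, Measure.prod_prod, Measure.pi_pi, Measure.pi_pi, ← Finset.prod_mul_distrib]
  refine Finset.prod_congr rfl fun i _ => ?_
  simp only [Finset.piecewise]
  split_ifs <;> simp

end Blocks

/-! ### Averages over tuples of distinct indices -/

section UAverage

theorem descFactorial_cast_pos {τ : Type} [Fintype τ] {n : ℕ} (h : Fintype.card τ ≤ n) :
    (0 : ℝ) < (n.descFactorial (Fintype.card τ) : ℝ) := by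
  exact_mod_cast Nat.descFactorial_pos.2 h

variable {α β τ : Type} [Fintype α] [DecidableEq α] [Fintype β] [DecidableEq β] [Fintype τ]
  [DecidableEq τ] {n : ℕ}

theorem uAverage_const (h : Fintype.card τ ≤ n) (c : ℝ) :
    uAverage (fun _ : τ ↪ Fin n => c) = c := by
  have := descFactorial_cast_pos h
  rw [uAverage, Finset.sum_const, nsmul_eq_mul, Finset.card_univ, Fintype.card_embedding_eq,
    Fintype.card_fin]
  field_simp

theorem uAverage_mono {f g : (τ ↪ Fin n) → ℝ} (h : ∀ e, f e ≤ g e) : uAverage f ≤ uAverage g :=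
  div_le_div_of_nonneg_right (Finset.sum_le_sum fun e _ => h e) (Nat.cast_nonneg _)

theorem uAverage_nonneg {f : (τ ↪ Fin n) → ℝ} (h : ∀ e, 0 ≤ f e) : 0 ≤ uAverage f :=
  div_nonneg (Finset.sum_nonneg fun e _ => h e) (Nat.cast_nonneg _)

theorem uAverage_add (f g : (τ ↪ Fin n) → ℝ) :
    uAverage (fun e => f e + g e) = uAverage f + uAverage g := by
  simp only [uAverage, Finset.sum_add_distrib, add_div]

theorem uAverage_sub (f g : (τ ↪ Fin n) → ℝ) :
    uAverage (fun e => f e - g e) = uAverage f - uAverage g := by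
  simp only [uAverage, Finset.sum_sub_distrib, sub_div]

theorem uAverage_mul_left (c : ℝ) (f : (τ ↪ Fin n) → ℝ) :
    uAverage (fun e => c * f e) = c * uAverage f := by
  simp only [uAverage, ← Finset.mul_sum, mul_div_assoc]

theorem uAverage_mul_right (c : ℝ) (f : (τ ↪ Fin n) → ℝ) :
    uAverage (fun e => f e * c) = uAverage f * c := by
  simp only [mul_comm _ c, uAverage_mul_left]

theorem uAverage_sum {ι : Type*} (s : Finset ι) (f : ι → (τ ↪ Fin n) → ℝ) :
    uAverage (fun e => ∑ i ∈ s, f i e) = ∑ i ∈ s, uAverage (f i) := by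
  simp only [uAverage]
  rw [Finset.sum_comm, Finset.sum_div]

theorem integral_uAverage {Ω : Type*} [MeasurableSpace Ω] {μ : Measure Ω}
    {f : (τ ↪ Fin n) → Ω → ℝ} (hf : ∀ e, Integrable (f e) μ) :
    ∫ ω, uAverage (fun e => f e ω) ∂μ = uAverage fun e => ∫ ω, f e ω ∂μ := by
  simp only [uAverage]
  rw [integral_div, integral_finsetSum _ fun e _ => hf e]

theorem integrable_uAverage {Ω : Type*} [MeasurableSpace Ω] {μ : Measure Ω}
    {f : (τ ↪ Fin n) → Ω → ℝ} (hf : ∀ e, Integrable (f e) μ) :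
    Integrable (fun ω => uAverage fun e => f e ω) μ :=
  (integrable_finsetSum _ fun e _ => hf e).div_const _

theorem uAverage_comp_equiv (g : α ≃ β) (f : (α ↪ Fin n) → ℝ) :
    uAverage (fun e : β ↪ Fin n => f (g.toEmbedding.trans e)) = uAverage f := by
  simp only [uAverage, Fintype.card_congr g]
  congr 1
  exact Fintype.sum_equiv (Equiv.embeddingCongr g.symm (Equiv.refl _)) _ _ fun e => rfl

theorem uAverage_comp_inl (h : Fintype.card α + Fintype.card β ≤ n) (f : (α ↪ Fin n) → ℝ) :
    uAverage (fun e : α ⊕ β ↪ Fin n => f (Function.Embedding.inl.trans e)) = uAverage f := by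
  classical
  have h1 : ∑ e : α ⊕ β ↪ Fin n, f (Function.Embedding.inl.trans e) =
      ∑ e : α ↪ Fin n, f e * ((n - Fintype.card α).descFactorial (Fintype.card β) : ℝ) := by
    rw [Fintype.sum_equiv Equiv.sumEmbeddingEquivSigmaEmbeddingRestricted
      (fun e : α ⊕ β ↪ Fin n => f (Function.Embedding.inl.trans e)) (fun x => f x.1)
      (fun e => rfl), Fintype.sum_sigma]
    refine Finset.sum_congr rfl fun e _ => ?_
    change ∑ _y, f e = _
    rw [Finset.sum_const, nsmul_eq_mul, Finset.card_univ, Fintype.card_embedding_eq, mul_comm]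
    congr 3
    rw [Fintype.card_compl_set, Fintype.card_fin, Set.card_range_of_injective e.injective]
  have h2 : n.descFactorial (Fintype.card (α ⊕ β)) =
      (n - Fintype.card α).descFactorial (Fintype.card β) *
        n.descFactorial (Fintype.card α) := by
    rw [Fintype.card_sum, add_comm]
    rw [Nat.descFactorial_eq_div (by omega), Nat.descFactorial_eq_div (by omega),
      Nat.descFactorial_eq_div (by omega)]
    have e1 := Nat.factorial_mul_descFactorial (n := n) (k := Fintype.card β + Fintype.card α)
      (by omega)
    have e2 := Nat.factorial_mul_descFactorial (n := n) (k := Fintype.card α) (by omega)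
    have e3 := Nat.factorial_mul_descFactorial (n := n - Fintype.card α) (k := Fintype.card β)
      (by omega)
    rw [Nat.descFactorial_eq_div (by omega)] at e1 e2 e3
    have e4 : n - Fintype.card α - Fintype.card β = n - (Fintype.card β + Fintype.card α) := by
      omega
    rw [e4] at e3 ⊢
    refine Nat.eq_of_mul_eq_mul_left (Nat.factorial_pos (n - (Fintype.card β + Fintype.card α))) ?_
    rw [e1, ← mul_assoc, e3, e2]
  have h3 : (0 : ℝ) < ((n - Fintype.card α).descFactorial (Fintype.card β) : ℝ) := by
    exact_mod_cast Nat.descFactorial_pos.2 (by omega)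
  rw [uAverage, uAverage, h1, h2, ← Finset.sum_mul]
  push_cast
  rw [mul_comm, mul_div_mul_left _ _ h3.ne']

/-- Averaging a function of a sub-tuple over all tuples is the same as averaging it over all
sub-tuples. -/
theorem uAverage_comp_embedding (h : Fintype.card β ≤ n) (g : α ↪ β) (f : (α ↪ Fin n) → ℝ) :
    uAverage (fun e : β ↪ Fin n => f (g.trans e)) = uAverage f := by
  classical
  let γ : Type := {b : β // b ∉ Set.range g}
  let E : α ⊕ γ ≃ β :=
    ((Equiv.ofInjective g g.injective).sumCongr (Equiv.refl γ)).trans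
      (Equiv.sumCompl fun b => b ∈ Set.range g)
  have hc : Fintype.card α + Fintype.card γ ≤ n := by
    rw [← Fintype.card_sum, Fintype.card_congr E]
    exact h
  rw [← uAverage_comp_inl (β := γ) hc f, ← uAverage_comp_equiv E]
  congr 1

theorem uAverage_indicator_le (h : Fintype.card τ ≤ n) (a : τ) (i : Fin n) :
    uAverage (fun e : τ ↪ Fin n => if e a = i then (1 : ℝ) else 0) ≤ 1 / n := by
  let g : Unit ↪ τ := ⟨fun _ => a, fun _ _ _ => rfl⟩
  have := uAverage_comp_embedding h g (fun e => if e () = i then (1 : ℝ) else 0)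
  change uAverage (fun e : τ ↪ Fin n => if e a = i then (1 : ℝ) else 0) = _ at this
  rw [this, uAverage, Finset.sum_boole]
  simp only [Fintype.card_unit, Nat.descFactorial_one]
  refine div_le_div_of_nonneg_right ?_ (Nat.cast_nonneg _)
  have : (Finset.univ.filter fun e : Unit ↪ Fin n => e () = i).card ≤ 1 := by
    refine Finset.card_le_one.2 fun e he e' he' => ?_
    ext ⟨⟩
    simp only [Finset.mem_filter, Finset.mem_univ, true_and] at he he'
    rw [he, he']
  exact_mod_cast this

theorem uAverage_indicator_pair_le (h : Fintype.card τ ≤ n) {a c : τ} (hac : a ≠ c)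
    (i j : Fin n) :
    uAverage (fun e : τ ↪ Fin n => if e a = i ∧ e c = j then (1 : ℝ) else 0) ≤
      1 / (n * (n - 1)) := by
  let g : Fin 2 ↪ τ := ⟨![a, c], by
    intro x y
    fin_cases x <;> fin_cases y <;> simp [hac, hac.symm]⟩
  have := uAverage_comp_embedding h g (fun e => if e 0 = i ∧ e 1 = j then (1 : ℝ) else 0)
  change uAverage (fun e : τ ↪ Fin n => if e a = i ∧ e c = j then (1 : ℝ) else 0) = _ at this
  have hn : 1 ≤ n := Fin.pos i
  rw [this, uAverage, Finset.sum_boole]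
  have hd : ((n.descFactorial (Fintype.card (Fin 2)) : ℕ) : ℝ) = n * (n - 1) := by
    simp only [Fintype.card_fin, Nat.descFactorial_succ, Nat.descFactorial_zero]
    push_cast [Nat.cast_sub hn]
    simp [mul_comm]
  rw [hd]
  have hn' : (1 : ℝ) ≤ n := by exact_mod_cast hn
  refine div_le_div_of_nonneg_right ?_ (mul_nonneg (Nat.cast_nonneg _) (by linarith))
  have : (Finset.univ.filter fun e : Fin 2 ↪ Fin n => e 0 = i ∧ e 1 = j).card ≤ 1 := by
    refine Finset.card_le_one.2 fun e he e' he' => ?_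
    simp only [Finset.mem_filter, Finset.mem_univ, true_and] at he he'
    ext x
    fin_cases x
    · simp [he.1, he'.1]
    · simp [he.2, he'.2]
  exact_mod_cast this

/-- The second moment of an average of uniformly square integrable variables is controlled by the
proportion of correlated pairs, counted with a weight `R` that is at least `1` on them. -/
theorem integral_uAverage_sq_le {Ω : Type*} [MeasurableSpace Ω] {μ : Measure Ω}
    {F : (τ ↪ Fin n) → Ω → ℝ} {D : ℝ} (hF : ∀ e e', Integrable (fun ω => F e ω * F e' ω) μ)
    (hD : ∀ e, ∫ ω, F e ω ^ 2 ∂μ ≤ D) (R : (τ ↪ Fin n) → (τ ↪ Fin n) → ℝ)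
    (hR : ∀ e e', 0 ≤ R e e')
    (h : ∀ e e', R e e' < 1 → ∫ ω, F e ω * F e' ω ∂μ = 0) :
    ∫ ω, (uAverage fun e => F e ω) ^ 2 ∂μ ≤ D * uAverage fun e' => uAverage fun e => R e e' := by
  have h1 : ∀ ω, (uAverage fun e => F e ω) ^ 2 =
      uAverage fun e' => uAverage fun e => F e ω * F e' ω := by
    intro ω
    simp only [uAverage_mul_right, uAverage_mul_left]
    rw [sq]
  simp only [h1]
  rw [integral_uAverage fun e' => integrable_uAverage fun e => hF e e', ← uAverage_mul_left]
  refine uAverage_mono fun e' => ?_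
  rw [integral_uAverage fun e => hF e e', ← uAverage_mul_left]
  refine uAverage_mono fun e => ?_
  have hD0 : 0 ≤ D := le_trans (integral_nonneg fun ω => sq_nonneg _) (hD e)
  rcases lt_or_ge (R e e') 1 with hlt | hge
  · rw [h e e' hlt]
    exact mul_nonneg hD0 (hR e e')
  · have hsq : ∀ e, Integrable (fun ω => F e ω ^ 2) μ := fun e => by
      simpa only [sq] using hF e e
    calc ∫ ω, F e ω * F e' ω ∂μ ≤ ∫ ω, (F e ω ^ 2 + F e' ω ^ 2) / 2 ∂μ := by
          refine integral_mono (hF e e') (((hsq e).add (hsq e')).div_const 2) fun ω => ?_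
          dsimp only
          nlinarith [sq_nonneg (F e ω - F e' ω)]
      _ = (∫ ω, F e ω ^ 2 ∂μ + ∫ ω, F e' ω ^ 2 ∂μ) / 2 := by
          rw [integral_div, integral_add (hsq e) (hsq e')]
      _ ≤ D := by linarith [hD e, hD e']
      _ ≤ D * R e e' := le_mul_of_one_le_right hD0 hge

/-- If tuples without common index are uncorrelated, the average has variance `O(1/n)`. -/
theorem integral_uAverage_sq_le_of_disjoint {Ω : Type*} [MeasurableSpace Ω] {μ : Measure Ω}
    {F : (τ ↪ Fin n) → Ω → ℝ} {D : ℝ} (hn : Fintype.card τ ≤ n) (hD0 : 0 ≤ D)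
    (hF : ∀ e e', Integrable (fun ω => F e ω * F e' ω) μ)
    (hD : ∀ e, ∫ ω, F e ω ^ 2 ∂μ ≤ D)
    (h : ∀ e e' : τ ↪ Fin n, (∀ a b, e a ≠ e' b) → ∫ ω, F e ω * F e' ω ∂μ = 0) :
    ∫ ω, (uAverage fun e => F e ω) ^ 2 ∂μ ≤ (Fintype.card τ) ^ 2 * D / n := by
  -- the weight is the number of common indices
  refine (integral_uAverage_sq_le hF hD
    (fun e e' => ∑ a, ∑ b, if e a = e' b then (1 : ℝ) else 0)
    (fun e e' => Finset.sum_nonneg fun a _ => Finset.sum_nonneg fun b _ => by positivity)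
    fun e e' hR => h e e' fun a b hab => ?_).trans ?_
  · refine absurd hR (not_lt.2 ?_)
    refine le_trans ?_ (Finset.single_le_sum (fun a _ => Finset.sum_nonneg fun b _ => by
      positivity) (Finset.mem_univ a))
    refine le_trans ?_ (Finset.single_le_sum (fun b _ => by positivity) (Finset.mem_univ b))
    rw [if_pos hab]
  · have : (uAverage fun e' : τ ↪ Fin n => uAverage fun e : τ ↪ Fin n =>
        ∑ a, ∑ b, if e a = e' b then (1 : ℝ) else 0) ≤ (Fintype.card τ) ^ 2 * (1 / n) := by
      rw [← uAverage_const hn ((Fintype.card τ : ℝ) ^ 2 * (1 / n))]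
      refine uAverage_mono fun e' => ?_
      simp only [uAverage_sum]
      refine (Finset.sum_le_sum fun a _ => Finset.sum_le_sum fun b _ =>
        uAverage_indicator_le hn a (e' b)).trans (le_of_eq ?_)
      simp only [Finset.sum_const, Finset.card_univ, nsmul_eq_mul]
      ring
    refine (mul_le_mul_of_nonneg_left this hD0).trans (le_of_eq (by ring))

/-- If tuples with at most one common index are uncorrelated, the average has
variance `O(1/n²)`. -/
theorem integral_uAverage_sq_le_of_degenerate {Ω : Type*} [MeasurableSpace Ω] {μ : Measure Ω}
    {F : (τ ↪ Fin n) → Ω → ℝ} {D : ℝ} (hn : Fintype.card τ ≤ n) (hn2 : 2 ≤ n) (hD0 : 0 ≤ D)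
    (hF : ∀ e e', Integrable (fun ω => F e ω * F e' ω) μ)
    (hD : ∀ e, ∫ ω, F e ω ^ 2 ∂μ ≤ D)
    (h : ∀ e e' : τ ↪ Fin n, (∀ a b c d, a ≠ c → ¬ (e a = e' b ∧ e c = e' d)) →
      ∫ ω, F e ω * F e' ω ∂μ = 0) :
    ∫ ω, (uAverage fun e => F e ω) ^ 2 ∂μ ≤ 2 * (Fintype.card τ) ^ 4 * D / n ^ 2 := by
  have hn' : (2 : ℝ) ≤ n := by exact_mod_cast hn2
  have hp : (0 : ℝ) < n * (n - 1) := mul_pos (by linarith) (by linarith)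
  -- the weight is the number of ordered pairs of common indices
  refine (integral_uAverage_sq_le hF hD
    (fun e e' => ∑ a, ∑ b, ∑ c, ∑ d,
      if a ≠ c then (if e a = e' b ∧ e c = e' d then (1 : ℝ) else 0) else 0)
    (fun e e' => Finset.sum_nonneg fun a _ => Finset.sum_nonneg fun b _ =>
      Finset.sum_nonneg fun c _ => Finset.sum_nonneg fun d _ => by positivity)
    fun e e' hR => h e e' fun a b c d hac hab => ?_).trans ?_
  · refine absurd hR (not_lt.2 ?_)
    refine le_trans ?_ (Finset.single_le_sum (fun a _ => Finset.sum_nonneg fun b _ =>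
      Finset.sum_nonneg fun c _ => Finset.sum_nonneg fun d _ => by positivity)
      (Finset.mem_univ a))
    refine le_trans ?_ (Finset.single_le_sum (fun b _ =>
      Finset.sum_nonneg fun c _ => Finset.sum_nonneg fun d _ => by positivity)
      (Finset.mem_univ b))
    refine le_trans ?_ (Finset.single_le_sum (fun c _ =>
      Finset.sum_nonneg fun d _ => by positivity) (Finset.mem_univ c))
    refine le_trans ?_ (Finset.single_le_sum (fun d _ => by positivity) (Finset.mem_univ d))
    rw [if_pos hac, if_pos hab]
  · have : (uAverage fun e' : τ ↪ Fin n => uAverage fun e : τ ↪ Fin n =>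
        ∑ a, ∑ b, ∑ c, ∑ d,
          if a ≠ c then (if e a = e' b ∧ e c = e' d then (1 : ℝ) else 0) else 0) ≤
        (Fintype.card τ) ^ 4 * (1 / (n * (n - 1))) := by
      rw [← uAverage_const hn ((Fintype.card τ : ℝ) ^ 4 * (1 / (n * (n - 1))))]
      refine uAverage_mono fun e' => ?_
      simp only [uAverage_sum]
      have key : ∀ a b c d, (uAverage fun e : τ ↪ Fin n =>
          if a ≠ c then (if e a = e' b ∧ e c = e' d then (1 : ℝ) else 0) else 0) ≤
          1 / (n * (n - 1)) := by
        intro a b c d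
        by_cases hac : a ≠ c
        · simp only [if_pos hac]
          exact uAverage_indicator_pair_le hn hac _ _
        · simp only [if_neg hac, uAverage_const hn]
          positivity
      refine (Finset.sum_le_sum fun a _ => Finset.sum_le_sum fun b _ =>
        Finset.sum_le_sum fun c _ => Finset.sum_le_sum fun d _ => key a b c d).trans
        (le_of_eq ?_)
      simp only [Finset.sum_const, Finset.card_univ, nsmul_eq_mul]
      ring
    refine (mul_le_mul_of_nonneg_left this hD0).trans ?_
    have h3 : (1 : ℝ) / (n * (n - 1)) ≤ 2 / n ^ 2 := by
      rw [div_le_div_iff₀ hp (by positivity)]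
      nlinarith
    calc D * ((Fintype.card τ : ℝ) ^ 4 * (1 / (n * (n - 1))))
        ≤ D * ((Fintype.card τ : ℝ) ^ 4 * (2 / n ^ 2)) := by gcongr
      _ = _ := by ring

end UAverage

/-! ### Mean embeddings in a Hilbert space -/

theorem sq_integral_mul_le {Ω : Type*} [MeasurableSpace Ω] {μ : Measure Ω} {f g : Ω → ℝ}
    (hf : Integrable (fun x => f x ^ 2) μ) (hg : Integrable (fun x => g x ^ 2) μ)
    (hfg : Integrable (fun x => f x * g x) μ) :
    (∫ x, f x * g x ∂μ) ^ 2 ≤ (∫ x, f x ^ 2 ∂μ) * ∫ x, g x ^ 2 ∂μ := by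
  have key : ∀ t : ℝ, 0 ≤ (∫ x, g x ^ 2 ∂μ) * (t * t) + (2 * ∫ x, f x * g x ∂μ) * t +
      ∫ x, f x ^ 2 ∂μ := by
    intro t
    have h1 : ∫ x, (f x + t * g x) ^ 2 ∂μ = (∫ x, g x ^ 2 ∂μ) * (t * t) +
        (2 * ∫ x, f x * g x ∂μ) * t + ∫ x, f x ^ 2 ∂μ := by
      have : ∀ x, (f x + t * g x) ^ 2 = f x ^ 2 + (2 * t) * (f x * g x) + (t * t) * g x ^ 2 :=
        fun x => by ring
      simp only [this]
      have h12 : Integrable (fun x => f x ^ 2 + (2 * t) * (f x * g x)) μ :=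
        hf.add (hfg.const_mul _)
      rw [integral_add h12 (hg.const_mul _), integral_add hf (hfg.const_mul _),
        integral_const_mul, integral_const_mul]
      ring
    rw [← h1]
    exact integral_nonneg fun x => sq_nonneg _
  have := discrim_le_zero key
  rw [discrim] at this
  nlinarith

section Hilbert

variable {H : Type} [NormedAddCommGroup H] [InnerProductSpace ℝ H] [CompleteSpace H]

/-- For a feature map `φ` the quadratic form `h ↦ ∫ ⟪φ x, h⟫² dP` is bounded by the
Hilbert-Schmidt norm of its covariance operator. -/
theorem integral_inner_sq_le {E : Type*} [MeasurableSpace E] (P : Measure E)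
    [IsFiniteMeasure P] {φ : E → H} (hφ : StronglyMeasurable φ) {C : ℝ} (hC : ∀ x, ‖φ x‖ ≤ C)
    (h : H) :
    ∫ x, (inner ℝ (φ x) h) ^ 2 ∂P ≤
      ‖h‖ ^ 2 * √(∫ x, ∫ y, (inner ℝ (φ x) (φ y)) ^ 2 ∂P ∂P) := by
  -- With `w = ∫ ⟪φ x, h⟫ φ x` the left side is `S = ⟪w, h⟫`, and `‖w‖² ≤ S √B` by the
  -- Cauchy-Schwarz inequality on the product space; a factor `S` cancels from `S² ≤ ‖w‖² ‖h‖²`.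
  set f : E → ℝ := fun x => inner ℝ (φ x) h with hf
  have hfm : StronglyMeasurable f := hφ.inner stronglyMeasurable_const
  have hfb : ∀ x, ‖f x‖ ≤ C * ‖h‖ := fun x =>
    (norm_inner_le_norm _ _).trans (mul_le_mul_of_nonneg_right (hC x) (norm_nonneg _))
  set K : E × E → ℝ := fun z => inner ℝ (φ z.1) (φ z.2) with hK
  have hKm : StronglyMeasurable K :=
    (hφ.comp_measurable measurable_fst).inner (hφ.comp_measurable measurable_snd)
  have hKb : ∀ z, ‖K z‖ ≤ C * C := fun z =>
    (norm_inner_le_norm _ _).trans (mul_le_mul (hC _) (hC _) (norm_nonneg _)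
      ((norm_nonneg _).trans (hC z.1)))
  have hfφ : Integrable (fun x => f x • φ x) P := by
    refine Integrable.of_bound (hfm.smul hφ).aestronglyMeasurable (C * ‖h‖ * C)
      (Eventually.of_forall fun x => ?_)
    rw [norm_smul]
    exact mul_le_mul (hfb x) (hC x) (norm_nonneg _) ((norm_nonneg _).trans (hfb x))
  set w : H := ∫ x, f x • φ x ∂P with hw
  set S : ℝ := ∫ x, f x ^ 2 ∂P with hS
  set B : ℝ := ∫ x, ∫ y, (inner ℝ (φ x) (φ y)) ^ 2 ∂P ∂P with hB
  have hS0 : 0 ≤ S := integral_nonneg fun x => sq_nonneg _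
  have hB0 : 0 ≤ B := integral_nonneg fun x => integral_nonneg fun y => sq_nonneg _
  have hwh : inner ℝ w h = S := by
    rw [hw, ← real_inner_comm, ← integral_inner hfφ h]
    refine integral_congr_ae (Eventually.of_forall fun x => ?_)
    change inner ℝ h (f x • φ x) = f x ^ 2
    rw [real_inner_smul_right, real_inner_comm, sq]
  have hff : StronglyMeasurable fun z : E × E => f z.1 * f z.2 :=
    (hfm.comp_measurable measurable_fst).mul (hfm.comp_measurable measurable_snd)
  have hffb : ∀ z : E × E, ‖f z.1 * f z.2‖ ≤ C * ‖h‖ * (C * ‖h‖) := fun z => by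
    rw [norm_mul]
    exact mul_le_mul (hfb _) (hfb _) (norm_nonneg _) ((norm_nonneg _).trans (hfb z.1))
  have hbsq : ∀ {a b : ℝ}, ‖a‖ ≤ b → ‖a ^ 2‖ ≤ b ^ 2 := fun {a b} hab => by
    rw [norm_pow]; exact pow_le_pow_left₀ (norm_nonneg _) hab 2
  have i1 : Integrable (fun z : E × E => (f z.1 * f z.2) ^ 2) (P.prod P) :=
    Integrable.of_bound (hff.pow 2).aestronglyMeasurable _
      (Eventually.of_forall fun z => hbsq (hffb z))
  have i2 : Integrable (fun z : E × E => K z ^ 2) (P.prod P) :=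
    Integrable.of_bound (hKm.pow 2).aestronglyMeasurable _
      (Eventually.of_forall fun z => hbsq (hKb z))
  have i3 : Integrable (fun z : E × E => f z.1 * f z.2 * K z) (P.prod P) :=
    Integrable.of_bound (hff.mul hKm).aestronglyMeasurable
      (C * ‖h‖ * (C * ‖h‖) * (C * C)) (Eventually.of_forall fun z => by
        rw [norm_mul]
        exact mul_le_mul (hffb z) (hKb z) (norm_nonneg _) ((norm_nonneg _).trans (hffb z)))
  have hww : ‖w‖ ^ 2 = ∫ z, f z.1 * f z.2 * K z ∂(P.prod P) := by
    rw [integral_prod _ i3, ← real_inner_self_eq_norm_sq]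
    conv_lhs => rw [hw]
    rw [← real_inner_comm, ← integral_inner hfφ]
    refine integral_congr_ae (Eventually.of_forall fun x => ?_)
    dsimp only
    rw [real_inner_smul_right, real_inner_comm, ← integral_inner hfφ, ← integral_const_mul]
    refine integral_congr_ae (Eventually.of_forall fun y => ?_)
    dsimp only
    rw [real_inner_smul_right, hK]
    ring
  have hcs := sq_integral_mul_le i1 i2 i3
  rw [← hww] at hcs
  have e1 : ∫ z : E × E, (f z.1 * f z.2) ^ 2 ∂(P.prod P) = S * S := by
    simp only [mul_pow]
    exact integral_prod_mul (fun x => f x ^ 2) (fun x => f x ^ 2)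
  have e2 : ∫ z : E × E, K z ^ 2 ∂(P.prod P) = B := integral_prod _ i2
  rw [e1, e2] at hcs
  have h1 : ‖w‖ ^ 2 ≤ S * √B := by
    refine abs_le_of_sq_le_sq' ?_ (mul_nonneg hS0 (Real.sqrt_nonneg _)) |>.2
    rw [mul_pow, Real.sq_sqrt hB0]
    linarith
  have h2 : S ^ 2 ≤ ‖w‖ ^ 2 * ‖h‖ ^ 2 := by
    rw [← hwh, ← mul_pow]
    exact sq_le_sq' (by linarith [neg_abs_le (inner ℝ w h : ℝ), abs_real_inner_le_norm w h])
      (real_inner_le_norm w h)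
  rcases hS0.eq_or_lt with h0 | h0
  · rw [← h0]
    positivity
  · have h3 : S * S ≤ S * (‖h‖ ^ 2 * √B) := by
      nlinarith [mul_le_mul_of_nonneg_right h1 (sq_nonneg ‖h‖)]
    exact le_of_mul_le_mul_left h3 h0

/-- Centering does not increase the second moment. -/
theorem integral_inner_sub_mean_sq_le {Ω : Type*} [MeasurableSpace Ω] (μ : Measure Ω)
    [IsProbabilityMeasure μ] {ξ : Ω → H} (hξ : StronglyMeasurable ξ) {C : ℝ}
    (hC : ∀ x, ‖ξ x‖ ≤ C) (v : H) :
    ∫ x, (inner ℝ (ξ x - ∫ y, ξ y ∂μ) v) ^ 2 ∂μ ≤ ∫ x, (inner ℝ (ξ x) v) ^ 2 ∂μ := by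
  have hint : Integrable ξ μ := Integrable.of_bound hξ.aestronglyMeasurable C
    (Eventually.of_forall hC)
  set m := ∫ y, ξ y ∂μ with hm
  have i1 : Integrable (fun x => (inner ℝ (ξ x) v : ℝ)) μ := hint.inner_const v
  have i2 : Integrable (fun x => (inner ℝ (ξ x) v : ℝ) ^ 2) μ := by
    refine Integrable.of_bound ((hξ.inner stronglyMeasurable_const).pow 2).aestronglyMeasurable
      ((C * ‖v‖) ^ 2) (Eventually.of_forall fun x => ?_)
    rw [norm_pow]
    exact pow_le_pow_left₀ (norm_nonneg _) ((norm_inner_le_norm _ _).trans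
      (mul_le_mul_of_nonneg_right (hC x) (norm_nonneg _))) 2
  have e1 : ∫ x, (inner ℝ (ξ x) v : ℝ) ∂μ = inner ℝ m v := by
    rw [hm, real_inner_comm, ← integral_inner hint v]
    exact integral_congr_ae (Eventually.of_forall fun x => real_inner_comm _ _)
  have e2 : ∀ x, (inner ℝ (ξ x - m) v : ℝ) ^ 2 =
      (inner ℝ (ξ x) v : ℝ) ^ 2 - (2 * inner ℝ m v) * inner ℝ (ξ x) v + (inner ℝ m v) ^ 2 := by
    intro x
    rw [inner_sub_left]
    ring
  simp only [e2]
  have i3 : Integrable (fun x => (inner ℝ (ξ x) v : ℝ) ^ 2 -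
      (2 * inner ℝ m v) * inner ℝ (ξ x) v) μ := i2.sub (i1.const_mul _)
  rw [integral_add i3 (integrable_const _), integral_sub i2 (i1.const_mul _),
    integral_const_mul, e1, integral_const]
  simp only [probReal_univ, one_smul]
  nlinarith [sq_nonneg (inner ℝ m v : ℝ)]

end Hilbert

/-! ### The variance of the discrepancy estimate -/

theorem integral_resample {n : ℕ} {E : Type*} [MeasurableSpace E] (P : Measure E)
    [IsProbabilityMeasure P] (S : Finset (Fin n)) {G : Type*} [NormedAddCommGroup G]
    [NormedSpace ℝ G] {f : (Fin n → E) → G} (hf : StronglyMeasurable f) :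
    ∫ X, f X ∂(Measure.pi fun _ => P) =
      ∫ z : (Fin n → E) × (Fin n → E), f (S.piecewise z.1 z.2)
        ∂((Measure.pi fun _ => P).prod (Measure.pi fun _ => P)) := by
  have h := measurePreserving_resample P S
  conv_lhs => rw [← h.map_eq]
  exact integral_map h.measurable.aemeasurable hf.aestronglyMeasurable

/-- Functions of disjoint groups of observations are independent. -/
theorem measurePreserving_pair {n : ℕ} {E E₁ E₂ : Type*} [MeasurableSpace E] [MeasurableSpace E₁]
    [MeasurableSpace E₂] {P : Measure E} [IsProbabilityMeasure P] {P₁ : Measure E₁}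
    {P₂ : Measure E₂} [SigmaFinite P₁] [SigmaFinite P₂]
    {U : (Fin n → E) → E₁} {V : (Fin n → E) → E₂}
    (hU : MeasurePreserving U (Measure.pi fun _ => P) P₁)
    (hV : MeasurePreserving V (Measure.pi fun _ => P) P₂) (S : Finset (Fin n))
    (hUS : ∀ x y, U (S.piecewise y x) = U y) (hVS : ∀ x y, V (S.piecewise y x) = V x) :
    MeasurePreserving (fun X => (U X, V X)) (Measure.pi fun _ => P) (P₁.prod P₂) := by
  refine ⟨hU.measurable.prodMk hV.measurable, ?_⟩
  have h := measurePreserving_resample P S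
  conv_lhs => rw [← h.map_eq]
  rw [Measure.map_map (hU.measurable.prodMk hV.measurable) h.measurable, ← (hU.prod hV).map_eq]
  congr 1
  ext z
  · simp only [Function.comp_apply, hUS, Prod.map_fst]
  · simp only [Function.comp_apply, hVS, Prod.map_snd]

section Contrast

variable {k : ℕ} {d : Fin k → ℕ} {n : ℕ} {H : Type} [NormedAddCommGroup H]

/-- The difference between the feature of one observation and the feature of the vector whose
blocks are taken from `k` further observations. -/
def contrast (φ : Joint d → H) (e : Unit ⊕ Fin k ↪ Fin n) (X : Fin n → Joint d) : H :=
  φ (X (e (Sum.inl ()))) - φ (mix X fun j => e (Sum.inr j))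

theorem mix_piecewise_left (S : Finset (Fin n)) (x y : Fin n → Joint d) (i : Fin k → Fin n)
    (h : ∀ j, i j ∈ S) : mix (S.piecewise y x) i = mix y i := by
  simp [mix, h]

theorem mix_piecewise_right (S : Finset (Fin n)) (x y : Fin n → Joint d) (i : Fin k → Fin n)
    (h : ∀ j, i j ∉ S) : mix (S.piecewise y x) i = mix x i := by
  simp [mix, h]

theorem contrast_piecewise_left (φ : Joint d → H) (e : Unit ⊕ Fin k ↪ Fin n)
    (S : Finset (Fin n)) (x y : Fin n → Joint d) (h : ∀ a, e a ∈ S) :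
    contrast φ e (S.piecewise y x) = contrast φ e y := by
  rw [contrast, contrast, mix_piecewise_left _ _ _ _ fun j => h _, Finset.piecewise_eq_of_mem _ _ _
    (h _)]

theorem contrast_piecewise_right (φ : Joint d → H) (e : Unit ⊕ Fin k ↪ Fin n)
    (S : Finset (Fin n)) (x y : Fin n → Joint d) (h : ∀ a, e a ∉ S) :
    contrast φ e (S.piecewise y x) = contrast φ e x := by
  rw [contrast, contrast, mix_piecewise_right _ _ _ _ fun j => h _,
    Finset.piecewise_eq_of_notMem _ _ _ (h _)]

theorem stronglyMeasurable_contrast {φ : Joint d → H} (hφ : StronglyMeasurable φ)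
    (e : Unit ⊕ Fin k ↪ Fin n) : StronglyMeasurable (contrast φ e) :=
  (hφ.comp_measurable (measurable_pi_apply (e (Sum.inl ())))).sub
    (hφ.comp_measurable (measurable_mix fun j => e (Sum.inr j)))

theorem norm_contrast_le {φ : Joint d → H} (hφ1 : ∀ x, ‖φ x‖ ≤ 1)
    (e : Unit ⊕ Fin k ↪ Fin n) (X : Fin n → Joint d) : ‖contrast φ e X‖ ≤ 2 :=
  (norm_sub_le_of_le (hφ1 _) (hφ1 _)).trans (by norm_num)

variable [InnerProductSpace ℝ H]

/-- The difference of the mean embeddings of `P` and of the product of its marginals. -/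
def meanContrast (φ : Joint d → H) (P : Measure (Joint d)) : H :=
  ∫ x, φ x ∂P - ∫ x, φ x ∂(productLaw P)

theorem injective_inr (e : Unit ⊕ Fin k ↪ Fin n) :
    Function.Injective fun j => e (Sum.inr j) := fun _ _ h => Sum.inr_injective (e.injective h)

theorem integral_contrast {φ : Joint d → H} (hφ : StronglyMeasurable φ) (hφ1 : ∀ x, ‖φ x‖ ≤ 1)
    (P : Measure (Joint d)) [IsProbabilityMeasure P] (e : Unit ⊕ Fin k ↪ Fin n) :
    ∫ X, contrast φ e X ∂(Measure.pi fun _ => P) = meanContrast φ P := by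
  have h1 := measurePreserving_eval (fun _ : Fin n => P) (e (Sum.inl ()))
  have h2 := measurePreserving_mix P _ (injective_inr e)
  unfold contrast meanContrast
  rw [integral_sub]
  · congr 1
    · conv_rhs => rw [← h1.map_eq]
      rw [integral_map h1.measurable.aemeasurable hφ.aestronglyMeasurable]
    · conv_rhs => rw [← h2.map_eq]
      rw [integral_map h2.measurable.aemeasurable hφ.aestronglyMeasurable]
  · exact Integrable.of_bound (hφ.comp_measurable
      (measurable_pi_apply (e (Sum.inl ())))).aestronglyMeasurable 1
      (Eventually.of_forall fun x => hφ1 _)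
  · exact Integrable.of_bound (hφ.comp_measurable
      (measurable_mix fun j => e (Sum.inr j))).aestronglyMeasurable 1
      (Eventually.of_forall fun x => hφ1 _)

theorem norm_meanContrast_le {φ : Joint d → H} (hφ1 : ∀ x, ‖φ x‖ ≤ 1)
    (P : Measure (Joint d)) [IsProbabilityMeasure P] : ‖meanContrast φ P‖ ≤ 2 := by
  refine (norm_sub_le _ _).trans ?_
  have h : ∀ (ρ : Measure (Joint d)) [IsProbabilityMeasure ρ],
      ‖∫ x, φ x ∂ρ‖ ≤ 1 := fun ρ _ => by
    simpa using norm_integral_le_of_norm_le_const (μ := ρ) (Eventually.of_forall hφ1)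
  linarith [h P, h (productLaw P)]

theorem integral_inner_sq_pair_le {φ : Joint d → H} (hφ : StronglyMeasurable φ)
    (hφ1 : ∀ x, ‖φ x‖ ≤ 1) {P : Measure (Joint d)} [IsProbabilityMeasure P]
    {P₁ P₂ : Measure (Joint d)} [IsProbabilityMeasure P₁] [IsProbabilityMeasure P₂]
    {U V : (Fin n → Joint d) → Joint d}
    (hU : MeasurePreserving U (Measure.pi fun _ => P) P₁)
    (hV : MeasurePreserving V (Measure.pi fun _ => P) P₂) (S : Finset (Fin n))
    (hUS : ∀ x y, U (S.piecewise y x) = U y) (hVS : ∀ x y, V (S.piecewise y x) = V x) {B : ℝ}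
    (hB : ∫ x, ∫ y, (inner ℝ (φ x) (φ y)) ^ 2 ∂P₂ ∂P₁ ≤ B) :
    Integrable (fun X => (inner ℝ (φ (U X)) (φ (V X)) : ℝ) ^ 2) (Measure.pi fun _ => P) ∧
    ∫ X, (inner ℝ (φ (U X)) (φ (V X))) ^ 2 ∂(Measure.pi fun _ => P) ≤ B := by
  have h := measurePreserving_pair hU hV S hUS hVS
  have hf : StronglyMeasurable fun z : Joint d × Joint d =>
      (inner ℝ (φ z.1) (φ z.2) : ℝ) ^ 2 :=
    ((hφ.comp_measurable measurable_fst).inner (hφ.comp_measurable measurable_snd)).pow 2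
  have hb : ∀ z : Joint d × Joint d, ‖(inner ℝ (φ z.1) (φ z.2) : ℝ) ^ 2‖ ≤ (1 * 1) ^ 2 :=
    fun z => by
    rw [norm_pow]
    exact pow_le_pow_left₀ (norm_nonneg _) ((norm_inner_le_norm _ _).trans
      (mul_le_mul (hφ1 _) (hφ1 _) (norm_nonneg _) zero_le_one)) 2
  constructor
  · exact Integrable.of_bound (hf.comp_measurable h.measurable).aestronglyMeasurable ((1 * 1) ^ 2)
      (Eventually.of_forall fun x => hb (U x, V x))
  · have e1 := integral_map (μ := Measure.pi fun _ => P) h.measurable.aemeasurable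
      (f := fun z : Joint d × Joint d =>
      (inner ℝ (φ z.1) (φ z.2) : ℝ) ^ 2) hf.aestronglyMeasurable
    rw [h.map_eq, integral_prod _ (Integrable.of_bound hf.aestronglyMeasurable _
      (Eventually.of_forall hb))] at e1
    exact e1.symm.le.trans hB

variable [CompleteSpace H]

/-- A centered contrast is orthogonal in mean to every variable that does not involve its
observations. -/
theorem integral_inner_contrast_eq_zero {φ : Joint d → H} (hφ : StronglyMeasurable φ)
    (hφ1 : ∀ x, ‖φ x‖ ≤ 1) (P : Measure (Joint d)) [IsProbabilityMeasure P]
    (e : Unit ⊕ Fin k ↪ Fin n) {V : (Fin n → Joint d) → H} (hV : StronglyMeasurable V) {C : ℝ}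
    (hC : ∀ X, ‖V X‖ ≤ C)
    (hVS : ∀ x y, V ((Finset.univ.map e).piecewise y x) = V x) :
    ∫ X, inner ℝ (contrast φ e X - meanContrast φ P) (V X) ∂(Measure.pi fun _ => P) = 0 := by
  have hζ := (stronglyMeasurable_contrast hφ e).sub
    (stronglyMeasurable_const (b := meanContrast φ P))
  have hζb : ∀ X, ‖contrast φ e X - meanContrast φ P‖ ≤ 4 := fun X =>
    (norm_sub_le _ _).trans (by linarith [norm_contrast_le hφ1 e X, norm_meanContrast_le hφ1 P])
  rw [integral_resample P (Finset.univ.map e) (hζ.inner hV)]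
  simp only [hVS]
  simp only [contrast_piecewise_left φ e _ _ _ fun a => Finset.mem_map_of_mem e (Finset.mem_univ a)]
  rw [integral_prod_symm]
  · refine integral_eq_zero_of_ae (Eventually.of_forall fun x => ?_)
    have hi : Integrable (contrast φ e) (Measure.pi fun _ => P) :=
      Integrable.of_bound (stronglyMeasurable_contrast hφ e).aestronglyMeasurable 2
        (Eventually.of_forall fun X => norm_contrast_le hφ1 e X)
    have hi' : Integrable (fun X => contrast φ e X - meanContrast φ P)
      (Measure.pi fun _ => P) := hi.sub (integrable_const _)
    dsimp only
    simp only [real_inner_comm (V x)]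
    rw [integral_inner hi', integral_sub hi (integrable_const _), integral_contrast hφ hφ1]
    simp
  · refine Integrable.of_bound (StronglyMeasurable.aestronglyMeasurable ?_) (4 * C)
      (Eventually.of_forall fun z => ?_)
    · exact (hζ.comp_measurable measurable_fst).inner (hV.comp_measurable measurable_snd)
    · exact (norm_inner_le_norm _ _).trans
        (mul_le_mul (hζb _) (hC _) (norm_nonneg _) (by norm_num))

theorem integral_contrast_inner_sq_le {φ : Joint d → H} (hφ : StronglyMeasurable φ)
    (hφ1 : ∀ x, ‖φ x‖ ≤ 1) (P : Measure (Joint d)) [IsProbabilityMeasure P]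
    (e : Unit ⊕ Fin k ↪ Fin n) (h : H) {B : ℝ}
    (hPP : ∫ x, ∫ y, (inner ℝ (φ x) (φ y)) ^ 2 ∂P ∂P ≤ B)
    (hQQ : ∫ x, ∫ y, (inner ℝ (φ x) (φ y)) ^ 2 ∂(productLaw P) ∂(productLaw P) ≤ B) :
    ∫ X, (inner ℝ (contrast φ e X) h) ^ 2 ∂(Measure.pi fun _ => P) ≤ 4 * (‖h‖ ^ 2 * √B) := by
  have h1 := measurePreserving_eval (fun _ : Fin n => P) (e (Sum.inl ()))
  have h2 := measurePreserving_mix P _ (injective_inr e)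
  have hf : StronglyMeasurable fun x => (inner ℝ (φ x) h : ℝ) ^ 2 :=
    (hφ.inner stronglyMeasurable_const).pow 2
  have hb : ∀ x, ‖(inner ℝ (φ x) h : ℝ) ^ 2‖ ≤ (1 * ‖h‖) ^ 2 := fun x => by
    rw [norm_pow]
    exact pow_le_pow_left₀ (norm_nonneg _) ((norm_inner_le_norm _ _).trans
      (mul_le_mul_of_nonneg_right (hφ1 x) (norm_nonneg _))) 2
  have i1 : Integrable (fun X : Fin n → Joint d =>
      (inner ℝ (φ (X (e (Sum.inl ())))) h : ℝ) ^ 2) (Measure.pi fun _ => P) :=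
    Integrable.of_bound (hf.comp_measurable
      (measurable_pi_apply (e (Sum.inl ())))).aestronglyMeasurable _
      (Eventually.of_forall fun x => hb _)
  have i2 : Integrable (fun X : Fin n → Joint d =>
      (inner ℝ (φ (mix X fun j => e (Sum.inr j))) h : ℝ) ^ 2) (Measure.pi fun _ => P) :=
    Integrable.of_bound (hf.comp_measurable
      (measurable_mix fun j => e (Sum.inr j))).aestronglyMeasurable _
      (Eventually.of_forall fun x => hb _)
  have e1 : ∫ X : Fin n → Joint d, (inner ℝ (φ (X (e (Sum.inl ())))) h : ℝ) ^ 2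
      ∂(Measure.pi fun _ => P) ≤ ‖h‖ ^ 2 * √B := by
    rw [← integral_map (φ := fun X : Fin n → Joint d => X (e (Sum.inl ())))
      (f := fun x => (inner ℝ (φ x) h : ℝ) ^ 2) h1.measurable.aemeasurable
      hf.aestronglyMeasurable]
    have := h1.map_eq
    change Measure.map (fun X : Fin n → Joint d => X (e (Sum.inl ()))) _ = P at this
    rw [this]
    refine (integral_inner_sq_le P hφ hφ1 h).trans ?_
    gcongr
  have e2 : ∫ X : Fin n → Joint d, (inner ℝ (φ (mix X fun j => e (Sum.inr j))) h : ℝ) ^ 2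
      ∂(Measure.pi fun _ => P) ≤ ‖h‖ ^ 2 * √B := by
    rw [← integral_map (φ := fun X : Fin n → Joint d => mix X fun j => e (Sum.inr j))
      (f := fun x => (inner ℝ (φ x) h : ℝ) ^ 2) h2.measurable.aemeasurable
      hf.aestronglyMeasurable, h2.map_eq]
    refine (integral_inner_sq_le _ hφ hφ1 h).trans ?_
    gcongr
  calc ∫ X, (inner ℝ (contrast φ e X) h) ^ 2 ∂(Measure.pi fun _ => P)
      ≤ ∫ X : Fin n → Joint d, (2 * (inner ℝ (φ (X (e (Sum.inl ())))) h : ℝ) ^ 2 +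
          2 * (inner ℝ (φ (mix X fun j => e (Sum.inr j))) h : ℝ) ^ 2)
          ∂(Measure.pi fun _ => P) := by
        refine integral_mono_of_nonneg (Eventually.of_forall fun X => sq_nonneg _)
          ((i1.const_mul 2).add (i2.const_mul 2)) (Eventually.of_forall fun X => ?_)
        dsimp only
        rw [contrast, inner_sub_left]
        nlinarith [sq_nonneg ((inner ℝ (φ (X (e (Sum.inl ())))) h : ℝ) +
          inner ℝ (φ (mix X fun j => e (Sum.inr j))) h)]
    _ = 2 * ∫ X : Fin n → Joint d, (inner ℝ (φ (X (e (Sum.inl ())))) h : ℝ) ^ 2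
          ∂(Measure.pi fun _ => P) +
        2 * ∫ X : Fin n → Joint d, (inner ℝ (φ (mix X fun j => e (Sum.inr j))) h : ℝ) ^ 2
          ∂(Measure.pi fun _ => P) := by
        rw [integral_add (i1.const_mul 2) (i2.const_mul 2), integral_const_mul,
          integral_const_mul]
    _ ≤ 4 * (‖h‖ ^ 2 * √B) := by linarith

/-- The second moment of the inner product of two centered contrasts without common observation. -/
theorem integral_inner_centered_sq_le {φ : Joint d → H} (hφ : StronglyMeasurable φ)
    (hφ1 : ∀ x, ‖φ x‖ ≤ 1) (P : Measure (Joint d)) [IsProbabilityMeasure P]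
    (e e' : Unit ⊕ Fin k ↪ Fin n) (hee : ∀ a b, e a ≠ e' b) {B : ℝ}
    (hPP : ∫ x, ∫ y, (inner ℝ (φ x) (φ y)) ^ 2 ∂P ∂P ≤ B)
    (hQQ : ∫ x, ∫ y, (inner ℝ (φ x) (φ y)) ^ 2 ∂(productLaw P) ∂(productLaw P) ≤ B)
    (hPQ : ∫ x, ∫ y, (inner ℝ (φ x) (φ y)) ^ 2 ∂(productLaw P) ∂P ≤ B)
    (hQP : ∫ x, ∫ y, (inner ℝ (φ x) (φ y)) ^ 2 ∂P ∂(productLaw P) ≤ B) :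
    ∫ X, (inner ℝ (contrast φ e X - meanContrast φ P) (contrast φ e' X - meanContrast φ P)) ^ 2
      ∂(Measure.pi fun _ => P) ≤ 16 * B := by
  set μ : Measure (Fin n → Joint d) := Measure.pi fun _ => P with hμ
  set m := meanContrast φ P with hm
  set S := Finset.univ.map e with hS
  have hl : ∀ a, e a ∈ S := fun a => Finset.mem_map_of_mem e (Finset.mem_univ a)
  have hr : ∀ b, e' b ∉ S := fun b hb => by
    obtain ⟨a, -, ha⟩ := Finset.mem_map.1 hb
    exact hee a b ha
  have hξ := fun e : Unit ⊕ Fin k ↪ Fin n => stronglyMeasurable_contrast hφ e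
  have hζ := fun e : Unit ⊕ Fin k ↪ Fin n => (hξ e).sub (stronglyMeasurable_const (b := m))
  have hξb : ∀ (e : Unit ⊕ Fin k ↪ Fin n) X, ‖contrast φ e X‖ ≤ 4 := fun e X =>
    (norm_contrast_le hφ1 e X).trans (by norm_num)
  have hζb : ∀ (e : Unit ⊕ Fin k ↪ Fin n) X, ‖contrast φ e X - m‖ ≤ 4 := fun e X =>
    (norm_sub_le _ _).trans (by linarith [norm_contrast_le hφ1 e X, norm_meanContrast_le hφ1 P])
  have hsq : ∀ {a b : H}, ‖a‖ ≤ 4 → ‖b‖ ≤ 4 → ‖(inner ℝ a b : ℝ) ^ 2‖ ≤ (4 * 4) ^ 2 :=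
    fun {a b} ha hb => by
    rw [norm_pow]
    exact pow_le_pow_left₀ (norm_nonneg _) ((norm_inner_le_norm _ _).trans
      (mul_le_mul ha hb (norm_nonneg _) (by norm_num))) 2
  have hint : ∀ {f g : (Fin n → Joint d) → H}, StronglyMeasurable f → StronglyMeasurable g →
      (∀ X, ‖f X‖ ≤ 4) → (∀ X, ‖g X‖ ≤ 4) →
      Integrable (fun z : (Fin n → Joint d) × (Fin n → Joint d) =>
        (inner ℝ (f z.1) (g z.2) : ℝ) ^ 2) (μ.prod μ) := fun hf hg hfb hgb =>
    Integrable.of_bound (((hf.comp_measurable measurable_fst).inner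
      (hg.comp_measurable measurable_snd)).pow 2).aestronglyMeasurable _
      (Eventually.of_forall fun z => hsq (hfb _) (hgb _))
  have iζζ := hint (hζ e) (hζ e') (hζb e) (hζb e')
  have iξζ := hint (hξ e) (hζ e') (hξb e) (hζb e')
  have iξξ := hint (hξ e) (hξ e') (hξb e) (hξb e')
  simp only [Pi.sub_apply] at iζζ iξζ
  -- Without common observations, the second contrast may be computed from an independent sample.
  -- Then either mean can be removed while the other argument is held fixed.
  have step1 : ∫ X, (inner ℝ (contrast φ e X - m) (contrast φ e' X - m) : ℝ) ^ 2 ∂μ =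
      ∫ z : (Fin n → Joint d) × (Fin n → Joint d),
        (inner ℝ (contrast φ e z.1 - m) (contrast φ e' z.2 - m) : ℝ) ^ 2 ∂(μ.prod μ) := by
    rw [integral_resample P S (((hζ e).inner (hζ e')).pow 2)]
    simp only [contrast_piecewise_left φ e S _ _ hl, contrast_piecewise_right φ e' S _ _ hr]
    rfl
  have step2 : ∫ z : (Fin n → Joint d) × (Fin n → Joint d),
        (inner ℝ (contrast φ e z.1 - m) (contrast φ e' z.2 - m) : ℝ) ^ 2 ∂(μ.prod μ) ≤
      ∫ z : (Fin n → Joint d) × (Fin n → Joint d),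
        (inner ℝ (contrast φ e z.1) (contrast φ e' z.2 - m) : ℝ) ^ 2 ∂(μ.prod μ) := by
    rw [integral_prod_symm _ iζζ, integral_prod_symm _ iξζ]
    refine integral_mono iζζ.integral_prod_right iξζ.integral_prod_right fun x => ?_
    have := integral_inner_sub_mean_sq_le μ (hξ e) (hξb e) (contrast φ e' x - m)
    rwa [integral_contrast hφ hφ1] at this
  have step3 : ∫ z : (Fin n → Joint d) × (Fin n → Joint d),
        (inner ℝ (contrast φ e z.1) (contrast φ e' z.2 - m) : ℝ) ^ 2 ∂(μ.prod μ) ≤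
      ∫ z : (Fin n → Joint d) × (Fin n → Joint d),
        (inner ℝ (contrast φ e z.1) (contrast φ e' z.2) : ℝ) ^ 2 ∂(μ.prod μ) := by
    rw [integral_prod _ iξζ, integral_prod _ iξξ]
    refine integral_mono iξζ.integral_prod_left iξξ.integral_prod_left fun y => ?_
    have := integral_inner_sub_mean_sq_le μ (hξ e') (hξb e') (contrast φ e y)
    rw [integral_contrast hφ hφ1] at this
    simp only [real_inner_comm (contrast φ e y)] at this
    exact this
  have step4 : ∫ z : (Fin n → Joint d) × (Fin n → Joint d),
        (inner ℝ (contrast φ e z.1) (contrast φ e' z.2) : ℝ) ^ 2 ∂(μ.prod μ) =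
      ∫ X, (inner ℝ (contrast φ e X) (contrast φ e' X) : ℝ) ^ 2 ∂μ := by
    rw [integral_resample P S (((hξ e).inner (hξ e')).pow 2)]
    simp only [contrast_piecewise_left φ e S _ _ hl, contrast_piecewise_right φ e' S _ _ hr]
    rfl
  rw [step1]
  refine step2.trans (step3.trans (step4.le.trans ?_))
  have u1 := measurePreserving_eval (fun _ : Fin n => P) (e (Sum.inl ()))
  have u2 := measurePreserving_mix P _ (injective_inr e)
  have v1 := measurePreserving_eval (fun _ : Fin n => P) (e' (Sum.inl ()))
  have v2 := measurePreserving_mix P _ (injective_inr e')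
  have a1 : ∀ x y : Fin n → Joint d, Function.eval (e (Sum.inl ())) (S.piecewise y x) =
      Function.eval (e (Sum.inl ())) y := fun x y => Finset.piecewise_eq_of_mem _ _ _ (hl _)
  have a2 : ∀ x y : Fin n → Joint d, mix (S.piecewise y x) (fun j => e (Sum.inr j)) =
      mix y fun j => e (Sum.inr j) := fun x y => mix_piecewise_left S x y _ fun j => hl _
  have b1 : ∀ x y : Fin n → Joint d, Function.eval (e' (Sum.inl ())) (S.piecewise y x) =
      Function.eval (e' (Sum.inl ())) x := fun x y => Finset.piecewise_eq_of_notMem _ _ _ (hr _)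
  have b2 : ∀ x y : Fin n → Joint d, mix (S.piecewise y x) (fun j => e' (Sum.inr j)) =
      mix x fun j => e' (Sum.inr j) := fun x y => mix_piecewise_right S x y _ fun j => hr _
  obtain ⟨i11, c11⟩ := integral_inner_sq_pair_le hφ hφ1 u1 v1 S a1 b1 hPP
  obtain ⟨i12, c12⟩ := integral_inner_sq_pair_le hφ hφ1 u1 v2 S a1 b2 hPQ
  obtain ⟨i21, c21⟩ := integral_inner_sq_pair_le hφ hφ1 u2 v1 S a2 b1 hQP
  obtain ⟨i22, c22⟩ := integral_inner_sq_pair_le hφ hφ1 u2 v2 S a2 b2 hQQ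
  have j1 := (i11.add i12).add (i21.add i22)
  refine (integral_mono_of_nonneg (Eventually.of_forall fun X => sq_nonneg _)
    (j1.const_mul 4) (Eventually.of_forall fun X => ?_)).trans ?_
  · simp only [Pi.add_apply, contrast, inner_sub_left, inner_sub_right, Function.eval]
    set p := (inner ℝ (φ (X (e (Sum.inl ())))) (φ (X (e' (Sum.inl ())))) : ℝ)
    set q := (inner ℝ (φ (X (e (Sum.inl ())))) (φ (mix X fun j => e' (Sum.inr j))) : ℝ)
    set r := (inner ℝ (φ (mix X fun j => e (Sum.inr j))) (φ (X (e' (Sum.inl ())))) : ℝ)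
    set t := (inner ℝ (φ (mix X fun j => e (Sum.inr j)))
      (φ (mix X fun j => e' (Sum.inr j))) : ℝ)
    nlinarith [sq_nonneg (p + q), sq_nonneg (p + r), sq_nonneg (p - t), sq_nonneg (q - r),
      sq_nonneg (q + t), sq_nonneg (r + t)]
  · rw [integral_const_mul, integral_add' (i11.add i12) (i21.add i22), integral_add' i11 i12,
      integral_add' i21 i22]
    linarith

end Contrast

section Variance

variable {k : ℕ} {d : Fin k → ℕ} {n : ℕ} {H : Type} [NormedAddCommGroup H]
  [InnerProductSpace ℝ H]

theorem gaussKernel_comm {ι : Type} [Fintype ι] (ν : ℝ) (x y : EuclideanSpace ℝ ι) :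
    gaussKernel ν x y = gaussKernel ν y x := by
  rw [gaussKernel, gaussKernel, norm_sub_rev]

/-- The discrepancy estimate is a single average of inner products of two contrasts. -/
theorem dHSIC_eq_uAverage {φ : Joint d → H} {ν : ℝ}
    (hφG : ∀ x y, inner ℝ (φ x) (φ y) = gaussKernel ν x y) (hn : 2 * (k + 1) ≤ n)
    (X : Fin n → Joint d) :
    dHSIC ν X = uAverage fun e : (Unit ⊕ Fin k) ⊕ (Unit ⊕ Fin k) ↪ Fin n =>
      inner ℝ (contrast φ (Function.Embedding.inl.trans e) X)
        (contrast φ (Function.Embedding.inr.trans e) X) := by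
  have hc : Fintype.card ((Unit ⊕ Fin k) ⊕ (Unit ⊕ Fin k)) ≤ n := by
    simp only [Fintype.card_sum, Fintype.card_unit, Fintype.card_fin]
    omega
  -- the sub-tuples on which the four inner products depend
  let g1 : Fin 2 ↪ (Unit ⊕ Fin k) ⊕ (Unit ⊕ Fin k) :=
    ⟨![Sum.inl (Sum.inl ()), Sum.inr (Sum.inl ())], by
      intro x y
      fin_cases x <;> fin_cases y <;> simp⟩
  let g2 : Fin k ⊕ Fin k ↪ (Unit ⊕ Fin k) ⊕ (Unit ⊕ Fin k) :=
    Function.Embedding.sumMap Function.Embedding.inr Function.Embedding.inr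
  let g3 : Unit ⊕ Fin k ↪ (Unit ⊕ Fin k) ⊕ (Unit ⊕ Fin k) :=
    Function.Embedding.sumMap Function.Embedding.inl Function.Embedding.inr
  let g4 : Unit ⊕ Fin k ↪ (Unit ⊕ Fin k) ⊕ (Unit ⊕ Fin k) :=
    g3.trans (Equiv.sumComm _ _).toEmbedding
  have h1 := uAverage_comp_embedding hc g1 fun e : Fin 2 ↪ Fin n =>
    gaussKernel ν (X (e 0)) (X (e 1))
  have h2 := uAverage_comp_embedding hc g2 fun e : Fin k ⊕ Fin k ↪ Fin n =>
    gaussKernel ν (mix X fun j => e (Sum.inl j)) (mix X fun j => e (Sum.inr j))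
  have h3 := uAverage_comp_embedding hc g3 fun e : Unit ⊕ Fin k ↪ Fin n =>
    gaussKernel ν (X (e (Sum.inl ()))) (mix X fun j => e (Sum.inr j))
  have h4 := uAverage_comp_embedding hc g4 fun e : Unit ⊕ Fin k ↪ Fin n =>
    gaussKernel ν (X (e (Sum.inl ()))) (mix X fun j => e (Sum.inr j))
  rw [dHSIC, two_mul]
  nth_rw 1 [← h3]
  rw [← h4, ← h1, ← h2, ← uAverage_add, ← uAverage_add, ← uAverage_sub]
  congr 1
  funext e
  simp only [contrast, inner_sub_left, inner_sub_right, hφG]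
  rw [gaussKernel_comm ν (mix X _) (X _)]
  have g10 : g1 0 = Sum.inl (Sum.inl ()) := rfl
  have g11 : g1 1 = Sum.inr (Sum.inl ()) := rfl
  simp only [g10, g11, g2, g3, g4, Function.Embedding.trans_apply, Function.Embedding.inl_apply,
    Function.Embedding.inr_apply, Function.Embedding.sumMap, Function.Embedding.coeFn_mk,
    Sum.map_inl, Sum.map_inr, Equiv.sumComm_apply, Sum.swap_inl, Sum.swap_inr,
    Equiv.toEmbedding_apply]
  ring

variable [CompleteSpace H]

/-- The mean square error of the discrepancy estimate. The first-order term carries the factor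
`‖meanContrast φ P‖²`, which is what makes the estimate relatively precise for weak dependence. -/
theorem integral_dHSIC_sub_sq_le {φ : Joint d → H} {ν : ℝ} (hφ : StronglyMeasurable φ)
    (hφ1 : ∀ x, ‖φ x‖ ≤ 1) (hφG : ∀ x y, inner ℝ (φ x) (φ y) = gaussKernel ν x y)
    (hn : 2 * (k + 1) ≤ n) (P : Measure (Joint d)) [IsProbabilityMeasure P] {B : ℝ}
    (hPP : ∫ x, ∫ y, gaussKernel ν x y ^ 2 ∂P ∂P ≤ B)
    (hQQ : ∫ x, ∫ y, gaussKernel ν x y ^ 2 ∂(productLaw P) ∂(productLaw P) ≤ B)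
    (hPQ : ∫ x, ∫ y, gaussKernel ν x y ^ 2 ∂(productLaw P) ∂P ≤ B)
    (hQP : ∫ x, ∫ y, gaussKernel ν x y ^ 2 ∂P ∂(productLaw P) ≤ B) :
    Integrable (fun X => (dHSIC ν X - ‖meanContrast φ P‖ ^ 2) ^ 2)
      (Measure.pi fun _ : Fin n => P) ∧
    ∫ X, (dHSIC ν X - ‖meanContrast φ P‖ ^ 2) ^ 2 ∂(Measure.pi fun _ : Fin n => P) ≤
      96 * (2 * (k + 1)) ^ 4 * (‖meanContrast φ P‖ ^ 2 * √B / n + B / n ^ 2) := by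
  simp only [← hφG] at hPP hQQ hPQ hQP
  have hB0 : 0 ≤ B := le_trans (integral_nonneg fun x => integral_nonneg fun y => sq_nonneg _) hPP
  set μ : Measure (Fin n → Joint d) := Measure.pi fun _ => P with hμ
  set h := meanContrast φ P with hh
  let σ : Type := (Unit ⊕ Fin k) ⊕ (Unit ⊕ Fin k)
  have hcard : Fintype.card σ = 2 * (k + 1) := by
    simp only [σ, Fintype.card_sum, Fintype.card_unit, Fintype.card_fin]
    omega
  have hc : Fintype.card σ ≤ n := hcard ▸ hn
  have hn2 : 2 ≤ n := by omega
  let L : (σ ↪ Fin n) → (Unit ⊕ Fin k ↪ Fin n) := fun e => Function.Embedding.inl.trans e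
  let R : (σ ↪ Fin n) → (Unit ⊕ Fin k ↪ Fin n) := fun e => Function.Embedding.inr.trans e
  let ζ : (Unit ⊕ Fin k ↪ Fin n) → (Fin n → Joint d) → H := fun e X => contrast φ e X - h
  let F : (σ ↪ Fin n) → (Fin n → Joint d) → ℝ := fun e X => inner ℝ (ζ (L e) X) (ζ (R e) X)
  let G : (Unit ⊕ Fin k ↪ Fin n) → (Fin n → Joint d) → ℝ := fun e X => inner ℝ (ζ e X) h
  have hζm : ∀ e, StronglyMeasurable (ζ e) := fun e =>
    (stronglyMeasurable_contrast hφ e).sub stronglyMeasurable_const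
  have hhb : ‖h‖ ≤ 2 := norm_meanContrast_le hφ1 P
  have hζb : ∀ e X, ‖ζ e X‖ ≤ 4 := fun e X =>
    (norm_sub_le_of_le (norm_contrast_le hφ1 e X) hhb).trans (by norm_num)
  have hFm : ∀ e, StronglyMeasurable (F e) := fun e => (hζm _).inner (hζm _)
  have hGm : ∀ e, StronglyMeasurable (G e) := fun e => (hζm _).inner stronglyMeasurable_const
  have hFb : ∀ e X, ‖F e X‖ ≤ 4 * 4 := fun e X => (norm_inner_le_norm _ _).trans
    (mul_le_mul (hζb _ _) (hζb _ _) (norm_nonneg _) (by norm_num))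
  have hGb : ∀ e X, ‖G e X‖ ≤ 4 * 2 := fun e X => (norm_inner_le_norm _ _).trans
    (mul_le_mul (hζb _ _) hhb (norm_nonneg _) (by norm_num))
  have hFF : ∀ e e', Integrable (fun X => F e X * F e' X) μ := fun e e' =>
    Integrable.of_bound ((hFm e).mul (hFm e')).aestronglyMeasurable (4 * 4 * (4 * 4))
      (Eventually.of_forall fun X => by
        rw [norm_mul]
        exact mul_le_mul (hFb _ _) (hFb _ _) (norm_nonneg _) (by norm_num))
  have hGG : ∀ e e', Integrable (fun X => G e X * G e' X) μ := fun e e' =>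
    Integrable.of_bound ((hGm e).mul (hGm e')).aestronglyMeasurable (4 * 2 * (4 * 2))
      (Eventually.of_forall fun X => by
        rw [norm_mul]
        exact mul_le_mul (hGb _ _) (hGb _ _) (norm_nonneg _) (by norm_num))
  have hζr : ∀ (e e' : Unit ⊕ Fin k ↪ Fin n), (∀ a b, e a ≠ e' b) → ∀ x y,
      ζ e' ((Finset.univ.map e).piecewise y x) = ζ e' x := by
    intro e e' hee x y
    simp only [ζ]
    rw [contrast_piecewise_right φ e' _ x y fun b hb => ?_]
    obtain ⟨a, -, ha⟩ := Finset.mem_map.1 hb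
    exact hee a b ha
  -- the doubly centered part
  have hA := integral_uAverage_sq_le_of_degenerate (μ := μ) (F := F) (D := 16 * B) hc hn2
    (by linarith) hFF
    (fun e => integral_inner_centered_sq_le hφ hφ1 P (L e) (R e)
      (fun a b hab => Sum.inl_ne_inr (e.injective hab)) hPP hQQ hPQ hQP)
    (fun e e' hee => by
      have hor : (∀ (a : Unit ⊕ Fin k) (b : σ), L e a ≠ e' b) ∨
          (∀ (a : Unit ⊕ Fin k) (b : σ), R e a ≠ e' b) := by
        by_contra hcon
        push Not at hcon
        obtain ⟨⟨a, b, hab⟩, ⟨c, d', hcd⟩⟩ := hcon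
        exact hee (Sum.inl a) b (Sum.inr c) d' Sum.inl_ne_inr ⟨hab, hcd⟩
      have hbound : ∀ (e₀ : Unit ⊕ Fin k ↪ Fin n) X, ‖F e' X • ζ e₀ X‖ ≤ 4 * 4 * 4 :=
        fun e₀ X => by
          rw [norm_smul]
          exact mul_le_mul (hFb _ _) (hζb _ _) (norm_nonneg _) (by norm_num)
      have hFr : ∀ e₀ : Unit ⊕ Fin k ↪ Fin n, (∀ a b, e₀ a ≠ e' b) → ∀ x y,
          F e' ((Finset.univ.map e₀).piecewise y x) = F e' x := fun e₀ h0 x y => by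
        simp only [F]
        rw [hζr e₀ (L e') (fun a b => h0 a _) x y, hζr e₀ (R e') (fun a b => h0 a _) x y]
      rcases hor with h0 | h0
      · have := integral_inner_contrast_eq_zero hφ hφ1 P (L e)
          (V := fun X => F e' X • ζ (R e) X) ((hFm e').smul (hζm (R e))) (hbound _)
          (fun x y => by
            rw [hFr _ h0, hζr (L e) (R e) (fun a b hab => Sum.inl_ne_inr (e.injective hab))])
        rw [← this]
        refine integral_congr_ae (Eventually.of_forall fun X => ?_)
        dsimp only
        rw [real_inner_smul_right, mul_comm]
      · have := integral_inner_contrast_eq_zero hφ hφ1 P (R e)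
          (V := fun X => F e' X • ζ (L e) X) ((hFm e').smul (hζm (L e))) (hbound _)
          (fun x y => by
            rw [hFr _ h0, hζr (R e) (L e) (fun a b hab => Sum.inr_ne_inl (e.injective hab))])
        rw [← this]
        refine integral_congr_ae (Eventually.of_forall fun X => ?_)
        dsimp only
        rw [real_inner_smul_right, mul_comm, real_inner_comm])
  -- the linear parts
  have hD : ∀ e, ∫ X, G e X ^ 2 ∂μ ≤ 4 * (‖h‖ ^ 2 * √B) := fun e => by
    refine le_trans ?_ (integral_contrast_inner_sq_le hφ hφ1 P e h hPP hQQ)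
    have := integral_inner_sub_mean_sq_le μ (stronglyMeasurable_contrast hφ e)
      (norm_contrast_le hφ1 e) h
    rwa [integral_contrast hφ hφ1] at this
  have hG0 : ∀ e e' : Unit ⊕ Fin k ↪ Fin n, (∀ a b, e a ≠ e' b) →
      ∫ X, G e X * G e' X ∂μ = 0 := fun e e' hee => by
    have := integral_inner_contrast_eq_zero hφ hφ1 P e
      (V := fun X => G e' X • h) ((hGm e').smul stronglyMeasurable_const) (C := 4 * 2 * 2)
      (fun X => by
        rw [norm_smul]
        exact mul_le_mul (hGb _ _) hhb (norm_nonneg _) (by norm_num))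
      (fun x y => by
        simp only [G]
        rw [hζr e e' hee])
    rw [← this]
    refine integral_congr_ae (Eventually.of_forall fun X => ?_)
    dsimp only
    rw [real_inner_smul_right, mul_comm]
  have hD0 : 0 ≤ 4 * (‖h‖ ^ 2 * √B) := by positivity
  have hBL := integral_uAverage_sq_le_of_disjoint (μ := μ) (F := fun e : σ ↪ Fin n => G (L e))
    hc hD0 (fun e e' => hGG _ _) (fun e => hD _)
    (fun e e' hee => hG0 _ _ fun a b => hee _ _)
  have hBR := integral_uAverage_sq_le_of_disjoint (μ := μ) (F := fun e : σ ↪ Fin n => G (R e))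
    hc hD0 (fun e e' => hGG _ _) (fun e => hD _)
    (fun e e' hee => hG0 _ _ fun a b => hee _ _)
  have hdec : ∀ X : Fin n → Joint d, dHSIC ν X - ‖h‖ ^ 2 = (uAverage fun e => F e X) +
      (uAverage fun e : σ ↪ Fin n => G (L e) X) + (uAverage fun e : σ ↪ Fin n => G (R e) X) := by
    intro X
    rw [dHSIC_eq_uAverage hφG hn, ← uAverage_const hc (‖h‖ ^ 2), ← uAverage_sub,
      ← uAverage_add, ← uAverage_add]
    congr 1
    funext e
    simp only [F, G, ζ, L, R, inner_sub_left, inner_sub_right, real_inner_self_eq_norm_sq]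
    rw [real_inner_comm h (contrast φ (Function.Embedding.inr.trans e) X)]
    ring
  have hsqi : ∀ {F' : (σ ↪ Fin n) → (Fin n → Joint d) → ℝ},
      (∀ e e', Integrable (fun X => F' e X * F' e' X) μ) →
      Integrable (fun X => (uAverage fun e => F' e X) ^ 2) μ := by
    intro F' hF'
    have h1 : ∀ X, (uAverage fun e => F' e X) ^ 2 =
        uAverage fun e' => uAverage fun e => F' e X * F' e' X := by
      intro X
      simp only [uAverage_mul_right, uAverage_mul_left]
      rw [sq]
    simp only [h1]
    exact integrable_uAverage fun e' => integrable_uAverage fun e => hF' e e'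
  have iA := hsqi hFF
  have iL : Integrable (fun X => (uAverage fun e : σ ↪ Fin n => G (L e) X) ^ 2) μ :=
    hsqi fun e e' => hGG _ _
  have iR : Integrable (fun X => (uAverage fun e : σ ↪ Fin n => G (R e) X) ^ 2) μ :=
    hsqi fun e e' => hGG _ _
  have hle : ∀ X : Fin n → Joint d, (dHSIC ν X - ‖h‖ ^ 2) ^ 2 ≤
      3 * ((uAverage fun e => F e X) ^ 2 + (uAverage fun e : σ ↪ Fin n => G (L e) X) ^ 2 +
      (uAverage fun e : σ ↪ Fin n => G (R e) X) ^ 2) := by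
    intro X
    rw [hdec]
    set a := uAverage fun e => F e X
    set b := uAverage fun e : σ ↪ Fin n => G (L e) X
    set c := uAverage fun e : σ ↪ Fin n => G (R e) X
    nlinarith [sq_nonneg (a - b), sq_nonneg (a - c), sq_nonneg (b - c)]
  have isum : Integrable (fun X => 3 * ((uAverage fun e => F e X) ^ 2 +
      (uAverage fun e : σ ↪ Fin n => G (L e) X) ^ 2 +
      (uAverage fun e : σ ↪ Fin n => G (R e) X) ^ 2)) μ :=
    ((iA.add iL).add iR).const_mul 3
  have hmeas : StronglyMeasurable fun X : Fin n → Joint d => (dHSIC ν X - ‖h‖ ^ 2) ^ 2 := by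
    have hu : ∀ {F' : (σ ↪ Fin n) → (Fin n → Joint d) → ℝ}, (∀ e, StronglyMeasurable (F' e)) →
        StronglyMeasurable fun X => uAverage fun e => F' e X := by
      intro F' hF'
      simp only [uAverage, div_eq_mul_inv]
      exact (Finset.stronglyMeasurable_fun_sum _ fun e _ => hF' e).mul_const _
    simp only [hdec]
    exact (((hu hFm).add (hu fun e => hGm _)).add (hu fun e => hGm _)).pow 2
  refine ⟨isum.mono' hmeas.aestronglyMeasurable (Eventually.of_forall fun X => ?_), ?_⟩
  · rw [Real.norm_of_nonneg (sq_nonneg _)]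
    exact hle X
  · refine (integral_mono_of_nonneg (Eventually.of_forall fun X => sq_nonneg _) isum
      (Eventually.of_forall hle)).trans ?_
    have iAL : Integrable (fun X => (uAverage fun e => F e X) ^ 2 +
      (uAverage fun e : σ ↪ Fin n => G (L e) X) ^ 2) μ := iA.add iL
    rw [integral_const_mul, integral_add iAL iR, integral_add iA iL]
    rw [hcard] at hA hBL hBR
    push_cast at hA hBL hBR
    have hn0 : (0 : ℝ) < n := by
      have : 0 < n := by omega
      exact_mod_cast this
    have hm1 : (1 : ℝ) ≤ 2 * (k + 1) := by
      have : (0 : ℝ) ≤ k := Nat.cast_nonneg k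
      linarith
    set m : ℝ := 2 * ((k : ℝ) + 1)
    have hm24 : m ^ 2 ≤ m ^ 4 := pow_le_pow_right₀ hm1 (by norm_num)
    set g := ‖h‖ ^ 2 * √B
    have hg0 : 0 ≤ g := by positivity
    have h5 : m ^ 2 * (4 * g) / n ≤ 4 * m ^ 4 * (g / n) := by
      rw [mul_div_assoc, mul_div_assoc]
      have : 0 ≤ g / n := by positivity
      nlinarith
    have h6 : 2 * m ^ 4 * (16 * B) / (n : ℝ) ^ 2 = 32 * m ^ 4 * (B / n ^ 2) := by ring
    have h7 : 0 ≤ m ^ 4 * (g / n) := by positivity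
    have h8 : 0 ≤ m ^ 4 * (B / n ^ 2) := by positivity
    linarith

end Variance

/-! ### Gaussian kernels and the Fourier transform -/

section Fourier

variable {ι : Type} [Fintype ι]

local notation "𝔼" => EuclideanSpace ℝ ι

theorem integrable_gauss_mul_cexp {b : ℝ} (hb : 0 < b) (w : 𝔼) :
    Integrable (fun v : 𝔼 =>
      ((Real.exp (-b * ‖v‖ ^ 2) : ℝ) : ℂ) * Complex.exp (-((inner ℝ w v : ℝ) : ℂ) * Complex.I)) := by
  have := GaussianFourier.integrable_cexp_neg_mul_sq_norm_add (b := (b : ℂ)) (by simpa using hb)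
    (-Complex.I) w
  refine this.congr (Eventually.of_forall fun v => ?_)
  dsimp only
  rw [Complex.ofReal_exp, ← Complex.exp_add]
  congr 1
  push_cast
  ring

theorem integrable_gauss {b : ℝ} (hb : 0 < b) :
    Integrable (fun v : 𝔼 => Real.exp (-b * ‖v‖ ^ 2)) := by
  have := (integrable_gauss_mul_cexp hb (0 : 𝔼)).re
  refine this.congr (Eventually.of_forall fun v => ?_)
  simp only [inner_zero_left, Complex.ofReal_zero, neg_zero, zero_mul, Complex.exp_zero, mul_one]
  exact Complex.ofReal_re _

/-- The characteristic function of a centered Gaussian density. -/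
theorem integral_gauss_mul_cexp {b : ℝ} (hb : 0 < b) (w : 𝔼) :
    ∫ v : 𝔼,
      ((Real.exp (-b * ‖v‖ ^ 2) : ℝ) : ℂ) * Complex.exp (-((inner ℝ w v : ℝ) : ℂ) * Complex.I) =
    (((Real.pi / b) ^ ((Fintype.card ι : ℝ) / 2) * Real.exp (-‖w‖ ^ 2 / (4 * b)) : ℝ) : ℂ) := by
  have := GaussianFourier.integral_cexp_neg_mul_sq_norm_add (b := (b : ℂ)) (by simpa using hb)
    (-Complex.I) w
  rw [finrank_euclideanSpace] at this
  push_cast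
  rw [Complex.ofReal_cpow (by positivity)]
  push_cast
  convert this using 2
  · ext v
    rw [← Complex.exp_add]
    congr 1
    ring
  · congr 1
    rw [neg_sq, Complex.I_sq]
    ring

theorem integral_gauss {b : ℝ} (hb : 0 < b) :
    ∫ v : 𝔼, Real.exp (-b * ‖v‖ ^ 2) =
      (Real.pi / b) ^ ((Fintype.card ι : ℝ) / 2) := by
  rw [GaussianFourier.integral_rexp_neg_mul_sq_norm hb, finrank_euclideanSpace]

theorem measurable_gaussKernel (ν : ℝ) :
    Measurable (fun z : 𝔼 × 𝔼 => gaussKernel ν z.1 z.2) := by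
  unfold gaussKernel
  fun_prop

theorem gaussKernel_nonneg (ν : ℝ) (x y : 𝔼) : 0 ≤ gaussKernel ν x y :=
  (Real.exp_pos _).le

theorem gaussKernel_le_one {ν : ℝ} (hν : 0 ≤ ν) (x y : 𝔼) :
    gaussKernel ν x y ≤ 1 := by
  rw [gaussKernel, Real.exp_le_one_iff]
  nlinarith [sq_nonneg ‖x - y‖]

theorem gaussKernel_sq (ν : ℝ) (x y : 𝔼) :
    gaussKernel ν x y ^ 2 = gaussKernel (2 * ν) x y := by
  rw [gaussKernel, gaussKernel, ← Real.exp_nat_mul]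
  congr 1
  push_cast
  ring

theorem continuous_phase (x : 𝔼) : Continuous fun ω : 𝔼 =>
    Complex.exp (-((inner ℝ x ω : ℝ) : ℂ) * Complex.I) := by fun_prop

theorem norm_phase (t : ℝ) : ‖Complex.exp (-(t : ℂ) * Complex.I)‖ = 1 := by
  rw [← Complex.ofReal_neg]
  exact Complex.norm_exp_ofReal_mul_I _

theorem integrable_mul_phase {u : 𝔼 → ℝ} (hu : Integrable u)
    (ω : 𝔼) : Integrable fun x : 𝔼 =>
      (u x : ℂ) * Complex.exp (-((inner ℝ x ω : ℝ) : ℂ) * Complex.I) := by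
  refine hu.ofReal.mul_bdd (c := 1) (Continuous.aestronglyMeasurable (by fun_prop))
    (Eventually.of_forall fun x => (norm_phase _).le)

theorem continuous_fourierT {u : 𝔼 → ℝ} (hu : Integrable u) :
    Continuous (fourierT u) := by
  refine continuous_const.mul (continuous_of_dominated (bound := fun x => ‖u x‖)
    (fun ω => (integrable_mul_phase hu ω).aestronglyMeasurable)
    (fun ω => Eventually.of_forall fun x => ?_) hu.norm (Eventually.of_forall fun x => ?_))
  · rw [norm_mul, norm_phase, mul_one, Complex.norm_real]
  · exact continuous_const.mul (continuous_phase x)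

theorem norm_fourierT_le {u : 𝔼 → ℝ} (ω : 𝔼) :
    ‖fourierT u ω‖ ≤ (2 * Real.pi) ^ (-(Fintype.card ι : ℝ) / 2) * ∫ x, ‖u x‖ := by
  rw [fourierT, norm_mul, Complex.norm_real, Real.norm_of_nonneg (by positivity)]
  refine mul_le_mul_of_nonneg_left ((norm_integral_le_integral_norm _).trans (le_of_eq ?_))
    (by positivity)
  refine integral_congr_ae (Eventually.of_forall fun x => ?_)
  dsimp only
  rw [norm_mul, norm_phase, mul_one, Complex.norm_real]

theorem integrable_gauss_mul_norm_fourierT_sq {u : 𝔼 → ℝ} (hu : Integrable u)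
    {b : ℝ} (hb : 0 < b) : Integrable fun ω : 𝔼 =>
      Real.exp (-b * ‖ω‖ ^ 2) * ‖fourierT u ω‖ ^ 2 := by
  refine (integrable_gauss hb).mul_bdd
    (c := ((2 * Real.pi) ^ (-(Fintype.card ι : ℝ) / 2) * ∫ x, ‖u x‖) ^ 2)
    ((continuous_fourierT hu).norm.pow 2).aestronglyMeasurable (Eventually.of_forall fun ω => ?_)
  rw [Real.norm_of_nonneg (by positivity)]
  exact pow_le_pow_left₀ (norm_nonneg _) (norm_fourierT_le ω) 2

/-- The quadratic form of the Gaussian kernel in the Fourier domain. -/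
theorem integral_gaussKernel_mul {u : 𝔼 → ℝ} (hu : Integrable u) {ν : ℝ}
    (hν : 0 < ν) :
    ∫ z : 𝔼 × 𝔼, u z.1 * u z.2 * gaussKernel ν z.1 z.2 =
      (Real.pi / ν) ^ ((Fintype.card ι : ℝ) / 2) *
        ∫ ω : 𝔼, Real.exp (-(1 / (4 * ν)) * ‖ω‖ ^ 2) * ‖fourierT u ω‖ ^ 2 := by
  set D : ℝ := ((Fintype.card ι : ℕ) : ℝ) with hD
  set b : ℝ := 1 / (4 * ν) with hb
  have hb0 : 0 < b := by positivity
  let e : 𝔼 → 𝔼 → ℂ := fun x ω => Complex.exp (-((inner ℝ x ω : ℝ) : ℂ) * Complex.I)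
  have hconj : ∀ x ω, (starRingEnd ℂ) (e x ω) = Complex.exp (((inner ℝ x ω : ℝ) : ℂ) * Complex.I) := by
    intro x ω
    simp only [e, ← Complex.exp_conj, map_mul, map_neg, Complex.conj_ofReal, Complex.conj_I]
    congr 1
    ring
  let Φ : (𝔼 × 𝔼) → 𝔼 → ℂ := fun z ω =>
    ((u z.1 * u z.2 : ℝ) : ℂ) * (((Real.exp (-b * ‖ω‖ ^ 2) : ℝ) : ℂ) * e (z.1 - z.2) ω)
  have huu : Integrable (fun z : 𝔼 × 𝔼 => u z.1 * u z.2) := hu.mul_prod hu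
  have hΦ : Integrable (Function.uncurry Φ) ((volume : Measure (𝔼 × 𝔼)).prod volume) := by
    have h1 : Integrable (fun z : (𝔼 × 𝔼) × 𝔼 =>
        ((u z.1.1 * u z.1.2 : ℝ) : ℂ) * ((Real.exp (-b * ‖z.2‖ ^ 2) : ℝ) : ℂ))
        ((volume : Measure (𝔼 × 𝔼)).prod volume) :=
      (huu.ofReal (𝕜 := ℂ)).mul_prod ((integrable_gauss hb0).ofReal (𝕜 := ℂ))
    refine (h1.mul_bdd (g := fun z : (𝔼 × 𝔼) × 𝔼 => e (z.1.1 - z.1.2) z.2) (c := 1)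
      (Continuous.aestronglyMeasurable (by fun_prop))
      (Eventually.of_forall fun x => (norm_phase _).le)).congr (Eventually.of_forall fun z => ?_)
    simp only [Function.uncurry, Φ]
    ring
  have hswap := integral_integral_swap hΦ
  -- integrating out the frequency
  have hleft : ∀ z : 𝔼 × 𝔼, ∫ ω, Φ z ω = (((4 * Real.pi * ν) ^ (D / 2) *
      (u z.1 * u z.2 * gaussKernel ν z.1 z.2) : ℝ) : ℂ) := by
    intro z
    simp only [Φ, e]
    rw [integral_const_mul, integral_gauss_mul_cexp hb0, ← Complex.ofReal_mul]
    congr 1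
    have h1 : Real.pi / b = 4 * Real.pi * ν := by rw [hb]; field_simp
    have h2 : -‖z.1 - z.2‖ ^ 2 / (4 * b) = -ν * ‖z.1 - z.2‖ ^ 2 := by rw [hb]; field_simp
    rw [h1, h2, gaussKernel]
    ring
  -- integrating out the points
  have hright : ∀ ω, ∫ z, Φ z ω = (((2 * Real.pi) ^ D *
      (Real.exp (-b * ‖ω‖ ^ 2) * ‖fourierT u ω‖ ^ 2) : ℝ) : ℂ) := by
    intro ω
    have h1 : ∀ z : 𝔼 × 𝔼, Φ z ω = ((Real.exp (-b * ‖ω‖ ^ 2) : ℝ) : ℂ) *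
        (((u z.1 : ℂ) * e z.1 ω) * (starRingEnd ℂ) ((u z.2 : ℂ) * e z.2 ω)) := by
      intro z
      have : e (z.1 - z.2) ω = e z.1 ω * (starRingEnd ℂ) (e z.2 ω) := by
        rw [hconj]
        simp only [e, ← Complex.exp_add, inner_sub_left]
        congr 1
        push_cast
        ring
      simp only [Φ, this, map_mul, Complex.conj_ofReal]
      push_cast
      ring
    simp only [h1]
    rw [integral_const_mul]
    have h2 : ∫ z : 𝔼 × 𝔼, ((u z.1 : ℂ) * e z.1 ω) * (starRingEnd ℂ) ((u z.2 : ℂ) * e z.2 ω) =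
        (∫ x, (u x : ℂ) * e x ω) * ∫ x, (starRingEnd ℂ) ((u x : ℂ) * e x ω) :=
      integral_prod_mul (fun x => (u x : ℂ) * e x ω)
        (fun x => (starRingEnd ℂ) ((u x : ℂ) * e x ω))
    rw [h2, integral_conj, Complex.mul_conj']
    have h3 : ‖fourierT u ω‖ = (2 * Real.pi) ^ (-D / 2) * ‖∫ x, (u x : ℂ) * e x ω‖ := by
      rw [fourierT, norm_mul, Complex.norm_real, Real.norm_of_nonneg (by positivity)]
    have h4 : (2 * Real.pi) ^ D * ‖fourierT u ω‖ ^ 2 = ‖∫ x, (u x : ℂ) * e x ω‖ ^ 2 := by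
      have : (2 * Real.pi) ^ D * ((2 * Real.pi) ^ (-D / 2)) ^ 2 = 1 := by
        rw [← Real.rpow_natCast, ← Real.rpow_mul (by positivity), ← Real.rpow_add (by positivity)]
        norm_num
      rw [h3, mul_pow, ← mul_assoc, this, one_mul]
    rw [← Complex.ofReal_pow, ← h4]
    push_cast
    ring
  simp only [hleft, hright] at hswap
  rw [integral_complex_ofReal, integral_complex_ofReal, Complex.ofReal_inj, integral_const_mul,
    integral_const_mul] at hswap
  have h5 : (Real.pi / ν) ^ (D / 2) * (4 * Real.pi * ν) ^ (D / 2) = (2 * Real.pi) ^ D := by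
    rw [← Real.mul_rpow (by positivity) (by positivity)]
    have : Real.pi / ν * (4 * Real.pi * ν) = (2 * Real.pi) ^ (2 : ℝ) := by
      rw [Real.rpow_two]
      field_simp
      norm_num
    rw [this, ← Real.rpow_mul (by positivity)]
    congr 1
    ring
  have h6 : 0 < (2 * Real.pi) ^ D := by positivity
  refine mul_left_cancel₀ h6.ne' ?_
  rw [mul_left_comm, ← hswap, ← mul_assoc, h5]

theorem norm_sub_sq_add_norm_sub_sq (x y t : 𝔼) :
    ‖t - x‖ ^ 2 + ‖t - y‖ ^ 2 = 2 * ‖t - (2⁻¹ : ℝ) • (x + y)‖ ^ 2 + ‖x - y‖ ^ 2 / 2 := by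
  simp only [← real_inner_self_eq_norm_sq, inner_sub_left, inner_sub_right, inner_smul_left,
    inner_smul_right, inner_add_left, inner_add_right, RCLike.conj_to_real]
  rw [real_inner_comm x t, real_inner_comm y t, real_inner_comm y x]
  ring

theorem gauss_mul_gauss (a : ℝ) (x y t : 𝔼) :
    Real.exp (-a * ‖t - x‖ ^ 2) * Real.exp (-a * ‖t - y‖ ^ 2) =
      gaussKernel (a / 2) x y * Real.exp (-(2 * a) * ‖t - (2⁻¹ : ℝ) • (x + y)‖ ^ 2) := by
  rw [gaussKernel, ← Real.exp_add, ← Real.exp_add]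
  congr 1
  have := norm_sub_sq_add_norm_sub_sq x y t
  linear_combination (-a) * this

theorem integrable_gauss_mul_gauss {a : ℝ} (ha : 0 < a) (x y : 𝔼) :
    Integrable fun t : 𝔼 =>
      Real.exp (-a * ‖t - x‖ ^ 2) * Real.exp (-a * ‖t - y‖ ^ 2) := by
  simp only [gauss_mul_gauss]
  exact ((integrable_gauss (b := 2 * a) (by positivity)).comp_sub_right _).const_mul _

theorem integral_gauss_mul_gauss {a : ℝ} (ha : 0 < a) (x y : 𝔼) :
    ∫ t : 𝔼, Real.exp (-a * ‖t - x‖ ^ 2) * Real.exp (-a * ‖t - y‖ ^ 2) =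
      (Real.pi / (2 * a)) ^ ((Fintype.card ι : ℝ) / 2) * gaussKernel (a / 2) x y := by
  simp only [gauss_mul_gauss]
  rw [integral_const_mul, integral_sub_right_eq_self (fun t : 𝔼 =>
    Real.exp (-(2 * a) * ‖t‖ ^ 2)), integral_gauss (by positivity), mul_comm]

/-- The square integral of a Gaussian smoothing. -/
theorem integral_smoothing_sq {u : 𝔼 → ℝ} (hu : Integrable u) {a : ℝ}
    (ha : 0 < a) :
    Integrable (fun t : 𝔼 =>
      (∫ x : 𝔼, Real.exp (-a * ‖t - x‖ ^ 2) * u x) ^ 2) ∧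
    ∫ t : 𝔼, (∫ x : 𝔼, Real.exp (-a * ‖t - x‖ ^ 2) * u x) ^ 2 =
      (Real.pi / (2 * a)) ^ ((Fintype.card ι : ℝ) / 2) *
      ∫ z : 𝔼 × 𝔼,
        u z.1 * u z.2 * gaussKernel (a / 2) z.1 z.2 := by
  let Φ : (𝔼 × 𝔼) → 𝔼 → ℝ := fun z t =>
    u z.1 * u z.2 * (Real.exp (-a * ‖t - z.1‖ ^ 2) * Real.exp (-a * ‖t - z.2‖ ^ 2))
  have huu : Integrable (fun z : 𝔼 × 𝔼 => u z.1 * u z.2) := hu.mul_prod hu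
  have hΦm : AEStronglyMeasurable (Function.uncurry Φ) ((volume : Measure (𝔼 × 𝔼)).prod volume) := by
    refine AEStronglyMeasurable.mul huu.aestronglyMeasurable.comp_fst ?_
    exact Continuous.aestronglyMeasurable (by fun_prop)
  have hΦ : Integrable (Function.uncurry Φ) ((volume : Measure (𝔼 × 𝔼)).prod volume) := by
    rw [integrable_prod_iff hΦm]
    refine ⟨Eventually.of_forall fun z =>
      (integrable_gauss_mul_gauss ha z.1 z.2).const_mul (u z.1 * u z.2), ?_⟩
    have h1 : ∀ z : 𝔼 × 𝔼, ∫ t, ‖Function.uncurry Φ (z, t)‖ = ‖u z.1 * u z.2‖ *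
        ((Real.pi / (2 * a)) ^ ((Fintype.card ι : ℝ) / 2) * gaussKernel (a / 2) z.1 z.2) := by
      intro z
      rw [← integral_gauss_mul_gauss ha, ← integral_const_mul]
      refine integral_congr_ae (Eventually.of_forall fun t => ?_)
      simp only [Function.uncurry, Φ]
      rw [norm_mul (u z.1 * u z.2), Real.norm_of_nonneg (r := _ * Real.exp _) (by positivity)]
    simp only [h1]
    refine huu.norm.mul_bdd (c := (Real.pi / (2 * a)) ^ ((Fintype.card ι : ℝ) / 2) * 1)
      ((measurable_gaussKernel _).const_mul _).aestronglyMeasurable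
      (Eventually.of_forall fun z => ?_)
    rw [norm_mul, Real.norm_of_nonneg (by positivity),
      Real.norm_of_nonneg (gaussKernel_nonneg _ _ _)]
    exact mul_le_mul_of_nonneg_left (gaussKernel_le_one (by positivity) _ _) (by positivity)
  have hsq : ∀ t, ∫ z, Φ z t = (∫ x, Real.exp (-a * ‖t - x‖ ^ 2) * u x) ^ 2 := by
    intro t
    rw [sq, ← integral_prod_mul]
    refine integral_congr_ae (Eventually.of_forall fun z => ?_)
    simp only [Φ]
    ring
  constructor
  · simp only [← hsq]
    exact hΦ.integral_prod_right
  · simp only [← hsq]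
    rw [← integral_integral_swap hΦ, ← integral_const_mul]
    refine integral_congr_ae (Eventually.of_forall fun z => ?_)
    simp only [Φ]
    rw [integral_const_mul, integral_gauss_mul_gauss ha]
    ring

/-- Plancherel inequality for an integrable, almost everywhere continuous function. -/
theorem lintegral_sq_le_lintegral_fourierT_sq {u : 𝔼 → ℝ} (hu : Integrable u)
    (hc : ∀ᵐ x, ContinuousAt u x) :
    ∫⁻ x, ENNReal.ofReal (u x ^ 2) ≤
      ∫⁻ ω : 𝔼, ENNReal.ofReal (‖fourierT u ω‖ ^ 2) := by
  -- The smoothings `v m` of `u` by Gaussian probability densities satisfy the inequality and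
  -- converge to `u` at its points of continuity, so that Fatou's lemma applies.
  set D : ℝ := ((Fintype.card ι : ℕ) : ℝ) with hD
  let v : ℕ → 𝔼 → ℝ := fun m t => (Real.pi * (m + 1)) ^ (D / 2) *
    ∫ x : 𝔼, Real.exp (-(Real.pi ^ 2 * (m + 1)) * ‖t - x‖ ^ 2) * u x
  have hv : ∀ m, Integrable (fun t => v m t ^ 2) ∧ ∫⁻ t, ENNReal.ofReal (v m t ^ 2) ≤
      ∫⁻ ω : 𝔼, ENNReal.ofReal (‖fourierT u ω‖ ^ 2) := by
    intro m
    have ha : 0 < Real.pi ^ 2 * ((m : ℝ) + 1) := by positivity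
    obtain ⟨h1, h2⟩ := integral_smoothing_sq hu ha
    have h3 : Integrable (fun t => v m t ^ 2) := by
      simp only [v, mul_pow]
      exact h1.const_mul _
    refine ⟨h3, ?_⟩
    rw [← ofReal_integral_eq_lintegral_ofReal h3 (Eventually.of_forall fun t => sq_nonneg _)]
    simp only [v, mul_pow]
    rw [integral_const_mul, h2, integral_gaussKernel_mul hu (by positivity), ← mul_assoc,
      ← mul_assoc]
    have h4 : ((Real.pi * ((m : ℝ) + 1)) ^ (D / 2)) ^ 2 *
        (Real.pi / (2 * (Real.pi ^ 2 * ((m : ℝ) + 1)))) ^ (D / 2) *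
        (Real.pi / (Real.pi ^ 2 * ((m : ℝ) + 1) / 2)) ^ (D / 2) = 1 := by
      rw [sq, ← Real.mul_rpow (by positivity) (by positivity),
        ← Real.mul_rpow (by positivity) (by positivity),
        ← Real.mul_rpow (by positivity) (by positivity)]
      have : Real.pi * ((m : ℝ) + 1) * (Real.pi * (m + 1)) *
          (Real.pi / (2 * (Real.pi ^ 2 * (m + 1)))) *
          (Real.pi / (Real.pi ^ 2 * (m + 1) / 2)) = 1 := by
        field_simp
      rw [this, Real.one_rpow]
    rw [h4, one_mul, ofReal_integral_eq_lintegral_ofReal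
      (integrable_gauss_mul_norm_fourierT_sq hu (by positivity))
      (Eventually.of_forall fun ω => by positivity)]
    refine lintegral_mono fun ω => ENNReal.ofReal_le_ofReal ?_
    refine mul_le_of_le_one_left (by positivity) ?_
    rw [Real.exp_le_one_iff, neg_mul, Left.neg_nonpos_iff]
    positivity
  have hlim : ∀ᵐ x, Tendsto (fun m => v m x) atTop (𝓝 (u x)) := by
    filter_upwards [hc] with x hx
    have h1 := Real.tendsto_integral_gaussian_smul' (hu.ofReal (𝕜 := ℂ))
      (v := x) (Complex.continuous_ofReal.continuousAt.comp hx)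
    have h2 : Tendsto (fun m : ℕ => (m : ℝ) + 1) atTop atTop :=
      tendsto_atTop_add_const_right _ _ tendsto_natCast_atTop_atTop
    have h3 := (Complex.continuous_re.tendsto _).comp (h1.comp h2)
    refine h3.congr fun m => ?_
    have h4 : ∫ w : 𝔼, ((Real.pi * (((m : ℝ) + 1 : ℝ) : ℂ)) ^ ((Module.finrank ℝ 𝔼 : ℂ) / 2) *
        Complex.exp (-Real.pi ^ 2 * (((m : ℝ) + 1 : ℝ) : ℂ) * ‖x - w‖ ^ 2)) • ((u w : ℝ) : ℂ) =
        ((v m x : ℝ) : ℂ) := by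
      simp only [v]
      rw [← integral_const_mul, ← integral_complex_ofReal]
      refine integral_congr_ae (Eventually.of_forall fun w => ?_)
      dsimp only
      rw [finrank_euclideanSpace, smul_eq_mul]
      push_cast
      rw [Complex.ofReal_cpow (by positivity), hD]
      push_cast
      rw [neg_mul, neg_mul]
      ring
    simp only [Function.comp_apply]
    exact (congrArg Complex.re h4).trans (Complex.ofReal_re _)
  calc ∫⁻ x, ENNReal.ofReal (u x ^ 2)
      = ∫⁻ x, liminf (fun m => ENNReal.ofReal (v m x ^ 2)) atTop := by
        refine lintegral_congr_ae ?_
        filter_upwards [hlim] with x hx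
        exact ((ENNReal.continuous_ofReal.tendsto _).comp (hx.pow 2)).liminf_eq.symm
    _ ≤ liminf (fun m => ∫⁻ x, ENNReal.ofReal (v m x ^ 2)) atTop :=
        lintegral_liminf_le' fun m => (hv m).1.aestronglyMeasurable.aemeasurable.ennreal_ofReal
    _ ≤ _ := by
        refine liminf_le_of_le (by isBoundedDefault) fun b hb => ?_
        obtain ⟨m, hm⟩ := hb.exists
        exact hm.trans (hv m).2

/-- A feature map of the Gaussian kernel into `L²`: the normalized Gaussian bump with parameter
`2 ν` centered at the point. -/
theorem exists_featureMap {ν : ℝ} (hν : 0 < ν) :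
    ∃ φ : 𝔼 → Lp ℝ 2 (volume : Measure 𝔼),
      StronglyMeasurable φ ∧ (∀ x, ‖φ x‖ ≤ 1) ∧
      ∀ x y, inner ℝ (φ x) (φ y) = gaussKernel ν x y := by
  set c : ℝ := √(((Real.pi / (2 * (2 * ν))) ^ ((Fintype.card ι : ℝ) / 2))⁻¹) with hc
  let f : 𝔼 → 𝔼 → ℝ := fun x t => c * Real.exp (-(2 * ν) * ‖t - x‖ ^ 2)
  have hf : ∀ x, MemLp (f x) 2 volume := fun x => by
    rw [memLp_two_iff_integrable_sq (Continuous.aestronglyMeasurable (by fun_prop))]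
    have := (integrable_gauss_mul_gauss (a := 2 * ν) (by positivity) x x).const_mul (c ^ 2)
    refine this.congr (Eventually.of_forall fun t => ?_)
    simp only [f]
    ring
  have hinner : ∀ x y, inner ℝ ((hf x).toLp (f x)) ((hf y).toLp (f y)) = gaussKernel ν x y := by
    intro x y
    rw [L2.inner_def]
    have h1 : ∫ t, inner ℝ (((hf x).toLp (f x) : 𝔼 → ℝ) t) (((hf y).toLp (f y) : 𝔼 → ℝ) t) =
        ∫ t, c ^ 2 * (Real.exp (-(2 * ν) * ‖t - x‖ ^ 2) * Real.exp (-(2 * ν) * ‖t - y‖ ^ 2)) := by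
      refine integral_congr_ae ?_
      filter_upwards [(hf x).coeFn_toLp, (hf y).coeFn_toLp] with t h1 h2
      rw [h1, h2]
      simp only [f, RCLike.inner_apply, conj_trivial]
      ring
    rw [h1, integral_const_mul, integral_gauss_mul_gauss (by positivity), ← mul_assoc,
      hc, Real.sq_sqrt (by positivity), inv_mul_cancel₀ (by positivity), one_mul]
    congr 1
    ring
  have hnorm : ∀ x, ‖(hf x).toLp (f x)‖ = 1 := by
    intro x
    have h1 : ‖(hf x).toLp (f x)‖ ^ 2 = 1 := by
      rw [← real_inner_self_eq_norm_sq, hinner]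
      simp [gaussKernel]
    exact (pow_eq_one_iff_of_nonneg (norm_nonneg _) two_ne_zero).1 h1
  refine ⟨fun x => (hf x).toLp (f x), ?_, fun x => (hnorm x).le, hinner⟩
  refine Continuous.stronglyMeasurable (continuous_iff_continuousAt.2 fun x => ?_)
  rw [ContinuousAt, tendsto_iff_norm_sub_tendsto_zero]
  have h2 : ∀ y, ‖(hf y).toLp (f y) - (hf x).toLp (f x)‖ = √(2 - 2 * gaussKernel ν y x) := by
    intro y
    rw [← Real.sqrt_sq (norm_nonneg _), norm_sub_sq_real, hnorm, hnorm, hinner]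
    congr 1
    ring
  simp only [h2]
  have h3 : Continuous fun y : 𝔼 => √(2 - 2 * gaussKernel ν y x) := by
    unfold gaussKernel
    fun_prop
  have h4 := h3.tendsto x
  simpa [gaussKernel] using h4

end Fourier

/-! ### Sobolev densities and their mean embeddings -/

section Density

variable {ι : Type} [Fintype ι]

local notation "𝔼" => EuclideanSpace ℝ ι

theorem IsDensityOf.integral_eq {f : 𝔼 → ℝ} {P : Measure 𝔼} (hf : IsDensityOf f P)
    {G : Type*} [NormedAddCommGroup G] [NormedSpace ℝ G] (g : 𝔼 → G) :
    ∫ x, g x ∂P = ∫ x, f x • g x := by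
  rw [hf.eq_withDensity, integral_withDensity_eq_integral_toReal_smul₀
    hf.aemeasurable.ennreal_ofReal (Eventually.of_forall fun x => ENNReal.ofReal_lt_top)]
  refine integral_congr_ae (Eventually.of_forall fun x => ?_)
  dsimp only
  rw [ENNReal.toReal_ofReal (hf.nonneg x)]

theorem lintegral_norm_fourierT_sq_le {s : ℝ} (hs : 0 ≤ s) (f : 𝔼 → ℝ) :
    ∫⁻ ω : 𝔼, ENNReal.ofReal (‖fourierT f ω‖ ^ 2) ≤ sobolevNormSq s f := by
  refine lintegral_mono fun ω => ENNReal.ofReal_le_ofReal ?_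
  refine le_mul_of_one_le_left (by positivity) (Real.one_le_rpow ?_ hs)
  nlinarith [sq_nonneg ‖ω‖]

theorem integral_gauss_mul_norm_fourierT_sq_le {f : 𝔼 → ℝ} (hf : Integrable f) {s R : ℝ}
    (hs : 0 ≤ s) (hR : sobolevNormSq s f ≤ ENNReal.ofReal R) (hR0 : 0 ≤ R) {b : ℝ} (hb : 0 < b) :
    ∫ ω : 𝔼, Real.exp (-b * ‖ω‖ ^ 2) * ‖fourierT f ω‖ ^ 2 ≤ R := by
  rw [integral_eq_lintegral_of_nonneg_ae (Eventually.of_forall fun ω => by positivity)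
    (integrable_gauss_mul_norm_fourierT_sq hf hb).aestronglyMeasurable]
  refine ENNReal.toReal_le_of_le_ofReal hR0 (le_trans (lintegral_mono fun ω => ?_)
    ((lintegral_norm_fourierT_sq_le hs f).trans hR))
  refine ENNReal.ofReal_le_ofReal (mul_le_of_le_one_left (by positivity) ?_)
  rw [Real.exp_le_one_iff]
  nlinarith [sq_nonneg ‖ω‖]

/-- The mean kernel value under a law with density in a Sobolev ball is of order `ν ^ (-D / 2)`,
since in the Fourier domain the Gaussian weight is at most `1`. -/
theorem integral_gaussKernel_le {f : 𝔼 → ℝ} {P : Measure 𝔼} (hf : IsDensityOf f P)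
    (hfi : Integrable f) {s R : ℝ} (hs : 0 ≤ s) (hR : sobolevNormSq s f ≤ ENNReal.ofReal R)
    (hR0 : 0 ≤ R) {ν : ℝ} (hν : 0 < ν) :
    ∫ x, ∫ y, gaussKernel ν x y ∂P ∂P ≤ (Real.pi / ν) ^ ((Fintype.card ι : ℝ) / 2) * R := by
  have h1 : ∫ x, ∫ y, gaussKernel ν x y ∂P ∂P =
      ∫ z : 𝔼 × 𝔼, f z.1 * f z.2 * gaussKernel ν z.1 z.2 := by
    have hi : Integrable (fun z : 𝔼 × 𝔼 => f z.1 * f z.2 * gaussKernel ν z.1 z.2) := by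
      refine (hfi.mul_prod hfi).mul_bdd (c := 1) (measurable_gaussKernel ν).aestronglyMeasurable
        (Eventually.of_forall fun z => ?_)
      rw [Real.norm_of_nonneg (gaussKernel_nonneg _ _ _)]
      exact gaussKernel_le_one hν.le _ _
    rw [Measure.volume_eq_prod] at hi ⊢
    rw [integral_prod _ hi]
    simp only [hf.integral_eq, smul_eq_mul]
    refine integral_congr_ae (Eventually.of_forall fun x => ?_)
    dsimp only
    rw [← integral_const_mul]
    refine integral_congr_ae (Eventually.of_forall fun y => ?_)
    dsimp only
    ring
  rw [h1, integral_gaussKernel_mul hfi hν]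
  exact mul_le_mul_of_nonneg_left
    (integral_gauss_mul_norm_fourierT_sq_le hfi hs hR hR0 (by positivity)) (by positivity)

variable {H : Type} [NormedAddCommGroup H] [InnerProductSpace ℝ H] [CompleteSpace H]

theorem norm_sq_integral_smul {u : 𝔼 → ℝ} (hu : Integrable u) {φ : 𝔼 → H}
    (hφ : StronglyMeasurable φ) (hφ1 : ∀ x, ‖φ x‖ ≤ 1) :
    ‖∫ x, u x • φ x‖ ^ 2 = ∫ z : 𝔼 × 𝔼, u z.1 * u z.2 * inner ℝ (φ z.1) (φ z.2) := by
  have hi : Integrable fun x => u x • φ x := by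
    refine hu.norm.mono' (hu.aestronglyMeasurable.smul hφ.aestronglyMeasurable)
      (Eventually.of_forall fun x => ?_)
    rw [norm_smul]
    exact mul_le_of_le_one_right (norm_nonneg _) (hφ1 x)
  have hK : Integrable (fun z : 𝔼 × 𝔼 => u z.1 * u z.2 * inner ℝ (φ z.1) (φ z.2))
      (volume.prod volume) := by
    refine (hu.mul_prod hu).mul_bdd (c := 1) ((hφ.comp_measurable measurable_fst).inner
      (hφ.comp_measurable measurable_snd)).aestronglyMeasurable (Eventually.of_forall fun z => ?_)
    refine (norm_inner_le_norm _ _).trans ?_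
    nlinarith [hφ1 z.1, hφ1 z.2, norm_nonneg (φ z.1), norm_nonneg (φ z.2)]
  rw [Measure.volume_eq_prod, integral_prod _ hK, ← real_inner_self_eq_norm_sq]
  rw [← integral_inner hi]
  refine integral_congr_ae (Eventually.of_forall fun x => ?_)
  dsimp only
  rw [real_inner_smul_right, real_inner_comm, ← integral_inner hi, ← integral_const_mul]
  refine integral_congr_ae (Eventually.of_forall fun y => ?_)
  dsimp only
  rw [real_inner_smul_right]
  ring

theorem integral_inner_integral {E : Type*} [MeasurableSpace E] (P Q : Measure E)
    [IsFiniteMeasure P] [IsFiniteMeasure Q] {φ : E → H} (hφ : StronglyMeasurable φ)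
    (hφ1 : ∀ x, ‖φ x‖ ≤ 1) :
    ∫ x, ∫ y, inner ℝ (φ x) (φ y) ∂Q ∂P = inner ℝ (∫ x, φ x ∂P) (∫ y, φ y ∂Q) := by
  have hi : ∀ (R' : Measure E) [IsFiniteMeasure R'], Integrable φ R' := fun R' _ =>
    Integrable.of_bound hφ.aestronglyMeasurable 1 (Eventually.of_forall hφ1)
  rw [real_inner_comm, ← integral_inner (hi P)]
  refine integral_congr_ae (Eventually.of_forall fun x => ?_)
  dsimp only
  rw [integral_inner (hi Q), real_inner_comm]

/-- The kernel is positive definite, so the mixed term is at most the average of the pure ones. -/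
theorem integral_gaussKernel_mixed_le {P Q : Measure 𝔼} [IsFiniteMeasure P] [IsFiniteMeasure Q]
    {ν B : ℝ} (hν : 0 < ν) (hP : ∫ x, ∫ y, gaussKernel ν x y ∂P ∂P ≤ B)
    (hQ : ∫ x, ∫ y, gaussKernel ν x y ∂Q ∂Q ≤ B) :
    ∫ x, ∫ y, gaussKernel ν x y ∂Q ∂P ≤ B := by
  obtain ⟨φ, hφ, hφ1, hG⟩ := exists_featureMap (ι := ι) hν
  simp only [← hG, integral_inner_integral _ _ hφ hφ1] at hP hQ ⊢
  rw [real_inner_self_eq_norm_sq] at hP hQ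
  nlinarith [real_inner_le_norm (∫ x, φ x ∂P) (∫ x, φ x ∂Q),
    sq_nonneg (‖∫ x, φ x ∂P‖ - ‖∫ x, φ x ∂Q‖)]

/-- Frequencies with `‖ω‖² ≤ ν` are seen by the kernel up to the factor `exp (1 / 4)`, and the
higher ones carry at most `ν ^ (-s) * R`. -/
theorem sq_le_of_sobolevNormSq_le {u : 𝔼 → ℝ} (hu : Integrable u)
    (hc : ∀ᵐ x, ContinuousAt u x) {s R δ ν : ℝ} (hs : 0 ≤ s) (hR0 : 0 ≤ R)
    (hR : sobolevNormSq s u ≤ ENNReal.ofReal R) (hδ0 : 0 ≤ δ) (hν : 0 < ν)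
    (hδ : ENNReal.ofReal δ ≤ eLpNorm u 2 volume) :
    δ ^ 2 ≤ Real.exp (1 / 4) * (∫ ω : 𝔼, Real.exp (-(1 / (4 * ν)) * ‖ω‖ ^ 2) *
      ‖fourierT u ω‖ ^ 2) + ν ^ (-s) * R := by
  set I := ∫ ω : 𝔼, Real.exp (-(1 / (4 * ν)) * ‖ω‖ ^ 2) * ‖fourierT u ω‖ ^ 2 with hI
  have hI0 : 0 ≤ I := integral_nonneg fun ω => by positivity
  have h1 : ENNReal.ofReal (δ ^ 2) ≤ ∫⁻ ω : 𝔼, ENNReal.ofReal (‖fourierT u ω‖ ^ 2) := by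
    refine le_trans ?_ (lintegral_sq_le_lintegral_fourierT_sq hu hc)
    have h2 : eLpNorm u 2 volume ^ 2 = ∫⁻ x, ENNReal.ofReal (u x ^ 2) := by
      have := eLpNorm_nnreal_pow_eq_lintegral (μ := (volume : Measure 𝔼)) (f := u)
        (p := 2) two_ne_zero
      have h3 : ((2 : NNReal) : ℝ≥0∞) = 2 := by norm_num
      have h4 : ((2 : NNReal) : ℝ) = ((2 : ℕ) : ℝ) := by norm_num
      rw [h3, h4, ENNReal.rpow_natCast] at this
      rw [this]
      refine lintegral_congr fun x => ?_
      rw [ENNReal.rpow_natCast, ← ofReal_norm, ← ENNReal.ofReal_pow (norm_nonneg _),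
        Real.norm_eq_abs, sq_abs]
    rw [← h2, ENNReal.ofReal_pow hδ0]
    gcongr
  have h2 : ∫⁻ ω : 𝔼, ENNReal.ofReal (‖fourierT u ω‖ ^ 2) ≤
      ENNReal.ofReal (Real.exp (1 / 4) * I + ν ^ (-s) * R) := by
    have h3 : ∀ ω : 𝔼, ‖fourierT u ω‖ ^ 2 ≤
        Real.exp (1 / 4) * (Real.exp (-(1 / (4 * ν)) * ‖ω‖ ^ 2) * ‖fourierT u ω‖ ^ 2) +
        ν ^ (-s) * ((1 + ‖ω‖ ^ 2) ^ s * ‖fourierT u ω‖ ^ 2) := by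
      intro ω
      rcases le_total (‖ω‖ ^ 2) ν with hω | hω
      · refine le_trans ?_ (le_add_of_nonneg_right (by positivity))
        rw [← mul_assoc, ← Real.exp_add]
        refine le_mul_of_one_le_left (by positivity) (Real.one_le_exp ?_)
        have : 1 / (4 * ν) * ‖ω‖ ^ 2 ≤ 1 / (4 * ν) * ν := by gcongr
        have h5 : 1 / (4 * ν) * ν = 1 / 4 := by field_simp
        linarith
      · refine le_trans ?_ (le_add_of_nonneg_left (by positivity))
        rw [← mul_assoc]
        refine le_mul_of_one_le_left (by positivity) ?_
        rw [Real.rpow_neg hν.le, inv_mul_eq_div, one_le_div (by positivity)]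
        exact Real.rpow_le_rpow hν.le (by linarith) hs
    calc ∫⁻ ω : 𝔼, ENNReal.ofReal (‖fourierT u ω‖ ^ 2)
        ≤ ∫⁻ ω : 𝔼, (ENNReal.ofReal (Real.exp (1 / 4)) *
            ENNReal.ofReal (Real.exp (-(1 / (4 * ν)) * ‖ω‖ ^ 2) * ‖fourierT u ω‖ ^ 2) +
            ENNReal.ofReal (ν ^ (-s)) *
            ENNReal.ofReal ((1 + ‖ω‖ ^ 2) ^ s * ‖fourierT u ω‖ ^ 2)) := by
          refine lintegral_mono fun ω => ?_
          rw [← ENNReal.ofReal_mul (by positivity), ← ENNReal.ofReal_mul (by positivity),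
            ← ENNReal.ofReal_add (by positivity) (by positivity)]
          exact ENNReal.ofReal_le_ofReal (h3 ω)
      _ = ENNReal.ofReal (Real.exp (1 / 4)) * ENNReal.ofReal I +
            ENNReal.ofReal (ν ^ (-s)) * sobolevNormSq s u := by
          have hint := integrable_gauss_mul_norm_fourierT_sq hu (b := 1 / (4 * ν)) (by positivity)
          rw [lintegral_add_left'
              (hint.aestronglyMeasurable.aemeasurable.ennreal_ofReal.const_mul _),
            lintegral_const_mul' _ _ ENNReal.ofReal_ne_top,
            lintegral_const_mul' _ _ ENNReal.ofReal_ne_top,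
            ← ofReal_integral_eq_lintegral_ofReal hint (Eventually.of_forall fun ω => by positivity)]
          rfl
      _ ≤ ENNReal.ofReal (Real.exp (1 / 4)) * ENNReal.ofReal I +
            ENNReal.ofReal (ν ^ (-s)) * ENNReal.ofReal R := by gcongr
      _ = _ := by
          rw [← ENNReal.ofReal_mul (by positivity), ← ENNReal.ofReal_mul (by positivity),
            ← ENNReal.ofReal_add (by positivity) (by positivity)]
  exact (ENNReal.ofReal_le_ofReal_iff (by positivity)).1 (h1.trans h2)

theorem fourierT_sub {f g : 𝔼 → ℝ} (hf : Integrable f) (hg : Integrable g) (ω : 𝔼) :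
    fourierT (fun x => f x - g x) ω = fourierT f ω - fourierT g ω := by
  rw [fourierT, fourierT, fourierT, ← mul_sub,
    ← integral_sub (integrable_mul_phase hf ω) (integrable_mul_phase hg ω)]
  congr 2
  funext x
  push_cast
  ring

theorem sobolevNormSq_sub_le {s : ℝ} {f g : 𝔼 → ℝ} (hf : Integrable f) (hg : Integrable g) :
    sobolevNormSq s (fun x => f x - g x) ≤ 2 * sobolevNormSq s f + 2 * sobolevNormSq s g := by
  have hm : ∀ h : 𝔼 → ℝ, Integrable h → Measurable fun ω : 𝔼 =>
      ENNReal.ofReal ((1 + ‖ω‖ ^ 2) ^ s * ‖fourierT h ω‖ ^ 2) := fun h hh => by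
    have := (continuous_fourierT hh).measurable
    fun_prop
  rw [sobolevNormSq, sobolevNormSq, sobolevNormSq, ← lintegral_const_mul _ (hm f hf),
    ← lintegral_const_mul _ (hm g hg), ← lintegral_add_left ((hm f hf).const_mul _)]
  refine lintegral_mono fun ω => ?_
  have h2 : ∀ a : ℝ, 2 * ENNReal.ofReal a = ENNReal.ofReal (2 * a) := fun a => by
    rw [ENNReal.ofReal_mul (by norm_num)]
    norm_num
  rw [h2, h2, ← ENNReal.ofReal_add (by positivity) (by positivity), fourierT_sub hf hg]
  refine ENNReal.ofReal_le_ofReal ?_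
  have h3 : ‖fourierT f ω - fourierT g ω‖ ^ 2 ≤ 2 * ‖fourierT f ω‖ ^ 2 + 2 * ‖fourierT g ω‖ ^ 2 := by
    have := norm_sub_le (fourierT f ω) (fourierT g ω)
    nlinarith [sq_nonneg (‖fourierT f ω‖ - ‖fourierT g ω‖), norm_nonneg (fourierT f ω),
      norm_nonneg (fourierT g ω), norm_nonneg (fourierT f ω - fourierT g ω)]
  have h4 : (0 : ℝ) ≤ (1 + ‖ω‖ ^ 2) ^ s := by positivity
  nlinarith

end Density

section Tensor

variable {k : ℕ} {d : Fin k → ℕ}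

theorem one_add_sum_le_prod_one_add {α : Type*} (t : Finset α) {a : α → ℝ} (ha : ∀ i, 0 ≤ a i) :
    1 + ∑ i ∈ t, a i ≤ ∏ i ∈ t, (1 + a i) := by
  classical
  induction t using Finset.induction_on with
  | empty => simp
  | insert i t hi ih =>
    rw [Finset.sum_insert hi, Finset.prod_insert hi]
    have : 0 ≤ ∑ i ∈ t, a i := Finset.sum_nonneg fun i _ => ha i
    nlinarith [ha i]

theorem integrable_tensor {q : (j : Fin k) → EuclideanSpace ℝ (Fin (d j)) → ℝ}
    (hq : ∀ j, Integrable (q j)) : Integrable (tensor q) :=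
  integrable_block_prod hq

theorem continuousAt_tensor_ae {q : (j : Fin k) → EuclideanSpace ℝ (Fin (d j)) → ℝ}
    (hq : ∀ j, ∀ᵐ x, ContinuousAt (q j) x) : ∀ᵐ x, ContinuousAt (tensor q) x := by
  have h : ∀ᵐ x : Joint d, ∀ j, ContinuousAt (q j) (block j x) :=
    ae_all_iff.2 fun j => (quasiMeasurePreserving_block j).ae (hq j)
  filter_upwards [h] with x hx
  exact tendsto_finsetProd _ fun j _ => (hx j).comp (continuous_block j).continuousAt

theorem fourierT_tensor (q : (j : Fin k) → EuclideanSpace ℝ (Fin (d j)) → ℝ) (ω : Joint d) :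
    fourierT (tensor q) ω = ∏ j, fourierT (q j) (block j ω) := by
  simp only [fourierT, Finset.prod_mul_distrib]
  congr 1
  · rw [← Complex.ofReal_prod, ← Real.rpow_sum_of_pos (by positivity)]
    congr 2
    rw [card_joint]
    push_cast
    simp only [Fintype.card_fin]
    rw [← Finset.sum_neg_distrib, Finset.sum_div]
  · rw [← integral_block_prod]
    refine integral_congr_ae (Eventually.of_forall fun x => ?_)
    dsimp only
    rw [Finset.prod_mul_distrib, ← Complex.exp_sum, tensor, inner_eq_sum_block]
    push_cast
    congr 2
    rw [← Finset.sum_mul, Finset.sum_neg_distrib]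

theorem sobolevNormSq_tensor_le {s : ℝ} (hs : 0 ≤ s)
    {q : (j : Fin k) → EuclideanSpace ℝ (Fin (d j)) → ℝ} (hq : ∀ j, Integrable (q j)) :
    sobolevNormSq s (tensor q) ≤ ∏ j, sobolevNormSq s (q j) := by
  have hm : ∀ j, Measurable fun ω : EuclideanSpace ℝ (Fin (d j)) =>
      ENNReal.ofReal ((1 + ‖ω‖ ^ 2) ^ s * ‖fourierT (q j) ω‖ ^ 2) := fun j => by
    have := (continuous_fourierT (hq j)).measurable
    fun_prop
  unfold sobolevNormSq
  rw [← lintegral_block_prod _ fun j => (hm j).aemeasurable]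
  refine lintegral_mono fun ω => ?_
  rw [← ENNReal.ofReal_prod_of_nonneg fun j _ => by positivity]
  refine ENNReal.ofReal_le_ofReal ?_
  rw [Finset.prod_mul_distrib, fourierT_tensor, norm_prod, Finset.prod_pow,
    Real.finsetProd_rpow _ _ fun j _ => by positivity]
  refine mul_le_mul_of_nonneg_right (Real.rpow_le_rpow (by positivity) ?_ hs) (by positivity)
  rw [norm_sq_eq_sum_block]
  exact one_add_sum_le_prod_one_add _ fun j => by positivity

variable {H : Type} [NormedAddCommGroup H] [InnerProductSpace ℝ H] [CompleteSpace H]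

/-- The consequences of membership in the alternative that enter the analysis of the test. -/
theorem altHyp_bounds {s : ℝ} (hs : 0 < s) {M : Fin k → ℝ} (hM : ∀ j, 0 < M j) {δ : ℝ}
    (hδ : 0 ≤ δ) {P : Measure (Joint d)} (hP : P ∈ altHyp d s M δ) {ν : ℝ} (hν : 0 < ν) :
    IsProbabilityMeasure P ∧
    (∫ x, ∫ y, gaussKernel ν x y ∂P ∂P ≤
      (Real.pi / ν) ^ ((∑ j, (d j : ℝ)) / 2) * (∏ j, M j) ^ 2) ∧
    (∫ x, ∫ y, gaussKernel ν x y ∂(productLaw P) ∂(productLaw P) ≤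
      (Real.pi / ν) ^ ((∑ j, (d j : ℝ)) / 2) * (∏ j, M j) ^ 2) ∧
    (∀ j, ∫ x, ∫ y, gaussKernel ν x y ∂(marginal P j) ∂(marginal P j) ≤
      (Real.pi / ν) ^ ((d j : ℝ) / 2) * M j ^ 2) ∧
    ∀ φ : Joint d → H, StronglyMeasurable φ → (∀ x, ‖φ x‖ ≤ 1) →
      (∀ x y, inner ℝ (φ x) (φ y) = gaussKernel ν x y) →
      δ ^ 2 ≤ Real.exp (1 / 4) * ((Real.pi / ν) ^ (-((∑ j, (d j : ℝ)) / 2)) *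
        ‖meanContrast φ P‖ ^ 2) + ν ^ (-s) * (4 * (∏ j, M j) ^ 2) := by
  obtain ⟨hprob, p, q, hp, hpW, hq, hΔ⟩ := hP
  have hcard : ((Fintype.card ((j : Fin k) × Fin (d j)) : ℕ) : ℝ) = ∑ j, (d j : ℝ) := by
    rw [card_joint]
    push_cast
    rfl
  have hM0 : 0 ≤ ∏ j, M j := Finset.prod_nonneg fun j _ => (hM j).le
  have hMj : ∀ j, sobolevNormSq s (q j) ≤ ENNReal.ofReal (M j ^ 2) := fun j => by
    rw [ENNReal.ofReal_pow (hM j).le]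
    exact (hq j).2.2.2
  have hMp : sobolevNormSq s p ≤ ENNReal.ofReal ((∏ j, M j) ^ 2) := by
    rw [ENNReal.ofReal_pow hM0]
    exact hpW.2.2
  have hqi : ∀ j, Integrable (q j) := fun j => (hq j).2.1
  have hti : Integrable (tensor q) := integrable_tensor hqi
  have hMt : sobolevNormSq s (tensor q) ≤ ENNReal.ofReal ((∏ j, M j) ^ 2) := by
    refine (sobolevNormSq_tensor_le hs.le hqi).trans ((Finset.prod_le_prod' fun j _ =>
      hMj j).trans ?_)
    rw [← ENNReal.ofReal_prod_of_nonneg fun j _ => by positivity, Finset.prod_pow]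
  have hpl := productLaw_eq_withDensity (P := P) fun j => (hq j).1
  have htd : IsDensityOf (tensor q) (productLaw P) :=
    ⟨fun x => Finset.prod_nonneg fun j _ => (hq j).1.nonneg _,
      aemeasurable_tensor fun j => (hq j).1.aemeasurable, hpl⟩
  refine ⟨hprob, ?_, ?_, fun j => ?_, fun φ hφ hφ1 hφG => ?_⟩
  · rw [← hcard]
    exact integral_gaussKernel_le hp hpW.1 hs.le hMp (by positivity) hν
  · rw [← hcard]
    exact integral_gaussKernel_le htd hti hs.le hMt (by positivity) hν
  · have := integral_gaussKernel_le (hq j).1 (hqi j) hs.le (hMj j) (by positivity) hν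
    rwa [Fintype.card_fin] at this
  · have hui : Integrable (fun x => p x - tensor q x) := hpW.1.sub hti
    have huc : ∀ᵐ x, ContinuousAt (fun x => p x - tensor q x) x := by
      filter_upwards [hpW.2.1, continuousAt_tensor_ae fun j => (hq j).2.2.1] with x h1 h2
      exact h1.sub h2
    have hus : sobolevNormSq s (fun x => p x - tensor q x) ≤
        ENNReal.ofReal (4 * (∏ j, M j) ^ 2) := by
      refine (sobolevNormSq_sub_le hpW.1 hti).trans ?_
      have h4 : ENNReal.ofReal (4 * (∏ j, M j) ^ 2) =
          2 * ENNReal.ofReal ((∏ j, M j) ^ 2) + 2 * ENNReal.ofReal ((∏ j, M j) ^ 2) := by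
        rw [← two_mul, ← mul_assoc, ENNReal.ofReal_mul (by norm_num)]
        norm_num
      rw [h4]
      gcongr
    have hmc : meanContrast φ P = ∫ x, (p x - tensor q x) • φ x := by
      have hsm : ∀ {f : Joint d → ℝ}, Integrable f → Integrable fun x => f x • φ x := by
        intro f hf
        refine hf.norm.mono' (hf.aestronglyMeasurable.smul hφ.aestronglyMeasurable)
          (Eventually.of_forall fun x => ?_)
        rw [norm_smul]
        exact mul_le_of_le_one_right (norm_nonneg _) (hφ1 x)
      rw [meanContrast, hp.integral_eq, htd.integral_eq, ← integral_sub (hsm hpW.1) (hsm hti)]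
      simp only [sub_smul]
    have hkey := sq_le_of_sobolevNormSq_le hui huc hs.le (by positivity) hus hδ hν hΔ
    have hn : ‖meanContrast φ P‖ ^ 2 = (Real.pi / ν) ^ ((∑ j, (d j : ℝ)) / 2) *
        ∫ ω : Joint d, Real.exp (-(1 / (4 * ν)) * ‖ω‖ ^ 2) *
          ‖fourierT (fun x => p x - tensor q x) ω‖ ^ 2 := by
      rw [hmc, norm_sq_integral_smul hui hφ hφ1]
      simp only [hφG]
      rw [integral_gaussKernel_mul hui hν, hcard]
    rw [hn, ← mul_assoc ((Real.pi / ν) ^ (-((∑ j, (d j : ℝ)) / 2))),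
      ← Real.rpow_add (by positivity), neg_add_cancel, Real.rpow_zero, one_mul]
    exact hkey

end Tensor

/-! ### The studentized statistic under the alternative -/

section Statistic

variable {k : ℕ} {d : Fin k → ℕ} {n : ℕ}

theorem estA_nonneg (ν : ℝ) (X : Fin n → Joint d) (l : Fin k) : 0 ≤ estA ν X l :=
  uAverage_nonneg fun _ => gaussKernel_nonneg _ _ _

theorem estB_nonneg (ν : ℝ) (X : Fin n → Joint d) (l : Fin k) : 0 ≤ estB ν X l :=
  uAverage_nonneg fun _ => mul_nonneg (gaussKernel_nonneg _ _ _) (gaussKernel_nonneg _ _ _)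

theorem estC_nonneg (ν : ℝ) (X : Fin n → Joint d) (l : Fin k) : 0 ≤ estC ν X l :=
  uAverage_nonneg fun _ => mul_nonneg (gaussKernel_nonneg _ _ _) (gaussKernel_nonneg _ _ _)

/-- By the arithmetic-geometric mean inequality and `G_ν² = G_{2ν}`, an average of products of two
kernel values is at most the average of single values of `G_{2ν}`. -/
theorem uAverage_mul_le_estA {m : ℕ} (hm : m ≤ n) (ν : ℝ) (X : Fin n → Joint d) (l : Fin k)
    (g₁ g₂ : Fin 2 ↪ Fin m) :
    (uAverage fun e : Fin m ↪ Fin n =>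
      gaussKernel ν (block l (X (e (g₁ 0)))) (block l (X (e (g₁ 1)))) *
        gaussKernel ν (block l (X (e (g₂ 0)))) (block l (X (e (g₂ 1))))) ≤ estA ν X l := by
  have hc : Fintype.card (Fin m) ≤ n := by simpa using hm
  have h1 := uAverage_comp_embedding hc g₁ fun e : Fin 2 ↪ Fin n =>
    gaussKernel (2 * ν) (block l (X (e 0))) (block l (X (e 1)))
  have h2 := uAverage_comp_embedding hc g₂ fun e : Fin 2 ↪ Fin n =>
    gaussKernel (2 * ν) (block l (X (e 0))) (block l (X (e 1)))
  have h3 : estA ν X l = 2⁻¹ * ((uAverage fun e : Fin m ↪ Fin n =>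
      gaussKernel (2 * ν) (block l (X (e (g₁ 0)))) (block l (X (e (g₁ 1))))) +
      uAverage fun e : Fin m ↪ Fin n =>
      gaussKernel (2 * ν) (block l (X (e (g₂ 0)))) (block l (X (e (g₂ 1))))) := by
    simp only [Function.Embedding.trans_apply] at h1 h2
    rw [h1, h2, estA]
    ring
  rw [h3, ← uAverage_add, ← uAverage_mul_left]
  refine uAverage_mono fun e => ?_
  rw [← gaussKernel_sq, ← gaussKernel_sq]
  nlinarith [sq_nonneg (gaussKernel ν (block l (X (e (g₁ 0)))) (block l (X (e (g₁ 1)))) -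
    gaussKernel ν (block l (X (e (g₂ 0)))) (block l (X (e (g₂ 1)))))]

theorem estB_le_estA (hn : 3 ≤ n) (ν : ℝ) (X : Fin n → Joint d) (l : Fin k) :
    estB ν X l ≤ estA ν X l :=
  uAverage_mul_le_estA hn ν X l ⟨![0, 1], by decide⟩ ⟨![0, 2], by decide⟩

theorem estC_le_estA (hn : 4 ≤ n) (ν : ℝ) (X : Fin n → Joint d) (l : Fin k) :
    estC ν X l ≤ estA ν X l :=
  uAverage_mul_le_estA hn ν X l ⟨![0, 2], by decide⟩ ⟨![1, 3], by decide⟩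

/-- All terms of the variance estimate are dominated by the product of the `a l`. -/
theorem varianceForm_le {a b c : Fin k → ℝ} (hb : ∀ l, 0 ≤ b l) (hc : ∀ l, 0 ≤ c l)
    (hba : ∀ l, b l ≤ a l) (hca : ∀ l, c l ≤ a l) :
    varianceForm a b c ≤ (2 + 4 * k + 2 * k ^ 2) * ∏ l, a l := by
  have ha : ∀ l, 0 ≤ a l := fun l => (hb l).trans (hba l)
  set p := ∏ l, a l with hp
  have hp0 : 0 ≤ p := Finset.prod_nonneg fun l _ => ha l
  have hB0 : 0 ≤ ∏ l, b l := Finset.prod_nonneg fun l _ => hb l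
  have hC0 : 0 ≤ ∏ l, c l := Finset.prod_nonneg fun l _ => hc l
  have hB : ∏ l, b l ≤ p := Finset.prod_le_prod (fun l _ => hb l) fun l _ => hba l
  have hC : ∏ l, c l ≤ p := Finset.prod_le_prod (fun l _ => hc l) fun l _ => hca l
  have her : ∀ (j : Fin k) (x : Fin k → ℝ), (∀ l, 0 ≤ x l) → (∀ l, x l ≤ a l) →
      0 ≤ ∏ l ∈ Finset.univ.erase j, x l ∧
      a j * ∏ l ∈ Finset.univ.erase j, x l ≤ p := by
    intro j x hx hxa
    refine ⟨Finset.prod_nonneg fun l _ => hx l, ?_⟩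
    rw [hp, ← Finset.mul_prod_erase Finset.univ a (Finset.mem_univ j)]
    exact mul_le_mul_of_nonneg_left (Finset.prod_le_prod (fun l _ => hx l) fun l _ => hxa l) (ha j)
  have h2 : ∀ j, -(a j * ∏ l ∈ Finset.univ.erase j, b l - ∏ l, b l
      - b j * ∏ l ∈ Finset.univ.erase j, c l + ∏ l, c l) ≤ 2 * p := by
    intro j
    obtain ⟨e1, e2⟩ := her j b hb hba
    obtain ⟨e3, e4⟩ := her j c hc hca
    have e5 : 0 ≤ a j * ∏ l ∈ Finset.univ.erase j, b l := mul_nonneg (ha j) e1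
    have e6 : b j * ∏ l ∈ Finset.univ.erase j, c l ≤ a j * ∏ l ∈ Finset.univ.erase j, c l :=
      mul_le_mul_of_nonneg_right (hba j) e3
    linarith
  have h3 : ∀ j₁ j₂, (if j₁ = j₂ then
        (a j₁ - 2 * b j₁ + c j₁) * ∏ l ∈ Finset.univ.erase j₁, c l
      else (b j₁ - c j₁) * (b j₂ - c j₂) * ∏ l ∈ (Finset.univ.erase j₁).erase j₂, c l) ≤ 2 * p := by
    intro j₁ j₂
    split_ifs with h
    · obtain ⟨e3, e4⟩ := her j₁ c hc hca
      have e5 : (a j₁ - 2 * b j₁ + c j₁) * ∏ l ∈ Finset.univ.erase j₁, c l ≤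
          (2 * a j₁) * ∏ l ∈ Finset.univ.erase j₁, c l :=
        mul_le_mul_of_nonneg_right (by linarith [hb j₁, hca j₁]) e3
      linarith
    · have hmem : j₂ ∈ Finset.univ.erase j₁ := by simp [Ne.symm h]
      have e1 : 0 ≤ ∏ l ∈ (Finset.univ.erase j₁).erase j₂, c l :=
        Finset.prod_nonneg fun l _ => hc l
      have e2 : a j₁ * (a j₂ * ∏ l ∈ (Finset.univ.erase j₁).erase j₂, c l) ≤ p := by
        rw [hp, ← Finset.mul_prod_erase Finset.univ a (Finset.mem_univ j₁),
          ← Finset.mul_prod_erase _ a hmem]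
        refine mul_le_mul_of_nonneg_left (mul_le_mul_of_nonneg_left ?_ (ha j₂)) (ha j₁)
        exact Finset.prod_le_prod (fun l _ => hc l) fun l _ => hca l
      have e3 : (b j₁ - c j₁) * (b j₂ - c j₂) ≤ a j₁ * a j₂ := by
        have f1 : |b j₁ - c j₁| ≤ a j₁ := abs_le.2 ⟨by linarith [hb j₁, hca j₁],
          by linarith [hc j₁, hba j₁]⟩
        have f2 : |b j₂ - c j₂| ≤ a j₂ := abs_le.2 ⟨by linarith [hb j₂, hca j₂],
          by linarith [hc j₂, hba j₂]⟩
        calc (b j₁ - c j₁) * (b j₂ - c j₂) ≤ |(b j₁ - c j₁) * (b j₂ - c j₂)| := le_abs_self _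
          _ = |b j₁ - c j₁| * |b j₂ - c j₂| := abs_mul _ _
          _ ≤ a j₁ * a j₂ := mul_le_mul f1 f2 (abs_nonneg _) (ha j₁)
      have e4 := mul_le_mul_of_nonneg_right e3 e1
      linarith
  have s2 : -∑ j, (a j * ∏ l ∈ Finset.univ.erase j, b l - ∏ l, b l
      - b j * ∏ l ∈ Finset.univ.erase j, c l + ∏ l, c l) ≤ k * (2 * p) := by
    rw [← Finset.sum_neg_distrib]
    refine (Finset.sum_le_sum fun j _ => h2 j).trans (le_of_eq ?_)
    simp
  have s3 : ∑ j₁, ∑ j₂, (if j₁ = j₂ then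
        (a j₁ - 2 * b j₁ + c j₁) * ∏ l ∈ Finset.univ.erase j₁, c l
      else (b j₁ - c j₁) * (b j₂ - c j₂) * ∏ l ∈ (Finset.univ.erase j₁).erase j₂, c l) ≤
      k * (k * (2 * p)) := by
    refine (Finset.sum_le_sum fun j _ => Finset.sum_le_sum fun i _ => h3 j i).trans (le_of_eq ?_)
    simp
  rw [varianceForm]
  nlinarith

theorem measurable_uAverage {Ω τ : Type} [MeasurableSpace Ω] [Fintype τ] [DecidableEq τ]
    {f : (τ ↪ Fin n) → Ω → ℝ} (hf : ∀ e, Measurable (f e)) :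
    Measurable fun ω => uAverage fun e => f e ω := by
  unfold uAverage
  exact (Finset.measurable_fun_sum _ fun e _ => hf e).div_const _

theorem measurable_gaussKernel_comp {Ω ι : Type} [MeasurableSpace Ω] [Fintype ι] (ν : ℝ)
    {f g : Ω → EuclideanSpace ℝ ι} (hf : Measurable f) (hg : Measurable g) :
    Measurable fun ω => gaussKernel ν (f ω) (g ω) := by
  unfold gaussKernel
  exact (((hf.sub hg).norm.pow_const 2).const_mul (-ν)).exp

theorem measurable_estA (ν : ℝ) (l : Fin k) :
    Measurable fun X : Fin n → Joint d => estA ν X l := by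
  unfold estA
  refine measurable_uAverage fun e => measurable_gaussKernel_comp _ ?_ ?_
  · exact (measurable_block l).comp (measurable_pi_apply (e 0))
  · exact (measurable_block l).comp (measurable_pi_apply (e 1))

theorem measurable_dHSIC (ν : ℝ) : Measurable fun X : Fin n → Joint d => dHSIC ν X := by
  unfold dHSIC
  refine ((measurable_uAverage fun e => ?_).add (measurable_uAverage fun e => ?_)).sub
    ((measurable_uAverage fun e => ?_).const_mul 2)
  · exact measurable_gaussKernel_comp ν (measurable_pi_apply _) (measurable_pi_apply _)
  · exact measurable_gaussKernel_comp ν (measurable_mix _) (measurable_mix _)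
  · exact measurable_gaussKernel_comp ν (measurable_pi_apply _) (measurable_mix _)

theorem integral_estA_le (hn : 2 ≤ n) {ν : ℝ} (hν : 0 < ν) (P : Measure (Joint d))
    [IsProbabilityMeasure P] (l : Fin k) {B : ℝ}
    (hB : ∫ x, ∫ y, gaussKernel (2 * ν) x y ∂(marginal P l) ∂(marginal P l) ≤ B) :
    Integrable (fun X => estA ν X l) (Measure.pi fun _ : Fin n => P) ∧
    ∫ X, estA ν X l ∂(Measure.pi fun _ : Fin n => P) ≤ B := by
  have hblock : ∀ i : Fin n, MeasurePreserving (fun X : Fin n → Joint d => block l (X i))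
      (Measure.pi fun _ => P) (marginal P l) := fun i =>
    (⟨measurable_block l, rfl⟩ : MeasurePreserving (block l) P (marginal P l)).comp
      (measurePreserving_eval (fun _ : Fin n => P) i)
  have key : ∀ e : Fin 2 ↪ Fin n, Integrable (fun X : Fin n → Joint d =>
      gaussKernel (2 * ν) (block l (X (e 0))) (block l (X (e 1)))) (Measure.pi fun _ => P) ∧
      ∫ X : Fin n → Joint d, gaussKernel (2 * ν) (block l (X (e 0))) (block l (X (e 1)))
        ∂(Measure.pi fun _ => P) ≤ B := by
    intro e
    have h01 : e 1 ∉ ({e 0} : Finset (Fin n)) := by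
      rw [Finset.mem_singleton]
      exact fun h => absurd (e.injective h) (by decide)
    have h := measurePreserving_pair (hblock (e 0)) (hblock (e 1)) {e 0}
      (fun x y => by rw [Finset.piecewise_eq_of_mem _ _ _ (Finset.mem_singleton_self _)])
      (fun x y => by rw [Finset.piecewise_eq_of_notMem _ _ _ h01])
    have hi : ∀ (ρ : Measure (EuclideanSpace ℝ (Fin (d l)) × EuclideanSpace ℝ (Fin (d l))))
        [IsFiniteMeasure ρ], Integrable (fun z : EuclideanSpace ℝ (Fin (d l)) ×
          EuclideanSpace ℝ (Fin (d l)) => gaussKernel (2 * ν) z.1 z.2) ρ := fun ρ _ => by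
      refine Integrable.of_bound (measurable_gaussKernel _).aestronglyMeasurable 1
        (Eventually.of_forall fun z => ?_)
      rw [Real.norm_of_nonneg (gaussKernel_nonneg _ _ _)]
      exact gaussKernel_le_one (by positivity) _ _
    constructor
    · exact h.integrable_comp_of_integrable (hi _)
    · have e1 := integral_map (μ := Measure.pi fun _ : Fin n => P) h.measurable.aemeasurable
        (measurable_gaussKernel (ι := Fin (d l)) (2 * ν)).aestronglyMeasurable
      rw [h.map_eq, integral_prod _ (hi _)] at e1
      exact e1.symm.le.trans hB
  unfold estA
  refine ⟨integrable_uAverage fun e => (key e).1, ?_⟩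
  rw [integral_uAverage fun e => (key e).1]
  have hc : Fintype.card (Fin 2) ≤ n := by simpa using hn
  rw [← uAverage_const hc B]
  exact uAverage_mono fun e => (key e).2

/-- A nonasymptotic lower bound for the power: with `g = ‖meanContrast φ P‖²`, the signal-to-noise
ratio `n g / √B` is assumed to be at least `ρ`. The test can only fail on two kinds of events: the
discrepancy estimate is off by at least `g / 2`, or some `estA` is at least `K` times the bound
`b l` on its mean. -/
theorem le_rejectProb_gaussTest {H : Type} [NormedAddCommGroup H] [InnerProductSpace ℝ H]
    [CompleteSpace H] {φ : Joint d → H} {ν : ℝ} (hν : 0 < ν) (hφ : StronglyMeasurable φ)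
    (hφ1 : ∀ x, ‖φ x‖ ≤ 1) (hφG : ∀ x y, inner ℝ (φ x) (φ y) = gaussKernel ν x y)
    (hn : 2 * (k + 1) ≤ n) (hn4 : 4 ≤ n) (P : Measure (Joint d)) [IsProbabilityMeasure P]
    {b : Fin k → ℝ} (hb0 : ∀ l, 0 < b l)
    (hb : ∀ l, ∫ x, ∫ y, gaussKernel (2 * ν) x y ∂(marginal P l) ∂(marginal P l) ≤ b l)
    (hPP : ∫ x, ∫ y, gaussKernel (2 * ν) x y ∂P ∂P ≤ ∏ l, b l)
    (hQQ : ∫ x, ∫ y, gaussKernel (2 * ν) x y ∂(productLaw P) ∂(productLaw P) ≤ ∏ l, b l)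
    (hnB : 1 / (n : ℝ) ^ 2 ≤ ∏ l, b l) {K : ℝ} (hK : 1 ≤ K) {ρ : ℝ} (hρ0 : 0 < ρ)
    (hρ : ρ ≤ n * ‖meanContrast φ P‖ ^ 2 / √(∏ l, b l)) {α : ℝ}
    (hz : upperQuantile α < ρ / (2 * √2 * √((2 + 4 * k + 2 * k ^ 2) * K ^ k))) :
    1 - ENNReal.ofReal (k / K + 4 * (96 * (2 * (k + 1)) ^ 4) * (1 / ρ + 1 / ρ ^ 2)) ≤
      rejectProb (gaussTest d n ν α) P := by
  set B := ∏ l, b l with hB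
  have hB0 : 0 < B := Finset.prod_pos fun l _ => hb0 l
  set g := ‖meanContrast φ P‖ ^ 2 with hg
  set μ : Measure (Fin n → Joint d) := Measure.pi fun _ => P with hμ
  set Ck : ℝ := 2 + 4 * k + 2 * k ^ 2 with hCk
  have hCk1 : 1 ≤ Ck := by
    have : (0 : ℝ) ≤ k := Nat.cast_nonneg k
    rw [hCk]
    nlinarith
  have hn0 : (0 : ℝ) < n := by
    have : 0 < n := by omega
    exact_mod_cast this
  have hsB : 0 < √B := Real.sqrt_pos.2 hB0
  have hg0 : 0 < g := by
    have h1 : 0 < n * g / √B := hρ0.trans_le hρ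
    by_contra hneg
    have : n * g / √B ≤ 0 := div_nonpos_of_nonpos_of_nonneg
      (mul_nonpos_of_nonneg_of_nonpos hn0.le (not_lt.1 hneg)) hsB.le
    linarith
  have hPQ := integral_gaussKernel_mixed_le (by positivity : 0 < 2 * ν) hPP hQQ
  have hQP := integral_gaussKernel_mixed_le (by positivity : 0 < 2 * ν) hQQ hPP
  simp only [← gaussKernel_sq] at hPP hQQ hPQ hQP
  obtain ⟨hvi, hvar⟩ := integral_dHSIC_sub_sq_le hφ hφ1 hφG hn P hPP hQQ hPQ hQP
  -- the two kinds of exceptional events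
  let S : Set (Fin n → Joint d) := {X | (g / 2) ^ 2 ≤ (dHSIC ν X - g) ^ 2}
  let T : Fin k → Set (Fin n → Joint d) := fun l => {X | K * b l ≤ estA ν X l}
  have hS : MeasurableSet S := measurableSet_le measurable_const
    (((measurable_dHSIC ν).sub_const g).pow_const 2)
  have hT : ∀ l, MeasurableSet (T l) := fun l =>
    measurableSet_le measurable_const (measurable_estA ν l)
  have hμS : μ S ≤ ENNReal.ofReal (4 * (96 * (2 * (k + 1)) ^ 4) * (1 / ρ + 1 / ρ ^ 2)) := by
    have h1 := mul_meas_ge_le_integral_of_nonneg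
      (Eventually.of_forall fun X => sq_nonneg (dHSIC ν X - g)) hvi ((g / 2) ^ 2)
    rw [← ofReal_measureReal]
    refine ENNReal.ofReal_le_ofReal ?_
    have h2 : g / n * √B / g ^ 2 ≤ 1 / ρ := by
      rw [div_le_div_iff₀ (by positivity) hρ0]
      have h3 : ρ * √B ≤ n * g := (le_div_iff₀ hsB).1 hρ
      have h4 : g / n * √B * ρ = g / n * (ρ * √B) := by ring
      rw [h4, one_mul]
      refine (mul_le_mul_of_nonneg_left h3 (by positivity)).trans (le_of_eq ?_)
      field_simp
    have h5 : B / n ^ 2 / g ^ 2 ≤ 1 / ρ ^ 2 := by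
      rw [div_div, div_le_div_iff₀ (by positivity) (by positivity)]
      have h3 : ρ * √B ≤ n * g := (le_div_iff₀ hsB).1 hρ
      have h4 := pow_le_pow_left₀ (by positivity) h3 2
      rw [mul_pow, Real.sq_sqrt hB0.le, mul_pow] at h4
      linarith
    have h6 : μ.real S ≤ (96 * (2 * (k + 1)) ^ 4 * (g * √B / n + B / n ^ 2)) / (g / 2) ^ 2 := by
      rw [le_div_iff₀ (by positivity), mul_comm]
      exact h1.trans hvar
    refine h6.trans ?_
    have h7 : (96 * (2 * ((k : ℝ) + 1)) ^ 4 * (g * √B / n + B / n ^ 2)) / (g / 2) ^ 2 =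
        4 * (96 * (2 * (k + 1)) ^ 4) * (g / n * √B / g ^ 2 + B / n ^ 2 / g ^ 2) := by
      field_simp
      ring
    rw [h7]
    gcongr
  have hμT : ∀ l, μ (T l) ≤ ENNReal.ofReal (1 / K) := by
    intro l
    obtain ⟨hi, hle⟩ := integral_estA_le (n := n) (by omega) hν P l (hb l)
    have h1 := mul_meas_ge_le_integral_of_nonneg
      (Eventually.of_forall fun X => estA_nonneg ν X l) hi (K * b l)
    rw [← ofReal_measureReal]
    refine ENNReal.ofReal_le_ofReal ?_
    rw [le_div_iff₀ (by positivity)]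
    have h2 : b l * (μ.real (T l) * K) ≤ b l * 1 := by
      rw [mul_one]
      refine le_trans (le_of_eq ?_) (h1.trans hle)
      ring
    exact le_of_mul_le_mul_left h2 (hb0 l)
  set bad : Set (Fin n → Joint d) := S ∪ ⋃ l, T l with hbad
  have hbadm : MeasurableSet bad := hS.union (MeasurableSet.iUnion hT)
  have hμbad : μ bad ≤ ENNReal.ofReal (k / K + 4 * (96 * (2 * (k + 1)) ^ 4) *
      (1 / ρ + 1 / ρ ^ 2)) := by
    have hU : μ (⋃ l, T l) ≤ ENNReal.ofReal (k / K) := by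
      refine (measure_iUnion_fintype_le μ T).trans ((Finset.sum_le_sum fun l _ =>
        hμT l).trans (le_of_eq ?_))
      rw [Finset.sum_const, Finset.card_univ, Fintype.card_fin, ← ENNReal.ofReal_nsmul]
      congr 1
      rw [nsmul_eq_mul]
      ring
    rw [add_comm (k / K : ℝ), ENNReal.ofReal_add (by positivity) (by positivity)]
    exact (measure_union_le _ _).trans (add_le_add hμS hU)
  have hgood : ∀ X, X ∈ badᶜ → upperQuantile α < testStat ν X := by
    intro X hX
    simp only [hbad, S, T, Set.mem_compl_iff, Set.mem_union, Set.mem_ofPred_eq, Set.mem_iUnion,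
      not_or, not_le, not_exists] at hX
    obtain ⟨hX1, hX2⟩ := hX
    have hdh : g / 2 < dHSIC ν X := by
      have := abs_lt_of_sq_lt_sq hX1 (by positivity)
      linarith [(abs_lt.1 this).1]
    have hA : ∏ l, estA ν X l ≤ K ^ k * B := by
      calc ∏ l, estA ν X l ≤ ∏ l, (K * b l) :=
            Finset.prod_le_prod (fun l _ => estA_nonneg ν X l) fun l _ => (hX2 l).le
        _ = K ^ k * B := by
            rw [Finset.prod_mul_distrib, Finset.prod_const, Finset.card_univ, Fintype.card_fin]
    have hKk : 1 ≤ K ^ k := one_le_pow₀ hK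
    have hV : varianceEst ν X ≤ Ck * K ^ k * B := by
      refine max_le ?_ ?_
      · refine (varianceForm_le (estB_nonneg ν X) (estC_nonneg ν X) (estB_le_estA (by omega) ν X)
          (estC_le_estA hn4 ν X)).trans ?_
        rw [mul_assoc]
        exact mul_le_mul_of_nonneg_left hA (by linarith)
      · refine hnB.trans (le_mul_of_one_le_left hB0.le ?_)
        nlinarith
    have hV0 : 0 < varianceEst ν X := lt_of_lt_of_le (by positivity) (le_max_right _ _)
    refine hz.trans_le ?_
    rw [testStat]
    have hsV : (√(Ck * K ^ k * B))⁻¹ ≤ (√(varianceEst ν X))⁻¹ :=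
      inv_anti₀ (Real.sqrt_pos.2 hV0) (Real.sqrt_le_sqrt hV)
    calc ρ / (2 * √2 * √(Ck * K ^ k))
        ≤ (n * g / √B) / (2 * √2 * √(Ck * K ^ k)) := by gcongr
      _ = n / √2 * (√(Ck * K ^ k * B))⁻¹ * (g / 2) := by
          rw [Real.sqrt_mul (show 0 ≤ Ck * K ^ k by positivity) B]
          field_simp
      _ ≤ n / √2 * (√(varianceEst ν X))⁻¹ * dHSIC ν X := by
          gcongr
  calc 1 - ENNReal.ofReal (k / K + 4 * (96 * (2 * (k + 1)) ^ 4) * (1 / ρ + 1 / ρ ^ 2))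
      ≤ 1 - μ bad := tsub_le_tsub_left hμbad _
    _ = μ badᶜ := by rw [prob_compl_eq_one_sub hbadm]
    _ = ∫⁻ X, badᶜ.indicator (fun _ => 1) X ∂μ := by
        rw [lintegral_indicator hbadm.compl, setLIntegral_one]
    _ ≤ rejectProb (gaussTest d n ν α) P := by
        refine lintegral_mono fun X => ?_
        refine Set.indicator_le_indicator_of_subset (fun Y hY => hgood Y hY) (fun _ => bot_le) X

end Statistic

/-! ### Consistency of the test -/

section Consistency

/-- The rates of bandwidth and separation: `ν ^ s Δ²` and the signal-to-noise ratio
`n (π / (2 ν)) ^ (D / 4) Δ²` diverge, and so does `n (π / (2 ν)) ^ (D / 4)`. -/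
theorem tendsto_signal {s D : ℝ} (hs : 0 < s) (hD : 0 ≤ D) {Δ ν : ℕ → ℝ}
    (hΔ : Tendsto (fun n : ℕ => (n : ℝ) ^ (2 * s / (D + 4 * s)) * Δ n) atTop atTop)
    (hν0 : ∀ n, 0 < ν n)
    (hν : ν =Θ[atTop] fun n : ℕ => (n : ℝ) ^ (4 / (D + 4 * s))) :
    Tendsto (fun n => ν n ^ s * Δ n ^ 2) atTop atTop ∧
    Tendsto (fun n : ℕ => n * (Real.pi / (2 * ν n)) ^ (D / 4) * Δ n ^ 2) atTop atTop ∧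
    Tendsto (fun n : ℕ => n * (Real.pi / (2 * ν n)) ^ (D / 4)) atTop atTop := by
  set θ := D + 4 * s with hθ
  have hθ0 : 0 < θ := by positivity
  obtain ⟨c₂, hc₂, h₂⟩ := hν.1.exists_pos
  obtain ⟨c₁, hc₁, h₁⟩ := hν.2.exists_pos
  have hsq : Tendsto (fun n : ℕ => ((n : ℝ) ^ (2 * s / θ) * Δ n) ^ 2) atTop atTop :=
    (tendsto_pow_atTop two_ne_zero).comp hΔ
  have hn1 : Tendsto (fun n : ℕ => ((n : ℝ) ^ (4 * s / θ))) atTop atTop :=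
    (tendsto_rpow_atTop (by positivity)).comp tendsto_natCast_atTop_atTop
  have e1 : ∀ n : ℕ, ((n : ℝ) ^ (2 * s / θ) * Δ n) ^ 2 = (n : ℝ) ^ (4 * s / θ) * Δ n ^ 2 := by
    intro n
    rw [mul_pow, ← Real.rpow_natCast, ← Real.rpow_mul (Nat.cast_nonneg n)]
    congr 2
    push_cast
    ring
  simp only [e1] at hsq
  have hlow : ∀ᶠ n : ℕ in atTop, c₁⁻¹ ^ s * (n : ℝ) ^ (4 * s / θ) ≤ ν n ^ s := by
    filter_upwards [h₁.bound] with n hn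
    rw [Real.norm_of_nonneg (by positivity), Real.norm_of_nonneg (hν0 n).le] at hn
    have h3 : c₁⁻¹ * (n : ℝ) ^ (4 / θ) ≤ ν n := by
      rw [inv_mul_le_iff₀ hc₁]
      exact hn
    have h4 := Real.rpow_le_rpow (by positivity) h3 hs.le
    rwa [Real.mul_rpow (by positivity) (by positivity), ← Real.rpow_mul (Nat.cast_nonneg n),
      div_mul_eq_mul_div] at h4
  have hup : ∀ᶠ n : ℕ in atTop, (Real.pi / (2 * c₂)) ^ (D / 4) * (n : ℝ) ^ (4 * s / θ) ≤
      n * (Real.pi / (2 * ν n)) ^ (D / 4) := by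
    filter_upwards [h₂.bound, eventually_gt_atTop 0] with n hn hpos
    rw [Real.norm_of_nonneg (hν0 n).le, Real.norm_of_nonneg (by positivity)] at hn
    have hn0 : (0 : ℝ) < n := by exact_mod_cast hpos
    have h3 : Real.pi / (2 * c₂) * (n : ℝ) ^ (-(4 / θ)) ≤ Real.pi / (2 * ν n) := by
      rw [Real.rpow_neg hn0.le, ← div_eq_mul_inv, div_div]
      have := hν0 n
      refine div_le_div_of_nonneg_left Real.pi_pos.le (by positivity) ?_
      linarith
    have h4 := Real.rpow_le_rpow (by positivity) h3 (by positivity : 0 ≤ D / 4)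
    rw [Real.mul_rpow (by positivity) (by positivity), ← Real.rpow_mul hn0.le] at h4
    have h5 := mul_le_mul_of_nonneg_left h4 hn0.le
    refine le_trans (le_of_eq ?_) h5
    have h6 : (n : ℝ) ^ (4 * s / θ) = n * (n : ℝ) ^ (-(4 / θ) * (D / 4)) := by
      nth_rewrite 2 [← Real.rpow_one (n : ℝ)]
      rw [← Real.rpow_add hn0]
      congr 1
      field_simp
      rw [hθ]
      ring
    rw [h6]
    ring
  have hC : 0 < (Real.pi / (2 * c₂)) ^ (D / 4) := by positivity
  have hC' : 0 < c₁⁻¹ ^ s := by positivity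
  refine ⟨tendsto_atTop_mono' _ ?_ (hsq.const_mul_atTop hC'),
    tendsto_atTop_mono' _ ?_ (hsq.const_mul_atTop hC), tendsto_atTop_mono' _ hup
      (hn1.const_mul_atTop hC)⟩
  · filter_upwards [hlow] with n hn
    rw [← mul_assoc]
    gcongr
  · filter_upwards [hup] with n hn
    rw [← mul_assoc]
    gcongr

variable {k : ℕ} {d : Fin k → ℕ}

theorem tendsto_power_gaussTest {s : ℝ} (hs : 0 < s) {M : Fin k → ℝ} (hM : ∀ j, 0 < M j)
    {Δ : ℕ → ℝ}
    (hΔ : Tendsto (fun n : ℕ => (n : ℝ) ^ (2 * s / ((∑ j, (d j : ℝ)) + 4 * s)) * Δ n) atTop atTop)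
    {ν : ℕ → ℝ} (hν0 : ∀ n, 0 < ν n)
    (hν : ν =Θ[atTop] fun n : ℕ => (n : ℝ) ^ (4 / ((∑ j, (d j : ℝ)) + 4 * s))) (α : ℝ) :
    Tendsto (fun n : ℕ => power (gaussTest d n (ν n) α) (altHyp d s M (Δ n))) atTop (𝓝 1) := by
  have hD : 0 ≤ ∑ j, (d j : ℝ) := Finset.sum_nonneg fun j _ => Nat.cast_nonneg _
  obtain ⟨ht1, ht2, ht3⟩ := tendsto_signal hs hD hΔ hν0 hν
  set D := ∑ j, (d j : ℝ) with hDdef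
  set N := ∏ j, M j with hN
  have hN0 : 0 < N := Finset.prod_pos fun j _ => hM j
  -- it suffices that the power is eventually at least `1 - ε`
  suffices key : ∀ ε : ℝ, 0 < ε → ∀ᶠ n : ℕ in atTop, ∀ P ∈ altHyp d s M (Δ n),
      1 - ENNReal.ofReal ε ≤ rejectProb (gaussTest d n (ν n) α) P by
    refine tendsto_order.2 ⟨fun a ha => ?_, fun a ha => Eventually.of_forall fun n =>
      (min_le_left _ _).trans_lt ha⟩
    obtain ⟨r, hr1, hr2⟩ := exists_between ha
    have hr : r ≠ ⊤ := (hr2.trans ENNReal.one_lt_top).ne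
    have hr1' : r.toReal < 1 := by
      rw [← ENNReal.toReal_one]
      exact (ENNReal.toReal_lt_toReal hr ENNReal.one_ne_top).2 hr2
    filter_upwards [key (1 - r.toReal) (by linarith)] with n hn
    refine hr1.trans_le (le_min hr2.le (le_iInf₂ fun P hP => le_trans (le_of_eq ?_) (hn P hP)))
    rw [ENNReal.ofReal_sub _ ENNReal.toReal_nonneg, ENNReal.ofReal_one, ENNReal.ofReal_toReal hr,
      ENNReal.sub_sub_cancel ENNReal.one_ne_top hr2.le]
  intro ε hε
  set A : ℝ := 96 * (2 * (k + 1)) ^ 4 with hA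
  have hA0 : 0 < A := by positivity
  obtain ⟨K, hK1, hKε⟩ : ∃ K : ℝ, 1 ≤ K ∧ k / K ≤ ε / 2 := by
    refine ⟨1 + 2 * k / ε, by have : 0 ≤ 2 * k / ε := by positivity
                              linarith, ?_⟩
    rw [div_le_iff₀ (by positivity)]
    field_simp
    linarith
  set Q : ℝ := 2 * √2 * √((2 + 4 * k + 2 * k ^ 2) * K ^ k) with hQ
  have hQ0 : 0 < Q := by positivity
  -- the signal-to-noise ratio required
  obtain ⟨ρ, hρ1, hρA, hρQ⟩ : ∃ ρ : ℝ, 1 ≤ ρ ∧ 8 * A / (ε / 2) ≤ ρ ∧ upperQuantile α < ρ / Q := by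
    refine ⟨max 1 (max (8 * A / (ε / 2)) ((upperQuantile α + 1) * Q)), le_max_left _ _,
      (le_max_left _ _).trans (le_max_right _ _), ?_⟩
    rw [lt_div_iff₀ hQ0]
    refine lt_of_lt_of_le ?_ ((le_max_right _ _).trans (le_max_right _ _))
    nlinarith
  have hρ0 : 0 < ρ := by linarith
  have hbudget : k / K + 4 * A * (1 / ρ + 1 / ρ ^ 2) ≤ ε := by
    have e6 : 1 / ρ ^ 2 ≤ 1 / ρ :=
      one_div_le_one_div_of_le hρ0 (le_self_pow₀ hρ1 two_ne_zero)
    have e7 : 8 * A * (1 / ρ) ≤ ε / 2 := by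
      rw [div_le_iff₀ (by positivity)] at hρA
      rw [mul_one_div, div_le_iff₀ hρ0]
      linarith
    have e8 := mul_le_mul_of_nonneg_left e6 (by positivity : 0 ≤ 4 * A)
    linarith
  have hΔpos : ∀ᶠ n : ℕ in atTop, 0 < Δ n := by
    filter_upwards [hΔ.eventually_gt_atTop 0] with n hn
    exact pos_of_mul_pos_right hn (by positivity)
  filter_upwards [ht1.eventually_ge_atTop (8 * N ^ 2),
    ht2.eventually_ge_atTop (ρ * (2 * N * Real.exp (1 / 4))), ht3.eventually_ge_atTop N⁻¹,
    hΔpos, eventually_ge_atTop 4, eventually_ge_atTop (2 * (k + 1))] with n h1 h2 h3 h4 hn4 hnk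
    P hP
  have hνn := hν0 n
  obtain ⟨φ, hφ, hφ1, hφG⟩ := exists_featureMap (ι := (j : Fin k) × Fin (d j)) hνn
  obtain ⟨hprob, -, -, -, hsig⟩ := altHyp_bounds
    (H := Lp ℝ 2 (volume : Measure (Joint d))) hs hM h4.le hP hνn
  obtain ⟨-, hPP, hQQ, hmarg, -⟩ := altHyp_bounds
    (H := Lp ℝ 2 (volume : Measure (Joint d))) hs hM h4.le hP (by positivity : 0 < 2 * ν n)
  have hg := hsig φ hφ hφ1 hφG
  set y := Real.pi / (2 * ν n) with hy
  have hy0 : 0 < y := by positivity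
  have hn0 : (0 : ℝ) < n := by
    have : 0 < n := by omega
    exact_mod_cast this
  set b : Fin k → ℝ := fun j => y ^ ((d j : ℝ) / 2) * M j ^ 2 with hb
  have hprod : ∏ j, b j = (y ^ (D / 4) * N) ^ 2 := by
    rw [hb, Finset.prod_mul_distrib, Finset.prod_pow, ← Real.rpow_sum_of_pos hy0, mul_pow,
      ← Real.rpow_natCast (y ^ (D / 4)), ← Real.rpow_mul hy0.le, ← Finset.sum_div]
    congr 2
    push_cast
    ring
  have hprod' : ∏ j, b j = y ^ (D / 2) * N ^ 2 := by
    rw [hprod, mul_pow, ← Real.rpow_natCast (y ^ (D / 4)), ← Real.rpow_mul hy0.le]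
    congr 2
    push_cast
    ring
  have hyD : 0 < y ^ (D / 4) := by positivity
  have hsqrt : √(∏ j, b j) = y ^ (D / 4) * N := by
    rw [hprod, Real.sqrt_sq (by positivity)]
  have hnB : 1 / (n : ℝ) ^ 2 ≤ ∏ j, b j := by
    rw [hprod, div_le_iff₀ (by positivity), ← mul_pow]
    have : 1 ≤ y ^ (D / 4) * N * n := by
      have := mul_le_mul_of_nonneg_right h3 hN0.le
      rw [inv_mul_cancel₀ hN0.ne'] at this
      linarith
    exact one_le_pow₀ this
  -- the signal dominates the bias
  have hbias : ν n ^ (-s) * (4 * N ^ 2) ≤ Δ n ^ 2 / 2 := by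
    rw [Real.rpow_neg hνn.le, inv_mul_le_iff₀ (by positivity)]
    linarith
  set G := ‖meanContrast φ P‖ ^ 2 with hG
  have hG' : Δ n ^ 2 * y ^ (D / 2) ≤ 2 * Real.exp (1 / 4) * G := by
    have e1 : Δ n ^ 2 / 2 ≤ Real.exp (1 / 4) * ((Real.pi / ν n) ^ (-(D / 2)) * G) := by linarith
    have e2 : y ^ (D / 2) ≤ (Real.pi / ν n) ^ (D / 2) := by
      refine Real.rpow_le_rpow hy0.le ?_ (by positivity)
      rw [hy]
      have := Real.pi_pos
      gcongr
      linarith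
    have hpi : 0 < (Real.pi / ν n) ^ (D / 2) := by positivity
    rw [Real.rpow_neg (by positivity)] at e1
    calc Δ n ^ 2 * y ^ (D / 2) ≤ Δ n ^ 2 * (Real.pi / ν n) ^ (D / 2) := by gcongr
      _ = 2 * (Δ n ^ 2 / 2) * (Real.pi / ν n) ^ (D / 2) := by ring
      _ ≤ 2 * (Real.exp (1 / 4) * (((Real.pi / ν n) ^ (D / 2))⁻¹ * G)) *
          (Real.pi / ν n) ^ (D / 2) := by gcongr
      _ = 2 * Real.exp (1 / 4) * G := by field_simp
  have hρ : ρ ≤ n * G / √(∏ j, b j) := by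
    rw [hsqrt, le_div_iff₀ (by positivity)]
    have e3 : y ^ (D / 2) = y ^ (D / 4) * y ^ (D / 4) := by
      rw [← Real.rpow_add hy0]
      congr 1
      ring
    rw [e3] at hG'
    have e4 : ρ * (2 * N * Real.exp (1 / 4)) * y ^ (D / 4) ≤ n * (2 * Real.exp (1 / 4) * G) := by
      calc ρ * (2 * N * Real.exp (1 / 4)) * y ^ (D / 4)
          ≤ (n * y ^ (D / 4) * Δ n ^ 2) * y ^ (D / 4) := by gcongr
        _ = n * (Δ n ^ 2 * (y ^ (D / 4) * y ^ (D / 4))) := by ring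
        _ ≤ n * (2 * Real.exp (1 / 4) * G) := by gcongr
    have e5 : 0 < 2 * Real.exp (1 / 4) := by positivity
    refine le_of_mul_le_mul_left ?_ e5
    linarith
  have hfin := le_rejectProb_gaussTest hνn hφ hφ1 hφG hnk hn4 P (b := b)
    (fun l => mul_pos (by positivity) (pow_pos (hM l) 2)) hmarg
    (hPP.trans hprod'.ge) (hQQ.trans hprod'.ge) hnB hK1 hρ0 hρ hρQ
  refine le_trans (tsub_le_tsub_left (ENNReal.ofReal_le_ofReal ?_) _) hfin
  exact hbudget

end Consistency

/-! ### Random signs -/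

section Signs

/-- A sign `±1`, encoded by a Boolean. -/
def sgn (c : Bool) : ℝ := if c then 1 else -1

theorem sgn_sq (c : Bool) : sgn c * sgn c = 1 := by cases c <;> simp [sgn]

theorem abs_sgn (c : Bool) : |sgn c| = 1 := by cases c <;> simp [sgn]

variable {G : Type} [Fintype G] [DecidableEq G]

theorem sum_prod_bool (g : G → Bool → ℝ) :
    ∑ ε : G → Bool, ∏ m, g m (ε m) = ∏ m, (g m true + g m false) := by
  have h := Finset.prod_univ_sum (fun _ : G => (Finset.univ : Finset Bool)) g
  simp only [Fintype.piFinset_univ, Fintype.sum_bool] at h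
  exact h.symm

theorem sum_sgn_mul_sgn (m m' : G) :
    ∑ ε : G → Bool, sgn (ε m) * sgn (ε m') = if m = m' then 2 ^ Fintype.card G else 0 := by
  split_ifs with h
  · subst h
    simp [sgn_sq]
  · have := sum_prod_bool fun i c => (if i = m then sgn c else 1) * (if i = m' then sgn c else 1)
    simp only [Finset.prod_mul_distrib, Finset.prod_ite_eq', Finset.mem_univ, if_true] at this
    rw [this]
    refine Finset.prod_eq_zero (Finset.mem_univ m) ?_
    simp [h, sgn]

/-- The mean square of a random signed sum is the sum of the squares. -/
theorem sum_norm_sum_sgn_smul_sq {V : Type*} [NormedAddCommGroup V] [InnerProductSpace ℝ V]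
    (z : G → V) :
    ∑ ε : G → Bool, ‖∑ m, sgn (ε m) • z m‖ ^ 2 = 2 ^ Fintype.card G * ∑ m, ‖z m‖ ^ 2 := by
  have h : ∀ ε : G → Bool, ‖∑ m, sgn (ε m) • z m‖ ^ 2 =
      ∑ m, ∑ m', (sgn (ε m) * sgn (ε m')) * inner ℝ (z m) (z m') := by
    intro ε
    rw [← real_inner_self_eq_norm_sq, sum_inner]
    refine Finset.sum_congr rfl fun m _ => ?_
    rw [inner_sum]
    refine Finset.sum_congr rfl fun m' _ => ?_
    rw [real_inner_smul_left, real_inner_smul_right, mul_assoc]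
  simp only [h]
  rw [Finset.sum_comm, Finset.mul_sum]
  refine Finset.sum_congr rfl fun m _ => ?_
  rw [Finset.sum_comm]
  simp only [← Finset.sum_mul, sum_sgn_mul_sgn, ite_mul, zero_mul, Finset.sum_ite_eq,
    Finset.mem_univ, if_true, real_inner_self_eq_norm_sq]

/-- The moment generating function of `∑ m, c m * ε m * ε' m`, for independent random signs, is
sub-Gaussian. -/
theorem sum_exp_sum_sgn_le (c : G → ℝ) :
    ∑ ε : G → Bool, ∑ ε' : G → Bool, Real.exp (∑ m, c m * (sgn (ε m) * sgn (ε' m))) ≤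
      (2 ^ Fintype.card G) ^ 2 * Real.exp (∑ m, c m ^ 2 / 2) := by
  have h : ∀ ε : G → Bool, ∑ ε' : G → Bool, Real.exp (∑ m, c m * (sgn (ε m) * sgn (ε' m))) ≤
      2 ^ Fintype.card G * Real.exp (∑ m, c m ^ 2 / 2) := by
    intro ε
    simp only [Real.exp_sum]
    rw [sum_prod_bool fun m b => Real.exp (c m * (sgn (ε m) * sgn b)), ← Finset.card_univ,
      ← Finset.prod_const, ← Finset.prod_mul_distrib]
    refine Finset.prod_le_prod (fun m _ => by positivity) fun m _ => ?_
    have h1 := Real.cosh_le_exp_half_sq (c m)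
    rw [Real.cosh_eq] at h1
    cases ε m <;> simp [sgn] <;> linarith
  refine (Finset.sum_le_sum fun ε _ => h ε).trans (le_of_eq ?_)
  simp
  ring

end Signs

/-! ### Mixtures of perturbations of a law -/

section Mixture

theorem sum_mul_sum_of_disjoint {G E : Type} [Fintype G] {h : G → E → ℝ}
    (hdis : ∀ m m' x, m ≠ m' → h m x * h m' x = 0)
    (c c' : G → ℝ) (x : E) :
    (∑ m, c m * h m x) * ∑ m, c' m * h m x = ∑ m, c m * c' m * h m x ^ 2 := by
  rw [Finset.sum_mul_sum]
  refine Finset.sum_congr rfl fun m _ => ?_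
  rw [Finset.sum_eq_single m]
  · ring
  · intro m' _ hm'
    have := hdis m m' x hm'.symm
    linear_combination c m * c' m' * this
  · simp

theorem abs_sum_sgn_mul_le {G E : Type} [Fintype G] {h : G → E → ℝ}
    (hdis : ∀ m m' x, m ≠ m' → h m x * h m' x = 0)
    {C : ℝ} (hC : 0 ≤ C) (x : E) (hx : ∀ m, |h m x| ≤ C) (ε : G → Bool) :
    |∑ m, sgn (ε m) * h m x| ≤ C := by
  by_cases h0 : ∀ m, h m x = 0
  · simpa [h0] using hC
  · push Not at h0
    obtain ⟨m, hm⟩ := h0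
    rw [Finset.sum_eq_single m, abs_mul, abs_sgn, one_mul]
    · exact hx m
    · intro m' _ hm'
      have := hdis m' m x hm'
      rw [(mul_eq_zero.1 this).resolve_right hm, mul_zero]
    · simp

variable {E : Type} [MeasurableSpace E]

theorem pi_withDensity {n : ℕ} (P : Measure E) [IsProbabilityMeasure P] {L : E → ℝ≥0∞}
    (hL : Measurable L) [IsProbabilityMeasure (P.withDensity L)] :
    Measure.pi (fun _ : Fin n => P.withDensity L) =
      (Measure.pi fun _ : Fin n => P).withDensity fun x => ∏ i, L (x i) := by
  refine Measure.pi_eq fun t ht => ?_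
  rw [withDensity_apply _ (MeasurableSet.univ_pi ht),
    ← lintegral_indicator (MeasurableSet.univ_pi ht)]
  have h : ∀ x : Fin n → E, (Set.univ.pi t).indicator (fun x => ∏ i, L (x i)) x =
      ∏ i, (t i).indicator L (x i) := by
    intro x
    by_cases hx : x ∈ Set.univ.pi t
    · rw [Set.indicator_of_mem hx]
      exact Finset.prod_congr rfl fun i _ => (Set.indicator_of_mem (hx i (Set.mem_univ i)) _).symm
    · rw [Set.indicator_of_notMem hx]
      simp only [Set.mem_univ_pi, not_forall] at hx
      obtain ⟨i, hi⟩ := hx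
      exact (Finset.prod_eq_zero (Finset.mem_univ i) (Set.indicator_of_notMem hi _)).symm
  simp only [h]
  rw [lintegral_fin_prod_eq_prod (fun _ : Fin n => P) (fun i => (t i).indicator L)
    fun i => (hL.indicator (ht i)).aemeasurable]
  refine Finset.prod_congr rfl fun i _ => ?_
  rw [lintegral_indicator (ht i), withDensity_apply _ (ht i)]

theorem rejectProb_withDensity {n : ℕ} {φ : (Fin n → E) → ℝ≥0∞} (hφ : IsTest φ) (P : Measure E)
    [IsProbabilityMeasure P] {L : E → ℝ} (hL : Measurable L) (hL0 : ∀ x, 0 ≤ L x) {C : ℝ}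
    (hC : ∀ x, L x ≤ C) (hL1 : ∫ x, L x ∂P = 1) :
    rejectProb φ (P.withDensity fun x => ENNReal.ofReal (L x)) =
      ENNReal.ofReal (∫ x, (φ x).toReal * ∏ i, L (x i) ∂(Measure.pi fun _ : Fin n => P)) := by
  have hLi : Integrable L P := Integrable.of_bound hL.aestronglyMeasurable C
    (Eventually.of_forall fun x => by rw [Real.norm_of_nonneg (hL0 x)]; exact hC x)
  have : IsProbabilityMeasure (P.withDensity fun x => ENNReal.ofReal (L x)) := by
    refine ⟨?_⟩
    rw [withDensity_apply _ MeasurableSet.univ, Measure.restrict_univ,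
      ← ofReal_integral_eq_lintegral_ofReal hLi (Eventually.of_forall hL0), hL1,
      ENNReal.ofReal_one]
  have hprod : Measurable fun x : Fin n → E => ∏ i, L (x i) :=
    Finset.measurable_fun_prod _ fun i _ => hL.comp (measurable_pi_apply i)
  have hprodE : Measurable fun x : Fin n → E => ∏ i, ENNReal.ofReal (L (x i)) :=
    Finset.measurable_fun_prod _ fun i _ => (hL.comp (measurable_pi_apply i)).ennreal_ofReal
  have hp0 : ∀ x : Fin n → E, 0 ≤ ∏ i, L (x i) := fun x => Finset.prod_nonneg fun i _ => hL0 _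
  have hpC : ∀ x : Fin n → E, ∏ i, L (x i) ≤ C ^ n := fun x => by
    refine (Finset.prod_le_prod (fun i _ => hL0 (x i)) fun i _ => hC (x i)).trans (le_of_eq ?_)
    simp
  have hφ1 : ∀ x, (φ x).toReal ≤ 1 := fun x => ENNReal.toReal_le_of_le_ofReal zero_le_one
    (by rw [ENNReal.ofReal_one]; exact hφ.2 x)
  rw [rejectProb, pi_withDensity P hL.ennreal_ofReal,
    lintegral_withDensity_eq_lintegral_mul _ hprodE hφ.1, ofReal_integral_eq_lintegral_ofReal]
  · refine lintegral_congr fun x => ?_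
    rw [Pi.mul_apply, ENNReal.ofReal_mul ENNReal.toReal_nonneg,
      ENNReal.ofReal_toReal ((hφ.2 x).trans_lt ENNReal.one_lt_top).ne,
      ENNReal.ofReal_prod_of_nonneg fun i _ => hL0 _, mul_comm]
  · refine Integrable.of_bound (hφ.1.ennreal_toReal.mul hprod).aestronglyMeasurable (C ^ n)
      (Eventually.of_forall fun x => ?_)
    rw [Real.norm_of_nonneg (mul_nonneg ENNReal.toReal_nonneg (hp0 x))]
    exact (mul_le_of_le_one_left (hp0 x) (hφ1 x)).trans (hpC x)
  · exact Eventually.of_forall fun x => mul_nonneg ENNReal.toReal_nonneg (hp0 x)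

variable {G : Type} [Fintype G] [DecidableEq G]

/-- Le Cam's method for a mixture: averaged over all signs, the probability of rejection under the
perturbed laws `(1 + ∑ m, ε m * h m) P` is controlled by that under `P`, through the second
moment of the mixed likelihood ratio. -/
theorem sum_rejectProb_le (P : Measure E) [IsProbabilityMeasure P] {h : G → E → ℝ}
    (hm : ∀ m, Measurable (h m)) (h1 : ∀ m x, |h m x| ≤ 1)
    (hdis : ∀ m m' x, m ≠ m' → h m x * h m' x = 0) (h0 : ∀ m, ∫ x, h m x ∂P = 0)
    {n : ℕ} {φ : (Fin n → E) → ℝ≥0∞} (hφ : IsTest φ) :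
    ∑ ε : G → Bool,
      rejectProb φ (P.withDensity fun x => ENNReal.ofReal (1 + ∑ m, sgn (ε m) * h m x)) ≤
    2 ^ Fintype.card G * ENNReal.ofReal
      √((rejectProb φ P).toReal * Real.exp (∑ m, (n * ∫ x, h m x ^ 2 ∂P) ^ 2 / 2)) := by
  set μ : Measure (Fin n → E) := Measure.pi fun _ => P with hμ
  set L : (G → Bool) → E → ℝ := fun ε x => 1 + ∑ m, sgn (ε m) * h m x with hL
  have hLm : ∀ ε, Measurable (L ε) := fun ε =>
    (Finset.measurable_fun_sum _ fun m _ => (hm m).const_mul _).const_add 1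
  have habs : ∀ (ε : G → Bool) (x : E), |∑ m, sgn (ε m) * h m x| ≤ 1 := fun ε x =>
    abs_sum_sgn_mul_le hdis zero_le_one x (fun m => h1 m x) ε
  have hL0 : ∀ ε x, 0 ≤ L ε x := fun ε x => by linarith [(abs_le.1 (habs ε x)).1]
  have hL2 : ∀ ε x, L ε x ≤ 2 := fun ε x => by linarith [(abs_le.1 (habs ε x)).2]
  have hhi : ∀ m, Integrable (h m) P := fun m =>
    Integrable.of_bound (hm m).aestronglyMeasurable 1 (Eventually.of_forall fun x => h1 m x)
  have hhi2 : ∀ m, Integrable (fun x => h m x ^ 2) P := fun m =>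
    Integrable.of_bound ((hm m).pow_const 2).aestronglyMeasurable 1
      (Eventually.of_forall fun x => by
        rw [norm_pow]; exact pow_le_one₀ (norm_nonneg _) (h1 m x))
  have hsi : ∀ ε : G → Bool, Integrable (fun x => ∑ m, sgn (ε m) * h m x) P := fun ε =>
    integrable_finsetSum _ fun m _ => (hhi m).const_mul _
  have hs0 : ∀ ε : G → Bool, ∫ x, ∑ m, sgn (ε m) * h m x ∂P = 0 := fun ε => by
    rw [integral_finsetSum _ fun m _ => (hhi m).const_mul _]
    simp [integral_const_mul, h0]
  have hL1 : ∀ ε, ∫ x, L ε x ∂P = 1 := fun ε => by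
    rw [hL, integral_add (integrable_const _) (hsi ε), hs0]
    simp
  set a : G → ℝ := fun m => ∫ x, h m x ^ 2 ∂P with ha
  have hLL : ∀ ε ε', ∫ x, L ε x * L ε' x ∂P = 1 + ∑ m, a m * (sgn (ε m) * sgn (ε' m)) := by
    intro ε ε'
    have e1 : ∀ x, L ε x * L ε' x = 1 + ((∑ m, sgn (ε m) * h m x + ∑ m, sgn (ε' m) * h m x) +
        ∑ m, sgn (ε m) * sgn (ε' m) * h m x ^ 2) := fun x => by
      rw [← sum_mul_sum_of_disjoint hdis]
      simp only [hL]
      ring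
    have i1 : Integrable (fun x => ∑ m, sgn (ε m) * sgn (ε' m) * h m x ^ 2) P :=
      integrable_finsetSum _ fun m _ => (hhi2 m).const_mul _
    have i2 : Integrable (fun x => ∑ m, sgn (ε m) * h m x + ∑ m, sgn (ε' m) * h m x) P :=
      (hsi ε).add (hsi ε')
    have i3 : Integrable (fun x => (∑ m, sgn (ε m) * h m x + ∑ m, sgn (ε' m) * h m x) +
        ∑ m, sgn (ε m) * sgn (ε' m) * h m x ^ 2) P := i2.add i1
    simp only [e1]
    rw [integral_add (integrable_const _) i3, integral_add i2 i1, integral_add (hsi ε) (hsi ε'), hs0, hs0,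
      integral_finsetSum _ fun m _ => (hhi2 m).const_mul _]
    simp only [integral_const_mul, integral_const, probReal_univ, one_smul, add_zero, zero_add, ha]
    congr 1
    exact Finset.sum_congr rfl fun m _ => mul_comm _ _
  -- the second moment of the mixed likelihood ratio
  set Z : (G → Bool) → (Fin n → E) → ℝ := fun ε x => ∏ i, L ε (x i) with hZ
  have hZm : ∀ ε, Measurable (Z ε) := fun ε =>
    Finset.measurable_fun_prod _ fun i _ => (hLm ε).comp (measurable_pi_apply i)
  have hZ0 : ∀ ε x, 0 ≤ Z ε x := fun ε x => Finset.prod_nonneg fun i _ => hL0 ε _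
  have hZb : ∀ ε x, Z ε x ≤ 2 ^ n := fun ε x => by
    refine (Finset.prod_le_prod (fun i _ => hL0 ε (x i)) fun i _ => hL2 ε (x i)).trans
      (le_of_eq ?_)
    simp
  have hφ1 : ∀ x, (φ x).toReal ≤ 1 := fun x => ENNReal.toReal_le_of_le_ofReal zero_le_one
    (by rw [ENNReal.ofReal_one]; exact hφ.2 x)
  have hφm : Measurable fun x => (φ x).toReal := hφ.1.ennreal_toReal
  have hφZi : ∀ ε, Integrable (fun x => (φ x).toReal * Z ε x) μ := fun ε => by
    refine Integrable.of_bound (hφm.mul (hZm ε)).aestronglyMeasurable (2 ^ n)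
      (Eventually.of_forall fun x => ?_)
    rw [Real.norm_of_nonneg (mul_nonneg ENNReal.toReal_nonneg (hZ0 ε x))]
    exact (mul_le_of_le_one_left (hZ0 ε x) (hφ1 x)).trans (hZb ε x)
  have hZZi : ∀ ε ε', Integrable (fun x => Z ε x * Z ε' x) μ := fun ε ε' => by
    refine Integrable.of_bound ((hZm ε).mul (hZm ε')).aestronglyMeasurable (2 ^ n * 2 ^ n)
      (Eventually.of_forall fun x => ?_)
    rw [Real.norm_of_nonneg (mul_nonneg (hZ0 ε x) (hZ0 ε' x))]
    exact mul_le_mul (hZb ε x) (hZb ε' x) (hZ0 ε' x) (by positivity)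
  have hZZ : ∀ ε ε', ∫ x, Z ε x * Z ε' x ∂μ ≤
      Real.exp (∑ m, (n * a m) * (sgn (ε m) * sgn (ε' m))) := by
    intro ε ε'
    simp only [hZ, ← Finset.prod_mul_distrib]
    rw [hμ, integral_fintype_prod_eq_prod (fun _ : Fin n => fun y => L ε y * L ε' y)]
    simp only [hLL, Finset.prod_const, Finset.card_univ, Fintype.card_fin]
    set t := ∑ m, a m * (sgn (ε m) * sgn (ε' m)) with ht
    have h1t : 0 ≤ 1 + t := by
      rw [← hLL]
      exact integral_nonneg fun x => mul_nonneg (hL0 ε x) (hL0 ε' x)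
    calc (1 + t) ^ n ≤ Real.exp t ^ n :=
          pow_le_pow_left₀ h1t (by linarith [Real.add_one_le_exp t]) n
      _ = Real.exp (∑ m, (n * a m) * (sgn (ε m) * sgn (ε' m))) := by
          rw [← Real.exp_nat_mul, ht, Finset.mul_sum]
          simp only [mul_assoc]
  set V : (Fin n → E) → ℝ := fun x => ∑ ε, Z ε x with hV
  have hVV : ∀ x, V x ^ 2 = ∑ ε, ∑ ε', Z ε x * Z ε' x := fun x => by
    rw [sq, hV, Finset.sum_mul_sum]
  have hV2i : Integrable (fun x => V x ^ 2) μ := by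
    simp only [hVV]
    exact integrable_finsetSum _ fun ε _ => integrable_finsetSum _ fun ε' _ => hZZi ε ε'
  have hV2 : ∫ x, V x ^ 2 ∂μ ≤ (2 ^ Fintype.card G) ^ 2 * Real.exp (∑ m, (n * a m) ^ 2 / 2) := by
    simp only [hVV]
    rw [integral_finsetSum _ fun ε _ => integrable_finsetSum _ fun ε' _ => hZZi ε ε']
    refine le_trans (Finset.sum_le_sum fun ε _ => ?_) (sum_exp_sum_sgn_le fun m => n * a m)
    rw [integral_finsetSum _ fun ε' _ => hZZi ε ε']
    exact Finset.sum_le_sum fun ε' _ => hZZ ε ε'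
  have hφi : Integrable (fun x => (φ x).toReal) μ :=
    Integrable.of_bound hφm.aestronglyMeasurable 1 (Eventually.of_forall fun x => by
      rw [Real.norm_of_nonneg ENNReal.toReal_nonneg]; exact hφ1 x)
  have hφ2i : Integrable (fun x => (φ x).toReal ^ 2) μ :=
    Integrable.of_bound (hφm.pow_const 2).aestronglyMeasurable 1 (Eventually.of_forall fun x => by
      rw [norm_pow, Real.norm_of_nonneg ENNReal.toReal_nonneg]
      exact pow_le_one₀ ENNReal.toReal_nonneg (hφ1 x))
  have hφ2 : ∫ x, (φ x).toReal ^ 2 ∂μ ≤ (rejectProb φ P).toReal := by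
    rw [rejectProb, ← integral_toReal hφ.1.aemeasurable
      (Eventually.of_forall fun x => (hφ.2 x).trans_lt ENNReal.one_lt_top)]
    refine integral_mono hφ2i hφi fun x => ?_
    exact pow_le_of_le_one ENNReal.toReal_nonneg (hφ1 x) two_ne_zero
  have hφVi : Integrable (fun x => (φ x).toReal * V x) μ := by
    simp only [hV, Finset.mul_sum]
    exact integrable_finsetSum _ fun ε _ => hφZi ε
  have hCS := sq_integral_mul_le hφ2i hV2i hφVi
  have hsum : ∑ ε : G → Bool, rejectProb φ (P.withDensity fun x => ENNReal.ofReal (L ε x)) =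
      ENNReal.ofReal (∫ x, (φ x).toReal * V x ∂μ) := by
    simp only [fun ε => rejectProb_withDensity hφ P (hLm ε) (hL0 ε) (hL2 ε) (hL1 ε)]
    rw [← ENNReal.ofReal_sum_of_nonneg fun ε _ =>
      integral_nonneg fun x => mul_nonneg ENNReal.toReal_nonneg (hZ0 ε x),
      ← integral_finsetSum _ fun ε _ => hφZi ε]
    simp only [hV, Finset.mul_sum, hZ]
  rw [hsum]
  have h2 : (2 : ℝ≥0∞) ^ Fintype.card G = ENNReal.ofReal (2 ^ Fintype.card G) := by
    rw [ENNReal.ofReal_pow (by norm_num)]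
    simp
  rw [h2, ← ENNReal.ofReal_mul (by positivity)]
  refine ENNReal.ofReal_le_ofReal ?_
  refine abs_le_of_sq_le_sq' ?_ (by positivity) |>.2
  rw [mul_pow, Real.sq_sqrt (by positivity)]
  refine hCS.trans ((mul_le_mul hφ2 hV2 (integral_nonneg fun x => sq_nonneg _)
    ENNReal.toReal_nonneg).trans (le_of_eq ?_))
  ring

end Mixture

/-! ### Sobolev norms of rescaled smooth functions -/

section Scaling

variable {ι : Type} [Fintype ι]

local notation "𝔼" => EuclideanSpace ℝ ι

/-- The Fourier transform of a test function decays faster than any power. -/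
theorem exists_norm_fourierT_le {f : 𝔼 → ℝ} (hf : ContDiff ℝ (⊤ : ℕ∞) f)
    (hc : HasCompactSupport f) (N : ℕ) :
    ∃ C : ℝ, 0 ≤ C ∧ ∀ ω, (1 + ‖ω‖) ^ N * ‖fourierT f ω‖ ≤ C := by
  have hfC : ContDiff ℝ (⊤ : ℕ∞) fun x => (f x : ℂ) := Complex.ofRealCLM.contDiff.comp hf
  have hcC : HasCompactSupport fun x => (f x : ℂ) := hc.comp_left Complex.ofReal_zero
  let S : SchwartzMap 𝔼 ℂ := hcC.toSchwartzMap hfC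
  have hS : ∀ ω : 𝔼, fourierT f ω = (((2 * Real.pi) ^ (-(Fintype.card ι : ℝ) / 2) : ℝ) : ℂ) *
      FourierTransform.fourier S ((2 * Real.pi)⁻¹ • ω) := by
    intro ω
    rw [SchwartzMap.fourier_coe, Real.fourier_eq', fourierT]
    congr 1
    refine integral_congr_ae (Eventually.of_forall fun x => ?_)
    dsimp only
    rw [real_inner_smul_right, smul_eq_mul, mul_comm]
    congr 2
    have := Real.pi_pos.ne'
    rw [← Complex.ofReal_neg]
    congr 2
    field_simp
  have hT := SchwartzMap.one_add_le_sup_seminorm_apply (𝕜 := ℝ) (m := (N, 0)) (k := N) (n := 0)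
    le_rfl le_rfl (FourierTransform.fourier S)
  set C₀ : ℝ := 2 ^ N * ((Finset.Iic (N, 0)).sup fun m => SchwartzMap.seminorm ℝ m.1 m.2)
    (FourierTransform.fourier S) with hC₀
  set c : ℝ := (2 * Real.pi) ^ (-(Fintype.card ι : ℝ) / 2) with hcdef
  have hc0 : 0 ≤ c := by positivity
  refine ⟨c * ((2 * Real.pi) ^ N * C₀), by positivity, fun ω => ?_⟩
  have h1 := hT ((2 * Real.pi)⁻¹ • ω)
  rw [norm_iteratedFDeriv_zero] at h1
  rw [hS, norm_mul, Complex.norm_real, Real.norm_of_nonneg hc0, mul_left_comm]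
  refine mul_le_mul_of_nonneg_left ?_ hc0
  have hpi : 1 ≤ 2 * Real.pi := by linarith [Real.pi_gt_three]
  have h2 : 1 + ‖ω‖ ≤ 2 * Real.pi * (1 + ‖(2 * Real.pi)⁻¹ • ω‖) := by
    rw [norm_smul, Real.norm_of_nonneg (by positivity), mul_add, ← mul_assoc,
      mul_inv_cancel₀ (by positivity)]
    linarith
  calc (1 + ‖ω‖) ^ N * ‖FourierTransform.fourier S ((2 * Real.pi)⁻¹ • ω)‖
      ≤ (2 * Real.pi * (1 + ‖(2 * Real.pi)⁻¹ • ω‖)) ^ N *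
        ‖FourierTransform.fourier S ((2 * Real.pi)⁻¹ • ω)‖ := by gcongr
    _ = (2 * Real.pi) ^ N * ((1 + ‖(2 * Real.pi)⁻¹ • ω‖) ^ N *
        ‖FourierTransform.fourier S ((2 * Real.pi)⁻¹ • ω)‖) := by rw [mul_pow, mul_assoc]
    _ ≤ (2 * Real.pi) ^ N * C₀ := by gcongr

theorem sobolevNormSq_lt_top {s : ℝ} (hs : 0 ≤ s) {f : 𝔼 → ℝ} (hf : ContDiff ℝ (⊤ : ℕ∞) f)
    (hc : HasCompactSupport f) : sobolevNormSq s f < ⊤ := by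
  obtain ⟨N, hN⟩ := exists_nat_ge (s + (Fintype.card ι + 1))
  obtain ⟨C, hC0, hC⟩ := exists_norm_fourierT_le hf hc N
  have hr : (Module.finrank ℝ 𝔼 : ℝ) < (Fintype.card ι : ℝ) + 1 := by
    rw [finrank_euclideanSpace]
    linarith
  have hint := (integrable_one_add_norm (μ := (volume : Measure 𝔼)) hr).const_mul (C ^ 2)
  refine lt_of_le_of_lt (lintegral_mono fun ω => ENNReal.ofReal_le_ofReal ?_) hint.lintegral_lt_top
  set t := 1 + ‖ω‖ with ht
  have ht1 : 1 ≤ t := by linarith [norm_nonneg ω]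
  have ht0 : 0 < t := by linarith
  have h1 : (1 + ‖ω‖ ^ 2) ^ s ≤ t ^ (2 * s) := by
    rw [Real.rpow_mul ht0.le]
    refine Real.rpow_le_rpow (by positivity) ?_ hs
    norm_cast
    nlinarith [norm_nonneg ω]
  have h2 : (t ^ N * ‖fourierT f ω‖) ^ 2 ≤ C ^ 2 := pow_le_pow_left₀ (by positivity) (hC ω) 2
  have h3 : t ^ (2 * s) * t ^ ((Fintype.card ι : ℝ) + 1) ≤ (t ^ N) ^ 2 := by
    rw [← Real.rpow_add ht0, ← pow_mul, ← Real.rpow_natCast]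
    refine Real.rpow_le_rpow_of_exponent_le ht1 ?_
    push_cast
    nlinarith [(Nat.cast_nonneg (Fintype.card ι) : (0 : ℝ) ≤ _)]
  rw [Real.rpow_neg ht0.le, ← div_eq_mul_inv, le_div_iff₀ (by positivity)]
  calc (1 + ‖ω‖ ^ 2) ^ s * ‖fourierT f ω‖ ^ 2 * t ^ ((Fintype.card ι : ℝ) + 1)
      ≤ t ^ (2 * s) * ‖fourierT f ω‖ ^ 2 * t ^ ((Fintype.card ι : ℝ) + 1) := by gcongr
    _ = t ^ (2 * s) * t ^ ((Fintype.card ι : ℝ) + 1) * ‖fourierT f ω‖ ^ 2 := by ring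
    _ ≤ (t ^ N) ^ 2 * ‖fourierT f ω‖ ^ 2 := by gcongr
    _ ≤ C ^ 2 := by rwa [← mul_pow]

theorem lintegral_comp_smul (f : 𝔼 → ℝ≥0∞) (hf : Measurable f) {r : ℝ} (hr : 0 < r) :
    ∫⁻ x, f (r • x) = ENNReal.ofReal (r ^ Fintype.card ι)⁻¹ * ∫⁻ x, f x := by
  rw [← lintegral_map hf (measurable_const_smul r), Measure.map_addHaar_smul volume hr.ne',
    lintegral_smul_measure, finrank_euclideanSpace, abs_of_pos (by positivity), smul_eq_mul]

theorem integral_comp_smul_sub {F : Type*} [NormedAddCommGroup F] [NormedSpace ℝ F]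
    (f : 𝔼 → F) {r : ℝ} (hr : 0 < r) (v : 𝔼) :
    ∫ x, f (r • x - v) = (r ^ Fintype.card ι)⁻¹ • ∫ x, f x := by
  rw [Measure.integral_comp_smul volume (fun z => f (z - v)), integral_sub_right_eq_self,
    finrank_euclideanSpace, abs_of_pos (by positivity)]

theorem integrable_comp_smul_sub {F : Type*} [NormedAddCommGroup F] [NormedSpace ℝ F]
    {f : 𝔼 → F} (hf : Integrable f) {r : ℝ} (hr : 0 < r) (v : 𝔼) :
    Integrable fun x => f (r • x - v) :=
  (hf.comp_sub_right v).comp_smul hr.ne'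

theorem norm_fourierT_comp_smul_sub (f : 𝔼 → ℝ) {r : ℝ} (hr : 0 < r) (v ω : 𝔼) :
    ‖fourierT (fun x => f (r • x - v)) ω‖ =
      (r ^ Fintype.card ι)⁻¹ * ‖fourierT f (r⁻¹ • ω)‖ := by
  have h : ∀ x : 𝔼, (f (r • x - v) : ℂ) * Complex.exp (-((inner ℝ x ω : ℝ) : ℂ) * Complex.I) =
      (fun y : 𝔼 => Complex.exp (-((inner ℝ v (r⁻¹ • ω) : ℝ) : ℂ) * Complex.I) *
        ((f y : ℂ) * Complex.exp (-((inner ℝ y (r⁻¹ • ω) : ℝ) : ℂ) * Complex.I))) (r • x - v) := by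
    intro x
    dsimp only
    rw [mul_left_comm, ← Complex.exp_add]
    congr 2
    rw [inner_sub_left, real_inner_smul_right, real_inner_smul_right, real_inner_smul_left,
      inv_mul_cancel_left₀ hr.ne']
    push_cast
    ring
  rw [fourierT, integral_congr_ae (Eventually.of_forall h),
    integral_comp_smul_sub (fun y : 𝔼 => Complex.exp (-((inner ℝ v (r⁻¹ • ω) : ℝ) : ℂ) *
      Complex.I) * ((f y : ℂ) * Complex.exp (-((inner ℝ y (r⁻¹ • ω) : ℝ) : ℂ) * Complex.I))) hr,
    integral_const_mul, fourierT]
  simp only [norm_mul, norm_smul, norm_phase, one_mul]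
  rw [Real.norm_of_nonneg (by positivity)]
  ring

theorem fourierT_sum_mul {G : Type} [Fintype G] {g : G → 𝔼 → ℝ}
    (hg : ∀ m, Integrable (g m)) (c : G → ℝ) (ω : 𝔼) :
    fourierT (fun x => ∑ m, c m * g m x) ω = ∑ m, c m • fourierT (g m) ω := by
  have h : ∀ x : 𝔼, ((∑ m, c m * g m x : ℝ) : ℂ) *
      Complex.exp (-((inner ℝ x ω : ℝ) : ℂ) * Complex.I) =
      ∑ m, (c m : ℂ) * ((g m x : ℂ) * Complex.exp (-((inner ℝ x ω : ℝ) : ℂ) * Complex.I)) := by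
    intro x
    push_cast
    rw [Finset.sum_mul]
    exact Finset.sum_congr rfl fun m _ => mul_assoc _ _ _
  rw [fourierT, integral_congr_ae (Eventually.of_forall h),
    integral_finsetSum _ fun m _ => (integrable_mul_phase (hg m) ω).const_mul _, Finset.mul_sum]
  refine Finset.sum_congr rfl fun m _ => ?_
  rw [integral_const_mul, fourierT, Complex.real_smul]
  ring

variable {G : Type} [Fintype G] [DecidableEq G]

/-- The mean over random signs of the squared Sobolev norm of a signed sum of translates of
`δ f (r x)`: cross terms cancel, so that it is at most `δ² r ^ (2 s)` times the norm of `f` when the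
number of terms is `r ^ card ι`. -/
theorem sum_sobolevNormSq_le {s : ℝ} (hs : 0 ≤ s) {f : 𝔼 → ℝ} (hf : Integrable f) {r : ℝ}
    (hr : 1 ≤ r) (δ : ℝ) (v : G → 𝔼) :
    ∑ ε : G → Bool, sobolevNormSq s (fun x => ∑ m, sgn (ε m) * (δ * f (r • x - v m))) ≤
      2 ^ Fintype.card G * (ENNReal.ofReal
        (Fintype.card G * (r ^ Fintype.card ι)⁻¹ * (δ ^ 2 * r ^ (2 * s))) * sobolevNormSq s f) := by
  have hr0 : 0 < r := by linarith
  have hgi : ∀ m, Integrable fun x : 𝔼 => f (r • x - v m) := fun m =>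
    integrable_comp_smul_sub hf hr0 _
  set R : ℝ := (r ^ Fintype.card ι)⁻¹ with hR
  have hR0 : 0 < R := by positivity
  have hF : ∀ (ε : G → Bool) (ω : 𝔼),
      fourierT (fun x => ∑ m, sgn (ε m) * (δ * f (r • x - v m))) ω =
        ∑ m, sgn (ε m) • (δ • fourierT (fun x => f (r • x - v m)) ω) := by
    intro ε ω
    have := fourierT_sum_mul hgi (fun m => sgn (ε m) * δ) ω
    simp only [mul_assoc] at this
    rw [this]
    exact Finset.sum_congr rfl fun m _ => mul_smul _ _ _
  have hmeas : ∀ ε : G → Bool, Measurable fun ω : 𝔼 => ENNReal.ofReal ((1 + ‖ω‖ ^ 2) ^ s *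
      ‖fourierT (fun x => ∑ m, sgn (ε m) * (δ * f (r • x - v m))) ω‖ ^ 2) := fun ε => by
    have := (continuous_fourierT (u := fun x => ∑ m, sgn (ε m) * (δ * f (r • x - v m)))
      (integrable_finsetSum _ fun m _ => ((hgi m).const_mul δ).const_mul _)).measurable
    fun_prop
  have hmf : Measurable fun ω : 𝔼 => ENNReal.ofReal ((1 + ‖ω‖ ^ 2) ^ s * ‖fourierT f ω‖ ^ 2) := by
    have := (continuous_fourierT hf).measurable
    fun_prop
  unfold sobolevNormSq
  rw [← lintegral_finsetSum _ fun ε _ => hmeas ε]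
  have hpt : ∀ ω : 𝔼, ∑ ε : G → Bool, ENNReal.ofReal ((1 + ‖ω‖ ^ 2) ^ s *
      ‖fourierT (fun x => ∑ m, sgn (ε m) * (δ * f (r • x - v m))) ω‖ ^ 2) ≤
      ENNReal.ofReal (2 ^ Fintype.card G * (Fintype.card G * R ^ 2 * (δ ^ 2 * r ^ (2 * s)))) *
      ENNReal.ofReal ((1 + ‖r⁻¹ • ω‖ ^ 2) ^ s * ‖fourierT f (r⁻¹ • ω)‖ ^ 2) := by
    intro ω
    rw [← ENNReal.ofReal_sum_of_nonneg fun ε _ => by positivity, ← Finset.mul_sum,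
      ← ENNReal.ofReal_mul (by positivity)]
    have hnorm : ∀ m, ‖δ • fourierT (fun x => f (r • x - v m)) ω‖ =
        |δ| * (R * ‖fourierT f (r⁻¹ • ω)‖) := fun m => by
      rw [norm_smul, norm_fourierT_comp_smul_sub f hr0, Real.norm_eq_abs]
    simp only [hF, sum_norm_sum_sgn_smul_sq, hnorm]
    refine ENNReal.ofReal_le_ofReal ?_
    have h1 : (1 + ‖ω‖ ^ 2) ^ s ≤ r ^ (2 * s) * (1 + ‖r⁻¹ • ω‖ ^ 2) ^ s := by
      rw [Real.rpow_mul hr0.le, ← Real.mul_rpow (by positivity) (by positivity)]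
      refine Real.rpow_le_rpow (by positivity) ?_ hs
      rw [norm_smul, Real.norm_of_nonneg (by positivity), mul_pow, mul_add, mul_one,
        Real.rpow_two, ← mul_assoc, ← mul_pow, mul_inv_cancel₀ hr0.ne', one_pow, one_mul]
      have : 1 ≤ r ^ 2 := one_le_pow₀ hr
      linarith
    rw [Finset.sum_const, Finset.card_univ, nsmul_eq_mul]
    calc (1 + ‖ω‖ ^ 2) ^ s * (2 ^ Fintype.card G * (Fintype.card G *
          (|δ| * (R * ‖fourierT f (r⁻¹ • ω)‖)) ^ 2))
        ≤ (r ^ (2 * s) * (1 + ‖r⁻¹ • ω‖ ^ 2) ^ s) * (2 ^ Fintype.card G * (Fintype.card G *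
          (|δ| * (R * ‖fourierT f (r⁻¹ • ω)‖)) ^ 2)) := by gcongr
      _ = _ := by
        rw [mul_pow |δ|, sq_abs]
        ring
  refine (lintegral_mono hpt).trans (le_of_eq ?_)
  have hms : Measurable fun ω : 𝔼 =>
      ENNReal.ofReal ((1 + ‖r⁻¹ • ω‖ ^ 2) ^ s * ‖fourierT f (r⁻¹ • ω)‖ ^ 2) :=
    hmf.comp (measurable_const_smul r⁻¹)
  have hsc := lintegral_comp_smul _ hmf (by positivity : 0 < r⁻¹)
  have h2 : (2 : ℝ≥0∞) ^ Fintype.card G = ENNReal.ofReal (2 ^ Fintype.card G) := by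
    rw [ENNReal.ofReal_pow (by norm_num)]
    simp
  have key : ENNReal.ofReal (2 ^ Fintype.card G * (Fintype.card G * R ^ 2 *
      (δ ^ 2 * r ^ (2 * s)))) * ENNReal.ofReal (r⁻¹ ^ Fintype.card ι)⁻¹ =
      2 ^ Fintype.card G * ENNReal.ofReal (Fintype.card G * R * (δ ^ 2 * r ^ (2 * s))) := by
    rw [h2, ← ENNReal.ofReal_mul (by positivity), ← ENNReal.ofReal_mul (by positivity)]
    congr 1
    rw [inv_pow r, inv_inv, hR]
    field_simp
  rw [lintegral_const_mul _ hms, hsc]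
  exact (mul_assoc _ _ _).symm.trans ((congrArg (· * _) key).trans (mul_assoc _ _ _))

end Scaling

/-! ### Gaussian densities with small Sobolev norm -/

section GaussianDensity

variable {ι : Type} [Fintype ι]

local notation "𝔼" => EuclideanSpace ℝ ι

/-- The centered Gaussian density `(β / π)^(D / 2) exp(-β ‖x‖²)`. -/
def gaussDensity (β : ℝ) (x : 𝔼) : ℝ :=
  (β / Real.pi) ^ ((Fintype.card ι : ℝ) / 2) * Real.exp (-β * ‖x‖ ^ 2)

theorem continuous_gaussDensity (β : ℝ) : Continuous (gaussDensity β : 𝔼 → ℝ) := by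
  unfold gaussDensity
  fun_prop

theorem gaussDensity_pos {β : ℝ} (hβ : 0 < β) (x : 𝔼) : 0 < gaussDensity β x := by
  have := Real.pi_pos
  unfold gaussDensity
  positivity

theorem integrable_gaussDensity {β : ℝ} (hβ : 0 < β) : Integrable (gaussDensity β : 𝔼 → ℝ) :=
  (integrable_gauss hβ).const_mul _

theorem div_pi_rpow_mul_pi_div_rpow {β : ℝ} (hβ : 0 < β) (t : ℝ) :
    (β / Real.pi) ^ t * (Real.pi / β) ^ t = 1 := by
  have := Real.pi_pos
  rw [← Real.mul_rpow (by positivity) (by positivity)]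
  have h : β / Real.pi * (Real.pi / β) = 1 := by field_simp
  rw [h, Real.one_rpow]

theorem integral_gaussDensity {β : ℝ} (hβ : 0 < β) : ∫ x : 𝔼, gaussDensity β x = 1 := by
  unfold gaussDensity
  rw [integral_const_mul, integral_gauss hβ, div_pi_rpow_mul_pi_div_rpow hβ]

theorem fourierT_gaussDensity {β : ℝ} (hβ : 0 < β) (ω : 𝔼) :
    fourierT (gaussDensity β) ω =
      (((2 * Real.pi) ^ (-(Fintype.card ι : ℝ) / 2) * Real.exp (-‖ω‖ ^ 2 / (4 * β)) : ℝ) : ℂ) := by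
  have h : ∀ x : 𝔼, ((gaussDensity β x : ℝ) : ℂ) *
      Complex.exp (-((inner ℝ x ω : ℝ) : ℂ) * Complex.I) =
      (((β / Real.pi) ^ ((Fintype.card ι : ℝ) / 2) : ℝ) : ℂ) * (((Real.exp (-β * ‖x‖ ^ 2) : ℝ) : ℂ) *
        Complex.exp (-((inner ℝ ω x : ℝ) : ℂ) * Complex.I)) := by
    intro x
    rw [real_inner_comm, gaussDensity, Complex.ofReal_mul, mul_assoc]
  rw [fourierT, integral_congr_ae (Eventually.of_forall h), integral_const_mul,
    integral_gauss_mul_cexp hβ, ← Complex.ofReal_mul, ← Complex.ofReal_mul,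
    ← mul_assoc ((β / Real.pi) ^ _), div_pi_rpow_mul_pi_div_rpow hβ, one_mul]

theorem one_add_rpow_le {s t : ℝ} (hs : 0 ≤ s) (ht : 0 ≤ t) :
    (1 + t) ^ s ≤ (2 * s + 1) ^ s * Real.exp (t / 2) := by
  have hN : 0 < 2 * s + 1 := by positivity
  have h1 : 1 + t ≤ (2 * s + 1) * Real.exp (t / (2 * s + 1)) := by
    have h2 := mul_le_mul_of_nonneg_left (Real.add_one_le_exp (t / (2 * s + 1))) hN.le
    have h3 : (2 * s + 1) * (t / (2 * s + 1) + 1) = t + (2 * s + 1) := by field_simp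
    linarith
  refine (Real.rpow_le_rpow (by positivity) h1 hs).trans ?_
  rw [Real.mul_rpow hN.le (Real.exp_pos _).le, ← Real.exp_mul]
  refine mul_le_mul_of_nonneg_left (Real.exp_le_exp.2 ?_) (by positivity)
  rw [div_mul_eq_mul_div, div_le_div_iff₀ hN two_pos]
  nlinarith

/-- Flat Gaussian densities have small Sobolev norm. -/
theorem tendsto_sobolevNormSq_gaussDensity [Nonempty ι] {s : ℝ} (hs : 0 ≤ s) :
    Tendsto (fun r : ℝ => sobolevNormSq s (gaussDensity (1 / (2 * r ^ 2)) : 𝔼 → ℝ)) atTop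
      (𝓝 0) := by
  set c : ℝ := ((2 * Real.pi) ^ (-(Fintype.card ι : ℝ) / 2)) ^ 2 with hc
  let h : 𝔼 → ℝ≥0∞ := fun u =>
    ENNReal.ofReal (c * ((1 + ‖u‖ ^ 2) ^ s * Real.exp (-‖u‖ ^ 2)))
  have hm : Measurable h := by fun_prop
  have hfin : ∫⁻ u, h u ≠ ⊤ := by
    have hi := ((integrable_gauss (ι := ι) (b := 1 / 2) (by norm_num)).const_mul
      (c * (2 * s + 1) ^ s))
    refine (lt_of_le_of_lt (lintegral_mono fun u => ENNReal.ofReal_le_ofReal ?_)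
      hi.lintegral_lt_top).ne
    have h1 := one_add_rpow_le hs (sq_nonneg ‖u‖)
    have h2 : Real.exp (‖u‖ ^ 2 / 2) * Real.exp (-‖u‖ ^ 2) = Real.exp (-(1 / 2) * ‖u‖ ^ 2) := by
      rw [← Real.exp_add]
      congr 1
      ring
    rw [mul_assoc]
    refine mul_le_mul_of_nonneg_left ?_ (by positivity)
    rw [← h2, ← mul_assoc]
    exact mul_le_mul_of_nonneg_right h1 (Real.exp_pos _).le
  have hlim : Tendsto (fun r : ℝ => ENNReal.ofReal r⁻¹ * ∫⁻ u, h u) atTop (𝓝 0) := by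
    have := ENNReal.Tendsto.mul_const (b := ∫⁻ u, h u)
      (ENNReal.tendsto_ofReal tendsto_inv_atTop_zero) (Or.inr hfin)
    simpa using this
  refine tendsto_of_tendsto_of_tendsto_of_le_of_le' tendsto_const_nhds hlim
    (Eventually.of_forall fun r => bot_le) ?_
  filter_upwards [eventually_ge_atTop (1 : ℝ)] with r hr
  have hr0 : 0 < r := by linarith
  have hscale := lintegral_comp_smul h hm hr0
  have hD : (r ^ Fintype.card ι)⁻¹ ≤ r⁻¹ :=
    inv_anti₀ hr0 (le_self_pow₀ hr Fintype.card_ne_zero)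
  calc sobolevNormSq s (gaussDensity (1 / (2 * r ^ 2)) : 𝔼 → ℝ)
      ≤ ∫⁻ ω, h (r • ω) := by
        refine lintegral_mono fun ω => ENNReal.ofReal_le_ofReal ?_
        have h1 : ‖ω‖ ^ 2 ≤ ‖r • ω‖ ^ 2 := by
          rw [norm_smul, Real.norm_of_nonneg hr0.le, mul_pow]
          exact le_mul_of_one_le_left (sq_nonneg _) (one_le_pow₀ hr)
        have h2 : Real.exp (-‖ω‖ ^ 2 / (4 * (1 / (2 * r ^ 2)))) ^ 2 = Real.exp (-‖r • ω‖ ^ 2) := by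
          rw [← Real.exp_nat_mul, norm_smul, Real.norm_of_nonneg hr0.le]
          congr 1
          push_cast
          field_simp
          ring
        rw [fourierT_gaussDensity (by positivity), Complex.norm_real,
          Real.norm_of_nonneg (by positivity), mul_pow, h2, ← hc, mul_left_comm]
        gcongr
    _ = ENNReal.ofReal (r ^ Fintype.card ι)⁻¹ * ∫⁻ u, h u := hscale
    _ ≤ ENNReal.ofReal r⁻¹ * ∫⁻ u, h u := by gcongr

theorem tensor_gaussDensity {k : ℕ} {d : Fin k → ℕ} {β : ℝ} (hβ : 0 < β) :
    tensor (d := d) (fun _ => gaussDensity β) = gaussDensity β := by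
  have := Real.pi_pos
  funext x
  unfold tensor gaussDensity
  rw [Finset.prod_mul_distrib, ← Real.rpow_sum_of_pos (by positivity), ← Real.exp_sum,
    norm_sq_eq_sum_block, ← Finset.mul_sum, card_joint, ← Finset.sum_div]
  simp

end GaussianDensity

/-! ### Oscillating perturbations supported in small cubes -/

section Wavelet

/-- A smooth bump supported in `[-1/4, 1/4]`. -/
def smallBump : ContDiffBump (0 : ℝ) := ⟨1 / 8, 1 / 4, by norm_num, by norm_num⟩

/-- A smooth function with vanishing integral, supported in the unit interval. -/
def mother (t : ℝ) : ℝ := smallBump (t - 1 / 4) - smallBump (t - 3 / 4)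

theorem contDiff_mother : ContDiff ℝ (⊤ : ℕ∞) mother :=
  (smallBump.contDiff.comp (contDiff_id.sub contDiff_const)).sub
    (smallBump.contDiff.comp (contDiff_id.sub contDiff_const))

theorem mother_eq_zero {t : ℝ} (ht : t ∉ Set.Ioo (0 : ℝ) 1) : mother t = 0 := by
  have h : ∀ u : ℝ, 1 / 4 ≤ |u| → smallBump u = 0 := fun u hu =>
    smallBump.zero_of_le_dist (by rw [Real.dist_eq, sub_zero]; exact hu)
  rw [Set.mem_Ioo, not_and_or, not_lt, not_lt] at ht
  rw [mother, h, h, sub_zero]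
  · rw [le_abs]
    rcases ht with ht | ht
    · right; linarith
    · left; linarith
  · rw [le_abs]
    rcases ht with ht | ht
    · right; linarith
    · left; linarith

theorem abs_mother_le (t : ℝ) : |mother t| ≤ 1 := by
  have h1 := smallBump.nonneg' (t - 1 / 4)
  have h2 := smallBump.nonneg' (t - 3 / 4)
  have h3 := smallBump.le_one (x := t - 1 / 4)
  have h4 := smallBump.le_one (x := t - 3 / 4)
  rw [mother, abs_le]
  constructor <;> linarith

theorem mother_quarter : mother (1 / 4) = 1 := by
  rw [mother, smallBump.one_of_mem_closedBall, smallBump.zero_of_le_dist, sub_zero]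
  · rw [Real.dist_eq]
    norm_num [smallBump]
  · rw [Metric.mem_closedBall, Real.dist_eq]
    norm_num [smallBump]

theorem integral_mother : ∫ t, mother t = 0 := by
  have hi : Integrable (fun t => smallBump t) :=
    smallBump.continuous.integrable_of_hasCompactSupport smallBump.hasCompactSupport
  unfold mother
  rw [integral_sub (hi.comp_sub_right _) (hi.comp_sub_right _),
    integral_sub_right_eq_self (fun t => smallBump t),
    integral_sub_right_eq_self (fun t => smallBump t), sub_self]

variable {ι : Type} [Fintype ι]

local notation "𝔼" => EuclideanSpace ℝ ι

/-- The product of the functions `mother (x a)` over all coordinates. -/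
def wavelet (x : 𝔼) : ℝ := ∏ a, mother (x a)

theorem contDiff_wavelet : ContDiff ℝ (⊤ : ℕ∞) (wavelet : 𝔼 → ℝ) :=
  contDiff_prod fun a _ => contDiff_mother.comp (EuclideanSpace.proj (𝕜 := ℝ) a).contDiff

theorem mem_Ioo_of_wavelet_ne_zero {x : 𝔼} (hx : wavelet x ≠ 0) (a : ι) :
    x a ∈ Set.Ioo (0 : ℝ) 1 := by
  by_contra h
  exact hx (Finset.prod_eq_zero (Finset.mem_univ a) (mother_eq_zero h))

theorem norm_sq_le_card {x : 𝔼} (hx : ∀ a, x a ∈ Set.Icc (0 : ℝ) 1) :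
    ‖x‖ ^ 2 ≤ Fintype.card ι := by
  rw [EuclideanSpace.norm_sq_eq]
  refine (Finset.sum_le_sum fun a _ => ?_ : _ ≤ ∑ _a : ι, (1 : ℝ)).trans (by simp)
  rw [Real.norm_of_nonneg (hx a).1]
  exact pow_le_one₀ (hx a).1 (hx a).2

theorem hasCompactSupport_wavelet : HasCompactSupport (wavelet : 𝔼 → ℝ) := by
  refine HasCompactSupport.intro (isCompact_closedBall (0 : 𝔼) √(Fintype.card ι)) fun x hx => ?_
  by_contra h
  refine hx ?_
  rw [mem_closedBall_zero_iff]
  exact Real.le_sqrt_of_sq_le (norm_sq_le_card fun a =>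
    Set.Ioo_subset_Icc_self (mem_Ioo_of_wavelet_ne_zero h a))

theorem abs_wavelet_le (x : 𝔼) : |wavelet x| ≤ 1 := by
  rw [wavelet, Finset.abs_prod]
  exact Finset.prod_le_one (fun a _ => abs_nonneg _) fun a _ => abs_mother_le _

theorem integrable_wavelet : Integrable (wavelet : 𝔼 → ℝ) :=
  contDiff_wavelet.continuous.integrable_of_hasCompactSupport hasCompactSupport_wavelet

theorem integral_wavelet [Nonempty ι] : ∫ x : 𝔼, wavelet x = 0 := by
  have h := (EuclideanSpace.volume_preserving_symm_measurableEquiv_toLp ι).integral_comp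
    (MeasurableEquiv.measurableEmbedding _) (fun y : ι → ℝ => ∏ a, mother (y a))
  rw [integral_fintype_prod_volume_eq_prod (fun _ : ι => mother)] at h
  refine h.trans (Finset.prod_eq_zero (Finset.mem_univ (Classical.arbitrary ι)) integral_mother)

theorem integral_wavelet_sq_pos : 0 < ∫ x : 𝔼, wavelet x ^ 2 := by
  refine Continuous.integral_pos_of_hasCompactSupport_nonneg_nonzero
    (contDiff_wavelet.continuous.pow 2) ?_ (fun x => sq_nonneg _) (x := WithLp.toLp 2 fun _ => 1 / 4)
    ?_
  · exact hasCompactSupport_wavelet.comp_left (g := fun t : ℝ => t ^ 2) (by norm_num)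
  · have h : wavelet (WithLp.toLp 2 fun _ => 1 / 4 : 𝔼) = ∏ _a : ι, mother (1 / 4) := rfl
    rw [h, mother_quarter]
    simp

/-- The lattice point with coordinates `m a`. -/
def vertex {b : ℕ} (m : ι → Fin b) : 𝔼 := WithLp.toLp 2 fun a => (m a : ℝ)

/-- The wavelet moved to the cube with side `1 / b` and lower corner `m / b`. -/
def cell {b : ℕ} (m : ι → Fin b) (x : 𝔼) : ℝ := wavelet ((b : ℝ) • x - vertex m)

variable {b : ℕ}

theorem mem_Ioo_of_cell_ne_zero {m : ι → Fin b} {x : 𝔼} (hx : cell m x ≠ 0) (a : ι) :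
    (b : ℝ) * x a - m a ∈ Set.Ioo (0 : ℝ) 1 :=
  mem_Ioo_of_wavelet_ne_zero hx a

theorem cell_mul_cell (m m' : ι → Fin b) (x : 𝔼) (h : m ≠ m') : cell m x * cell m' x = 0 := by
  by_contra hne
  rw [mul_eq_zero, not_or] at hne
  refine h (funext fun a => Fin.ext ?_)
  have h1 := mem_Ioo_of_cell_ne_zero hne.1 a
  have h2 := mem_Ioo_of_cell_ne_zero hne.2 a
  have h3 : ((m a : ℕ) : ℝ) < (m' a : ℕ) + 1 := by linarith [h1.1, h2.2]
  have h4 : ((m' a : ℕ) : ℝ) < (m a : ℕ) + 1 := by linarith [h1.2, h2.1]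
  norm_cast at h3 h4
  omega

theorem mem_Icc_of_cell_ne_zero {m : ι → Fin b} {x : 𝔼} (hx : cell m x ≠ 0) (a : ι) :
    x a ∈ Set.Icc (0 : ℝ) 1 := by
  have h := mem_Ioo_of_cell_ne_zero hx a
  have hm0 : (0 : ℝ) ≤ (m a : ℕ) := Nat.cast_nonneg _
  have hm : ((m a : ℕ) : ℝ) + 1 ≤ b := by exact_mod_cast (m a).2
  have hb : (0 : ℝ) < b := by linarith
  have h1 : 0 < b * x a := by linarith [h.1]
  have h2 : b * x a < b * 1 := by linarith [h.2]
  exact ⟨(pos_of_mul_pos_right h1 hb.le).le, (lt_of_mul_lt_mul_left h2 hb.le).le⟩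

theorem abs_cell_le (m : ι → Fin b) (x : 𝔼) : |cell m x| ≤ 1 := abs_wavelet_le _

theorem continuous_cell (m : ι → Fin b) : Continuous (cell m) :=
  contDiff_wavelet.continuous.comp ((continuous_const_smul (b : ℝ)).sub continuous_const)

theorem integrable_cell (hb : 0 < b) (m : ι → Fin b) : Integrable (cell m) :=
  integrable_comp_smul_sub integrable_wavelet (by exact_mod_cast hb) _

theorem integrable_cell_sq (hb : 0 < b) (m : ι → Fin b) : Integrable fun x => cell m x ^ 2 := by
  simp only [sq]
  exact (integrable_cell hb m).mul_bdd (c := 1) (continuous_cell m).aestronglyMeasurable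
    (Eventually.of_forall fun x => abs_cell_le m x)

theorem integral_cell_sq (hb : 0 < b) (m : ι → Fin b) :
    ∫ x, cell m x ^ 2 = ((b : ℝ) ^ Fintype.card ι)⁻¹ * ∫ x : 𝔼, wavelet x ^ 2 :=
  integral_comp_smul_sub (fun x : 𝔼 => wavelet x ^ 2) (by exact_mod_cast hb) _

theorem cell_eq_prod_block {k : ℕ} {d : Fin k → ℕ} (m : ((j : Fin k) × Fin (d j)) → Fin b)
    (x : Joint d) : cell m x = ∏ j, cell (fun a => m ⟨j, a⟩) (block j x) := by
  simp only [cell, wavelet]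
  rw [Fintype.prod_sigma]
  rfl

theorem integral_cell [Nonempty ι] (hb : 0 < b) (m : ι → Fin b) : ∫ x, cell m x = 0 := by
  have h := integral_comp_smul_sub (wavelet : 𝔼 → ℝ) (r := b) (by exact_mod_cast hb) (vertex m)
  rwa [integral_wavelet, smul_zero] at h

theorem setIntegral_block_prod {k : ℕ} {d : Fin k → ℕ}
    (f : (j : Fin k) → EuclideanSpace ℝ (Fin (d j)) → ℝ) (j : Fin k)
    {A : Set (EuclideanSpace ℝ (Fin (d j)))} (hA : MeasurableSet A) :
    ∫ x : Joint d in block j ⁻¹' A, ∏ i, f i (block i x) =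
      (∫ y in A, f j y) * ∏ i ∈ Finset.univ.erase j, ∫ y, f i y := by
  have h : ∀ x : Joint d, (block j ⁻¹' A).indicator (fun x => ∏ i, f i (block i x)) x =
      ∏ i, Function.update f j (A.indicator (f j)) i (block i x) := by
    intro x
    rw [← Finset.mul_prod_erase _ _ (Finset.mem_univ j), Function.update_self]
    have h1 : ∏ i ∈ Finset.univ.erase j,
        Function.update f j (A.indicator (f j)) i (block i x) =
        ∏ i ∈ Finset.univ.erase j, f i (block i x) :=
      Finset.prod_congr rfl fun i hi => by
        rw [Function.update_of_ne (Finset.ne_of_mem_erase hi)]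
    rw [h1]
    by_cases hx : block j x ∈ A
    · rw [Set.indicator_of_mem hx, Set.indicator_of_mem (Set.mem_preimage.2 hx),
        Finset.mul_prod_erase _ (fun i => f i (block i x)) (Finset.mem_univ j)]
    · have hx' : x ∉ block j ⁻¹' A := hx
      rw [Set.indicator_of_notMem hx, Set.indicator_of_notMem hx', zero_mul]
  rw [← integral_indicator (measurable_block j hA), integral_congr_ae (Eventually.of_forall h),
    integral_block_prod, ← Finset.mul_prod_erase _ _ (Finset.mem_univ j), Function.update_self,
    integral_indicator hA]
  congr 1
  exact Finset.prod_congr rfl fun i hi => by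
    rw [Function.update_of_ne (Finset.ne_of_mem_erase hi)]

/-- Every cell integrates to zero over the cylinders based on a single block, since the
oscillation in the other blocks remains. -/
theorem setIntegral_cell {k : ℕ} (hk : 2 ≤ k) {d : Fin k → ℕ} (hd : ∀ j, 1 ≤ d j) (hb : 0 < b)
    (m : ((j : Fin k) × Fin (d j)) → Fin b) (j : Fin k)
    {A : Set (EuclideanSpace ℝ (Fin (d j)))} (hA : MeasurableSet A) :
    ∫ x in block j ⁻¹' A, cell m x = 0 := by
  simp only [cell_eq_prod_block]
  rw [setIntegral_block_prod (fun i => cell fun a => m ⟨i, a⟩) j hA]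
  have : Nontrivial (Fin k) := Fin.nontrivial_iff_two_le.2 hk
  obtain ⟨i, hi⟩ := exists_ne j
  have : Nonempty (Fin (d i)) := ⟨⟨0, hd i⟩⟩
  rw [Finset.prod_eq_zero (Finset.mem_erase.2 ⟨hi, Finset.mem_univ i⟩) (integral_cell hb _),
    mul_zero]

end Wavelet

/-! ### The null law and its perturbations -/

section Perturbation

variable {k : ℕ} {d : Fin k → ℕ}

/-- The law on `ℝ^d` with density `f`. -/
def lawOf (f : Joint d → ℝ) : Measure (Joint d) :=
  volume.withDensity fun x => ENNReal.ofReal (f x)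

theorem isDensityOf_lawOf {f : Joint d → ℝ} (hf : ∀ x, 0 ≤ f x) (hm : AEMeasurable f) :
    IsDensityOf f (lawOf f) := ⟨hf, hm, rfl⟩

theorem isProbabilityMeasure_lawOf {f : Joint d → ℝ} (hf : ∀ x, 0 ≤ f x) (hi : Integrable f)
    (h1 : ∫ x, f x = 1) : IsProbabilityMeasure (lawOf f) := by
  refine ⟨?_⟩
  rw [lawOf, withDensity_apply _ MeasurableSet.univ, Measure.restrict_univ,
    ← ofReal_integral_eq_lintegral_ofReal hi (Eventually.of_forall hf), h1, ENNReal.ofReal_one]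

/-- Adding to a product density a function that integrates to zero over every cylinder based on a
single block does not change the marginal laws. -/
theorem isDensityOf_marginal_lawOf {q : (j : Fin k) → EuclideanSpace ℝ (Fin (d j)) → ℝ}
    (hq0 : ∀ j x, 0 ≤ q j x) (hqi : ∀ j, Integrable (q j)) (hq1 : ∀ j, ∫ x, q j x = 1)
    {f : Joint d → ℝ} (hfi : Integrable f) (hf0 : ∀ x, 0 ≤ tensor q x + f x) (j : Fin k)
    (hfj : ∀ A : Set (EuclideanSpace ℝ (Fin (d j))), MeasurableSet A →
      ∫ x in block j ⁻¹' A, f x = 0) :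
    IsDensityOf (q j) (marginal (lawOf fun x => tensor q x + f x) j) := by
  refine ⟨hq0 j, (hqi j).aestronglyMeasurable.aemeasurable, ?_⟩
  ext A hA
  have hti : Integrable (tensor q) := integrable_tensor hqi
  have htf : Integrable fun x => tensor q x + f x := hti.add hfi
  have hB := measurable_block (d := d) j hA
  rw [marginal, Measure.map_apply (measurable_block j) hA, lawOf, withDensity_apply _ hB,
    withDensity_apply _ hA, ← ofReal_integral_eq_lintegral_ofReal htf.integrableOn
      (Eventually.of_forall hf0), ← ofReal_integral_eq_lintegral_ofReal (hqi j).integrableOn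
      (Eventually.of_forall (hq0 j))]
  congr 1
  have h := setIntegral_block_prod q j hA
  rw [Finset.prod_eq_one fun i _ => hq1 i, mul_one] at h
  rw [integral_add hti.integrableOn hfi.integrableOn, hfj A hA, add_zero]
  exact h

theorem lawOf_mem_nullHyp {s : ℝ} {M : Fin k → ℝ}
    {q : (j : Fin k) → EuclideanSpace ℝ (Fin (d j)) → ℝ}
    (hq0 : ∀ j x, 0 ≤ q j x) (hqc : ∀ j, Continuous (q j)) (hqi : ∀ j, Integrable (q j))
    (hq1 : ∀ j, ∫ x, q j x = 1) (hqs : ∀ j, sobolevNormSq s (q j) ≤ ENNReal.ofReal (M j) ^ 2) :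
    lawOf (tensor q) ∈ nullHyp d s M := by
  have ht0 : ∀ x, 0 ≤ tensor q x := fun x => Finset.prod_nonneg fun j _ => hq0 j _
  have hti : Integrable (tensor q) := integrable_tensor hqi
  have hmarg := fun j => isDensityOf_marginal_lawOf hq0 hqi hq1 (f := fun _ => 0)
    (integrable_zero _ _ _) (fun x => by rw [add_zero]; exact ht0 x) j
    (fun A _ => integral_zero _ _)
  simp only [add_zero] at hmarg
  refine ⟨isProbabilityMeasure_lawOf ht0 hti ?_, q, fun j => ⟨hmarg j, hqi j,
    Eventually.of_forall fun x => (hqc j).continuousAt, hqs j⟩,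
    isDensityOf_lawOf ht0 hti.aestronglyMeasurable.aemeasurable⟩
  have h := integral_block_prod q
  rwa [Finset.prod_eq_one fun i _ => hq1 i] at h

theorem lawOf_mem_altHyp {s : ℝ} {M : Fin k → ℝ} {δ : ℝ}
    {q : (j : Fin k) → EuclideanSpace ℝ (Fin (d j)) → ℝ}
    (hq0 : ∀ j x, 0 ≤ q j x) (hqc : ∀ j, Continuous (q j)) (hqi : ∀ j, Integrable (q j))
    (hq1 : ∀ j, ∫ x, q j x = 1) (hqs : ∀ j, sobolevNormSq s (q j) ≤ ENNReal.ofReal (M j) ^ 2)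
    {f : Joint d → ℝ} (hfc : Continuous f) (hfi : Integrable f) (hfint : ∫ x, f x = 0)
    (hf0 : ∀ x, 0 ≤ tensor q x + f x)
    (hfj : ∀ (j : Fin k) (A : Set (EuclideanSpace ℝ (Fin (d j)))), MeasurableSet A →
      ∫ x in block j ⁻¹' A, f x = 0)
    (hfs : sobolevNormSq s (fun x => tensor q x + f x) ≤ ENNReal.ofReal (∏ j, M j) ^ 2)
    (hfδ : ENNReal.ofReal δ ≤ eLpNorm f 2 volume) :
    lawOf (fun x => tensor q x + f x) ∈ altHyp d s M δ := by
  have hti : Integrable (tensor q) := integrable_tensor hqi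
  have htc : Continuous (tensor q) :=
    continuous_finsetProd _ fun j _ => (hqc j).comp (continuous_block j)
  refine ⟨isProbabilityMeasure_lawOf hf0 (hti.add hfi) ?_, fun x => tensor q x + f x, q,
    isDensityOf_lawOf hf0 (htc.add hfc).measurable.aemeasurable,
    ⟨hti.add hfi, Eventually.of_forall fun x => (htc.add hfc).continuousAt, hfs⟩,
    fun j => ⟨isDensityOf_marginal_lawOf hq0 hqi hq1 hfi hf0 j (hfj j), hqi j,
      Eventually.of_forall fun x => (hqc j).continuousAt, hqs j⟩, ?_⟩
  · have h := integral_block_prod q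
    rw [Finset.prod_eq_one fun i _ => hq1 i] at h
    rw [integral_add hti hfi, hfint, add_zero]
    exact h
  · simpa only [add_sub_cancel_left] using hfδ

variable {ι : Type} [Fintype ι] [DecidableEq ι] {b : ℕ}

/-- The perturbation `δ ∑ m, ε m * cell m`, with signs `ε`. -/
def perturbation (δ : ℝ) (ε : (ι → Fin b) → Bool) (x : EuclideanSpace ℝ ι) : ℝ :=
  ∑ m, sgn (ε m) * (δ * cell m x)

theorem continuous_perturbation (δ : ℝ) (ε : (ι → Fin b) → Bool) :
    Continuous (perturbation δ ε) :=
  continuous_finsetSum _ fun m _ => continuous_const.mul (continuous_const.mul (continuous_cell m))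

theorem integrable_perturbation (hb : 0 < b) (δ : ℝ) (ε : (ι → Fin b) → Bool) :
    Integrable (perturbation δ ε) :=
  integrable_finsetSum _ fun m _ => ((integrable_cell hb m).const_mul _).const_mul _

theorem setIntegral_perturbation (hk : 2 ≤ k) (hd : ∀ j, 1 ≤ d j) (hb : 0 < b) (δ : ℝ)
    (ε : (((j : Fin k) × Fin (d j)) → Fin b) → Bool) (j : Fin k)
    {A : Set (EuclideanSpace ℝ (Fin (d j)))} (hA : MeasurableSet A) :
    ∫ x in block j ⁻¹' A, perturbation δ ε x = 0 := by
  unfold perturbation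
  rw [integral_finsetSum _ fun m _ =>
    (((integrable_cell hb m).const_mul _).const_mul _).integrableOn]
  simp [integral_const_mul, setIntegral_cell hk hd hb _ j hA]

theorem perturbation_sq (δ : ℝ) (ε : (ι → Fin b) → Bool) (x : EuclideanSpace ℝ ι) :
    perturbation δ ε x ^ 2 = ∑ m : ι → Fin b, δ ^ 2 * cell m x ^ 2 := by
  have h := sum_mul_sum_of_disjoint (h := fun (m : ι → Fin b) (x : EuclideanSpace ℝ ι) => cell m x)
    cell_mul_cell (fun m => sgn (ε m) * δ) (fun m => sgn (ε m) * δ) x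
  rw [sq, perturbation]
  simp only [← mul_assoc]
  simp only [h]
  refine Finset.sum_congr rfl fun m _ => ?_
  linear_combination δ ^ 2 * cell m x ^ 2 * sgn_sq (ε m)

theorem integral_perturbation_sq (hb : 0 < b) (δ : ℝ) (ε : (ι → Fin b) → Bool) :
    Integrable (fun x => perturbation δ ε x ^ 2) ∧
    ∫ x, perturbation δ ε x ^ 2 = δ ^ 2 * ∫ x : EuclideanSpace ℝ ι, wavelet x ^ 2 := by
  have hi : ∀ m : ι → Fin b, Integrable fun x => δ ^ 2 * cell m x ^ 2 := fun m =>
    (integrable_cell_sq hb m).const_mul _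
  simp only [perturbation_sq]
  refine ⟨integrable_finsetSum _ fun m _ => hi m, ?_⟩
  rw [integral_finsetSum _ fun m _ => hi m]
  simp only [integral_const_mul, integral_cell_sq hb, Finset.sum_const, Finset.card_univ,
    Fintype.card_fun, Fintype.card_fin, nsmul_eq_mul]
  push_cast
  have : (0 : ℝ) < b := by exact_mod_cast hb
  field_simp

theorem ofReal_le_eLpNorm_perturbation (hb : 0 < b) {δ Δ : ℝ} (hδ : 0 ≤ δ)
    (hΔ : Δ ≤ δ * √(∫ x : EuclideanSpace ℝ ι, wavelet x ^ 2)) (ε : (ι → Fin b) → Bool) :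
    ENNReal.ofReal Δ ≤ eLpNorm (perturbation δ ε) 2 volume := by
  obtain ⟨hi, hint⟩ := integral_perturbation_sq hb δ ε
  have h : ∫⁻ x, ‖perturbation δ ε x‖ₑ ^ (2 : ℝ) =
      ENNReal.ofReal (δ ^ 2 * ∫ x : EuclideanSpace ℝ ι, wavelet x ^ 2) := by
    rw [← hint, ofReal_integral_eq_lintegral_ofReal hi (Eventually.of_forall fun x => sq_nonneg _)]
    refine lintegral_congr fun x => ?_
    rw [Real.enorm_eq_ofReal_abs, ENNReal.rpow_two, ← ENNReal.ofReal_pow (abs_nonneg _), sq_abs]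
  have hK : 0 ≤ ∫ x : EuclideanSpace ℝ ι, wavelet x ^ 2 := integral_nonneg fun x => sq_nonneg _
  rw [eLpNorm_eq_lintegral_rpow_enorm_toReal two_ne_zero ENNReal.ofNat_ne_top,
    ENNReal.toReal_ofNat, h, ENNReal.ofReal_rpow_of_nonneg (by positivity) (by norm_num),
    ← Real.sqrt_eq_rpow, Real.sqrt_mul (sq_nonneg δ), Real.sqrt_sq hδ]
  exact ENNReal.ofReal_le_ofReal hΔ

theorem abs_perturbation_le {δ : ℝ} (hδ : 0 ≤ δ) (ε : (ι → Fin b) → Bool)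
    (x : EuclideanSpace ℝ ι) : |perturbation δ ε x| ≤ δ := by
  refine abs_sum_sgn_mul_le (h := fun (m : ι → Fin b) (x : EuclideanSpace ℝ ι) => δ * cell m x)
    (fun m m' x h => ?_) hδ x (fun m => ?_) ε
  · linear_combination δ ^ 2 * cell_mul_cell m m' x h
  · rw [abs_mul, abs_of_nonneg hδ]
    exact mul_le_of_le_one_right hδ (abs_cell_le m x)

theorem perturbation_eq_zero {δ : ℝ} (ε : (ι → Fin b) → Bool) {x : EuclideanSpace ℝ ι}
    (hx : ¬∀ a, x a ∈ Set.Icc (0 : ℝ) 1) : perturbation δ ε x = 0 := by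
  refine Finset.sum_eq_zero fun m _ => ?_
  by_contra h
  exact hx (mem_Icc_of_cell_ne_zero fun h0 => h (by rw [h0, mul_zero, mul_zero]))

end Perturbation

/-! ### The lower bound for the testing error -/

section LowerBound

theorem sobolevNormSq_neg {ι : Type} [Fintype ι] (s : ℝ) (f : EuclideanSpace ℝ ι → ℝ) :
    sobolevNormSq s (fun x => -f x) = sobolevNormSq s f := by
  have h : ∀ ω, fourierT (fun x => -f x) ω = -fourierT f ω := fun ω => by
    simp [fourierT, integral_neg]
  simp only [sobolevNormSq, h, norm_neg]

theorem sobolevNormSq_add_le {ι : Type} [Fintype ι] {s : ℝ} {f g : EuclideanSpace ℝ ι → ℝ}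
    (hf : Integrable f) (hg : Integrable g) :
    sobolevNormSq s (fun x => f x + g x) ≤ 2 * sobolevNormSq s f + 2 * sobolevNormSq s g := by
  have h := sobolevNormSq_sub_le (s := s) hf hg.neg
  have h2 := sobolevNormSq_neg s g
  simp only [Pi.neg_apply, sub_neg_eq_add] at h
  exact h.trans (by rw [← h2]; rfl)

variable {k : ℕ} {d : Fin k → ℕ} {b : ℕ}

/-- The probability of rejection, averaged over all signs of the perturbation. The exponent is
half the sum of the squares of `n ∫ (δ cell)² / p`, bounded through the lower bound `c` of the
Gaussian density `p` on the unit cube. -/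
theorem sum_rejectProb_perturbation_le {β : ℝ} (hβ : 0 < β) {c : ℝ} (hc : 0 < c)
    (hcβ : ∀ x : Joint d, (∀ a, x a ∈ Set.Icc (0 : ℝ) 1) → c ≤ gaussDensity β x) {δ : ℝ}
    (hδ : 0 < δ) (hδc : δ ≤ c) (hb : 0 < b) (hD : 0 < Fintype.card ((j : Fin k) × Fin (d j)))
    {n : ℕ} {φ : (Fin n → Joint d) → ℝ≥0∞} (hφ : IsTest φ) :
    ∑ ε : (((j : Fin k) × Fin (d j)) → Fin b) → Bool,
      rejectProb φ (lawOf fun x => gaussDensity β x + perturbation δ ε x) ≤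
    2 ^ Fintype.card (((j : Fin k) × Fin (d j)) → Fin b) * ENNReal.ofReal
      √((rejectProb φ (lawOf (gaussDensity β : Joint d → ℝ))).toReal *
        Real.exp ((n * (δ ^ 2 / c * ∫ x : Joint d, wavelet x ^ 2)) ^ 2 /
          (2 * (b : ℝ) ^ Fintype.card ((j : Fin k) × Fin (d j))))) := by
  set J := (j : Fin k) × Fin (d j) with hJ
  set p : Joint d → ℝ := gaussDensity β with hp
  have hp0 : ∀ x, 0 < p x := gaussDensity_pos hβ
  have hpc : Continuous p := continuous_gaussDensity β
  set P := lawOf p with hP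
  have hPd : IsDensityOf p P := isDensityOf_lawOf (fun x => (hp0 x).le) hpc.measurable.aemeasurable
  have : IsProbabilityMeasure P := isProbabilityMeasure_lawOf (fun x => (hp0 x).le)
    (integrable_gaussDensity hβ) (integral_gaussDensity hβ)
  have : Nonempty J := Fintype.card_pos_iff.1 hD
  let h : (J → Fin b) → Joint d → ℝ := fun m x => δ * cell m x / p x
  have hm : ∀ m, Measurable (h m) := fun m =>
    ((continuous_cell m).measurable.const_mul δ).div hpc.measurable
  have hcell : ∀ (m : J → Fin b) x, cell m x ≠ 0 → c ≤ p x := fun m x hx =>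
    hcβ x (mem_Icc_of_cell_ne_zero hx)
  have h1 : ∀ m x, |h m x| ≤ 1 := by
    intro m x
    by_cases hx : cell m x = 0
    · simp [h, hx]
    · rw [abs_div, abs_mul, abs_of_pos hδ, abs_of_pos (hp0 x), div_le_one (hp0 x)]
      exact (mul_le_of_le_one_right hδ.le (abs_cell_le m x)).trans (hδc.trans (hcell m x hx))
  have hdis : ∀ m m' x, m ≠ m' → h m x * h m' x = 0 := by
    intro m m' x hne
    have := cell_mul_cell m m' x hne
    have e : h m x * h m' x = δ ^ 2 / p x ^ 2 * (cell m x * cell m' x) := by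
      simp only [h]
      field_simp
    rw [e, this, mul_zero]
  have h0 : ∀ m, ∫ x, h m x ∂P = 0 := by
    intro m
    rw [hPd.integral_eq]
    have e : ∀ x, p x • h m x = δ * cell m x := fun x => by
      have := (hp0 x).ne'
      simp only [h, smul_eq_mul]
      field_simp
    simp only [e]
    rw [integral_const_mul, integral_cell hb, mul_zero]
  have hbD : (0 : ℝ) < (b : ℝ) ^ Fintype.card J := by
    have : (0 : ℝ) < b := by exact_mod_cast hb
    positivity
  set K := ∫ x : Joint d, wavelet x ^ 2 with hK
  have h2 : ∀ m, ∫ x, h m x ^ 2 ∂P ≤ δ ^ 2 / c * (((b : ℝ) ^ Fintype.card J)⁻¹ * K) := by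
    intro m
    rw [hPd.integral_eq, ← integral_cell_sq hb m, ← integral_const_mul]
    have hle : ∀ x, p x • h m x ^ 2 ≤ δ ^ 2 / c * cell m x ^ 2 := by
      intro x
      have hpx := hp0 x
      by_cases hx : cell m x = 0
      · simp [h, hx]
      · have e : p x • h m x ^ 2 = δ ^ 2 * cell m x ^ 2 / p x := by
          simp only [h, smul_eq_mul]
          field_simp
        rw [e, div_mul_eq_mul_div]
        exact div_le_div_of_nonneg_left (by positivity) hc (hcell m x hx)
    refine integral_mono_of_nonneg (Eventually.of_forall fun x => ?_)
      ((integrable_cell_sq hb m).const_mul _) (Eventually.of_forall hle)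
    exact smul_nonneg (hp0 x).le (sq_nonneg _)
  have key := sum_rejectProb_le P hm h1 hdis h0 hφ
  have hlaw : ∀ ε : (J → Fin b) → Bool,
      P.withDensity (fun x => ENNReal.ofReal (1 + ∑ m, sgn (ε m) * h m x)) =
        lawOf fun x => p x + perturbation δ ε x := by
    intro ε
    rw [hP, lawOf, ← withDensity_mul _ hpc.measurable.ennreal_ofReal
      ((Finset.measurable_fun_sum _ fun m _ => (hm m).const_mul _).const_add 1).ennreal_ofReal,
      lawOf]
    congr 1
    funext x
    have hpx := (hp0 x).ne'
    rw [Pi.mul_apply, ← ENNReal.ofReal_mul (hp0 x).le, mul_add, mul_one, perturbation,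
      Finset.mul_sum]
    congr 2
    refine Finset.sum_congr rfl fun m _ => ?_
    simp only [h]
    field_simp
  simp only [hlaw] at key
  refine key.trans (mul_le_mul_right (ENNReal.ofReal_le_ofReal (Real.sqrt_le_sqrt ?_)) _)
  refine mul_le_mul_of_nonneg_left (Real.exp_le_exp.2 ?_) ENNReal.toReal_nonneg
  refine (Finset.sum_le_sum fun m _ => (?_ : _ ≤
    (n * (δ ^ 2 / c * (((b : ℝ) ^ Fintype.card J)⁻¹ * K))) ^ 2 / 2)).trans (le_of_eq ?_)
  · have := h2 m
    have h3 : 0 ≤ ∫ x, h m x ^ 2 ∂P := integral_nonneg fun x => sq_nonneg _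
    gcongr
  · rw [Finset.sum_const, Finset.card_univ, Fintype.card_fun, Fintype.card_fin, nsmul_eq_mul]
    push_cast
    field_simp
    change (n : ℝ) ^ 2 * K ^ 2 * (b : ℝ) ^ Fintype.card J = _
    ring

/-- A nonasymptotic upper bound for the power against the alternative. The last summand bounds
the proportion of the perturbed laws that leave the Sobolev ball, by Markov's inequality. -/
theorem power_altHyp_le (hk : 2 ≤ k) (hd : ∀ j, 1 ≤ d j) {s : ℝ} (hs : 0 ≤ s) {M : Fin k → ℝ}
    (hM : ∀ j, 0 < M j) {β : ℝ} (hβ : 0 < β)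
    (hq : ∀ j, sobolevNormSq s (gaussDensity β : EuclideanSpace ℝ (Fin (d j)) → ℝ) ≤
      ENNReal.ofReal (M j) ^ 2)
    (hp : sobolevNormSq s (gaussDensity β : Joint d → ℝ) ≤ ENNReal.ofReal ((∏ j, M j) ^ 2 / 4))
    {c : ℝ} (hc : 0 < c)
    (hcβ : ∀ x : Joint d, (∀ a, x a ∈ Set.Icc (0 : ℝ) 1) → c ≤ gaussDensity β x) {δ : ℝ}
    (hδ : 0 < δ) (hδc : δ ≤ c) (hb : 0 < b)
    (hψ : ENNReal.ofReal (δ ^ 2 * (b : ℝ) ^ (2 * s)) * sobolevNormSq s (wavelet : Joint d → ℝ) ≤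
      ENNReal.ofReal ((∏ j, M j) ^ 2 / 8)) {Δ : ℝ}
    (hΔ : Δ ≤ δ * √(∫ x : Joint d, wavelet x ^ 2))
    {n : ℕ} {φ : (Fin n → Joint d) → ℝ≥0∞} (hφ : IsTest φ) :
    power φ (altHyp d s M Δ) ≤ ENNReal.ofReal
      √((rejectProb φ (lawOf (gaussDensity β : Joint d → ℝ))).toReal *
        Real.exp ((n * (δ ^ 2 / c * ∫ x : Joint d, wavelet x ^ 2)) ^ 2 /
          (2 * (b : ℝ) ^ Fintype.card ((j : Fin k) × Fin (d j))))) + 2⁻¹ := by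
  set J := (j : Fin k) × Fin (d j) with hJ
  have : Nonempty J := ⟨⟨⟨0, by omega⟩, ⟨0, hd _⟩⟩⟩
  have hDpos : 0 < Fintype.card J := Fintype.card_pos
  set N := ∏ j, M j with hN
  have hN0 : 0 < N := Finset.prod_pos fun j _ => hM j
  set A := ENNReal.ofReal
      √((rejectProb φ (lawOf (gaussDensity β : Joint d → ℝ))).toReal *
        Real.exp ((n * (δ ^ 2 / c * ∫ x : Joint d, wavelet x ^ 2)) ^ 2 /
          (2 * (b : ℝ) ^ Fintype.card J))) with hA
  have hsum := sum_rejectProb_perturbation_le hβ hc hcβ hδ hδc hb hDpos hφ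
  set T := ENNReal.ofReal (N ^ 2 / 4) with hT
  have hT0 : T ≠ 0 := (ENNReal.ofReal_pos.2 (by positivity)).ne'
  have hTt : T ≠ ⊤ := ENNReal.ofReal_ne_top
  have hpi : Integrable (gaussDensity β : Joint d → ℝ) := integrable_gaussDensity hβ
  -- either the perturbed law belongs to the alternative or its Sobolev norm is large
  have hpow : ∀ ε : (J → Fin b) → Bool, power φ (altHyp d s M Δ) ≤
      rejectProb φ (lawOf fun x => gaussDensity β x + perturbation δ ε x) +
        sobolevNormSq s (perturbation δ ε) / T := by
    intro ε
    by_cases hε : sobolevNormSq s (perturbation δ ε) ≤ T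
    · have hfi := integrable_perturbation hb δ ε
      have hmem : lawOf (fun x => gaussDensity β x + perturbation δ ε x) ∈ altHyp d s M Δ := by
        rw [← tensor_gaussDensity hβ]
        refine lawOf_mem_altHyp (fun j x => (gaussDensity_pos hβ x).le)
          (fun j => continuous_gaussDensity β) (fun j => integrable_gaussDensity hβ)
          (fun j => integral_gaussDensity hβ) hq (continuous_perturbation δ ε) hfi ?_ ?_ ?_ ?_
          (ofReal_le_eLpNorm_perturbation hb hδ.le hΔ ε)
        · have := setIntegral_perturbation hk hd hb δ ε ⟨0, by omega⟩ MeasurableSet.univ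
          rwa [Set.preimage_univ, setIntegral_univ] at this
        · intro x
          rw [tensor_gaussDensity hβ]
          by_cases hx : ∀ a, x a ∈ Set.Icc (0 : ℝ) 1
          · have h1 := hcβ x hx
            have h2 := (abs_le.1 (abs_perturbation_le hδ.le ε x)).1
            linarith
          · rw [perturbation_eq_zero ε hx, add_zero]
            exact (gaussDensity_pos hβ x).le
        · exact fun j A hA => setIntegral_perturbation hk hd hb δ ε j hA
        · rw [tensor_gaussDensity hβ]
          refine (sobolevNormSq_add_le hpi hfi).trans ((add_le_add (mul_le_mul_right hp 2)
            (mul_le_mul_right hε 2)).trans (le_of_eq ?_))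
          rw [← mul_add, ← ENNReal.ofReal_add (by positivity) (by positivity),
            ← ENNReal.ofReal_ofNat 2, ← ENNReal.ofReal_mul (by norm_num),
            ← ENNReal.ofReal_pow hN0.le]
          congr 1
          ring
      exact ((min_le_right _ _).trans (iInf₂_le _ hmem)).trans le_self_add
    · rw [not_le] at hε
      have h1 : 1 ≤ sobolevNormSq s (perturbation δ ε) / T := by
        rw [ENNReal.le_div_iff_mul_le (Or.inl hT0) (Or.inl hTt), one_mul]
        exact hε.le
      exact (min_le_left _ _).trans (h1.trans le_add_self)
  have hS : ∑ ε : (J → Fin b) → Bool, sobolevNormSq s (perturbation δ ε : Joint d → ℝ) ≤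
      2 ^ Fintype.card (J → Fin b) * ENNReal.ofReal (N ^ 2 / 8) := by
    have h1 := sum_sobolevNormSq_le (G := J → Fin b) hs (integrable_wavelet (ι := J))
      (r := b) (by exact_mod_cast hb) δ vertex
    refine h1.trans (mul_le_mul_right (le_trans (le_of_eq ?_) hψ) _)
    congr 2
    have : (0 : ℝ) < b := by exact_mod_cast hb
    rw [Fintype.card_fun, Fintype.card_fin]
    push_cast
    field_simp
  set C : ℝ≥0∞ := 2 ^ Fintype.card (J → Fin b) with hC
  have hC0 : C ≠ 0 := pow_ne_zero _ two_ne_zero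
  have hCt : C ≠ ⊤ := ENNReal.pow_ne_top ENNReal.ofNat_ne_top
  have hall : C * power φ (altHyp d s M Δ) ≤ C * (A + 2⁻¹) := by
    have h1 : C * power φ (altHyp d s M Δ) =
        ∑ _ε : (J → Fin b) → Bool, power φ (altHyp d s M Δ) := by
      rw [Finset.sum_const, Finset.card_univ, Fintype.card_fun, Fintype.card_bool, nsmul_eq_mul]
      push_cast
      rfl
    rw [h1]
    refine (Finset.sum_le_sum fun ε _ => hpow ε).trans ?_
    rw [Finset.sum_add_distrib, mul_add]
    refine add_le_add hsum ?_
    simp only [div_eq_mul_inv]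
    rw [← Finset.sum_mul]
    refine (mul_le_mul_left hS _).trans (le_of_eq ?_)
    rw [mul_assoc]
    congr 1
    rw [hT, ← ENNReal.ofReal_inv_of_pos (by positivity), ← ENNReal.ofReal_mul (by positivity),
      ← ENNReal.ofReal_ofNat 2, ← ENNReal.ofReal_inv_of_pos (by norm_num)]
    congr 1
    field_simp
    norm_num
  exact (ENNReal.mul_le_mul_iff_right hC0 hCt).1 hall

end LowerBound

/-! ### Rates and the minimax lower bound -/

section Minimax

/-- The choice `b ≍ n ^ (2 / (D + 4 s))` of the number of cells per direction balances the Sobolev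
norm of a perturbation of height `δ = C n ^ (-2 s / (D + 4 s))` and the exponent in the second
moment of the likelihood ratio. -/
theorem exists_resolution {s : ℝ} (hs : 0 < s) (D : ℕ) {C c ε L : ℝ} (κ : ℝ) (hC : 0 < C)
    (hc : 0 < c) (hε : 0 < ε) (hL : 0 ≤ L) :
    ∃ (E : ℝ) (b : ℕ → ℕ), 0 ≤ E ∧ ∀ᶠ n : ℕ in atTop, 0 < b n ∧
      C * (n : ℝ) ^ (-(2 * s / (D + 4 * s))) ≤ c ∧
      (C * (n : ℝ) ^ (-(2 * s / (D + 4 * s)))) ^ 2 * (b n : ℝ) ^ (2 * s) * L ≤ ε ∧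
      (n * ((C * (n : ℝ) ^ (-(2 * s / (D + 4 * s)))) ^ 2 * κ)) ^ 2 / (2 * (b n : ℝ) ^ D) ≤ E := by
  set θ : ℝ := D + 4 * s with hθ
  have hθ0 : 0 < θ := by positivity
  set a : ℝ := 2⁻¹ * (ε / (C ^ 2 * (L + 1))) ^ (1 / (2 * s)) with ha
  have ha0 : 0 < a := by positivity
  have h2a : (2 * a) ^ (2 * s) = ε / (C ^ 2 * (L + 1)) := by
    rw [ha, mul_inv_cancel_left₀ two_ne_zero, ← Real.rpow_mul (by positivity),
      one_div_mul_cancel (by positivity), Real.rpow_one]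
  refine ⟨(C ^ 2 * κ) ^ 2 / (2 * a ^ D), fun n => ⌈a * (n : ℝ) ^ (2 / θ)⌉₊, by positivity, ?_⟩
  have ht1 : Tendsto (fun n : ℕ => a * (n : ℝ) ^ (2 / θ)) atTop atTop :=
    ((tendsto_rpow_atTop (by positivity)).comp tendsto_natCast_atTop_atTop).const_mul_atTop ha0
  have ht2 : Tendsto (fun n : ℕ => C * (n : ℝ) ^ (-(2 * s / θ))) atTop (𝓝 (C * 0)) :=
    ((tendsto_rpow_neg_atTop (by positivity)).comp tendsto_natCast_atTop_atTop).const_mul C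
  rw [mul_zero] at ht2
  filter_upwards [ht1.eventually_ge_atTop 1, ht2.eventually_le_const hc, eventually_gt_atTop 0]
    with n h1 h2 hn
  have hn0 : (0 : ℝ) < n := by exact_mod_cast hn
  set x : ℝ := a * (n : ℝ) ^ (2 / θ) with hx
  have hxb : x ≤ (⌈x⌉₊ : ℝ) := Nat.le_ceil x
  have hbx : (⌈x⌉₊ : ℝ) ≤ 2 * x := by linarith [Nat.ceil_lt_add_one (by linarith : 0 ≤ x)]
  refine ⟨Nat.ceil_pos.2 (by linarith), h2, ?_, ?_⟩
  · have e1 : (⌈x⌉₊ : ℝ) ^ (2 * s) ≤ (2 * a) ^ (2 * s) * (n : ℝ) ^ (4 * s / θ) := by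
      refine (Real.rpow_le_rpow (by positivity) hbx (by positivity)).trans (le_of_eq ?_)
      rw [hx, ← mul_assoc, Real.mul_rpow (by positivity) (by positivity),
        ← Real.rpow_mul hn0.le]
      congr 2
      ring
    have e2 : ((n : ℝ) ^ (-(2 * s / θ))) ^ 2 * (n : ℝ) ^ (4 * s / θ) = 1 := by
      rw [← Real.rpow_natCast, ← Real.rpow_mul hn0.le, ← Real.rpow_add hn0]
      have : -(2 * s / θ) * ((2 : ℕ) : ℝ) + 4 * s / θ = 0 := by
        push_cast
        ring
      rw [this, Real.rpow_zero]
    calc (C * (n : ℝ) ^ (-(2 * s / θ))) ^ 2 * (⌈x⌉₊ : ℝ) ^ (2 * s) * L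
        ≤ (C * (n : ℝ) ^ (-(2 * s / θ))) ^ 2 * ((2 * a) ^ (2 * s) * (n : ℝ) ^ (4 * s / θ)) * L := by
          gcongr
      _ = C ^ 2 * (2 * a) ^ (2 * s) * L *
          (((n : ℝ) ^ (-(2 * s / θ))) ^ 2 * (n : ℝ) ^ (4 * s / θ)) := by ring
      _ = ε * (L / (L + 1)) := by
          rw [e2, h2a]
          field_simp
      _ ≤ ε := mul_le_of_le_one_right hε.le ((div_le_one (by positivity)).2 (by linarith))
  · have e3 : (n : ℝ) ^ 2 * (((n : ℝ) ^ (-(2 * s / θ))) ^ 2) ^ 2 = ((n : ℝ) ^ (2 / θ)) ^ D := by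
      simp only [← Real.rpow_natCast, ← Real.rpow_mul hn0.le, ← Real.rpow_add hn0]
      congr 1
      field_simp
      push_cast
      rw [hθ]
      ring
    have e4 : 0 < x ^ D := by positivity
    calc (n * ((C * (n : ℝ) ^ (-(2 * s / θ))) ^ 2 * κ)) ^ 2 / (2 * (⌈x⌉₊ : ℝ) ^ D)
        ≤ (n * ((C * (n : ℝ) ^ (-(2 * s / θ))) ^ 2 * κ)) ^ 2 / (2 * x ^ D) := by gcongr
      _ = (C ^ 2 * κ) ^ 2 * ((n : ℝ) ^ 2 * (((n : ℝ) ^ (-(2 * s / θ))) ^ 2) ^ 2) / (2 * x ^ D) := by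
          ring
      _ = (C ^ 2 * κ) ^ 2 / (2 * a ^ D) := by
          rw [e3, hx, mul_pow a]
          field_simp

theorem gaussDensity_ge {ι : Type} [Fintype ι] {β : ℝ} (hβ : 0 < β) (x : EuclideanSpace ℝ ι)
    (hx : ∀ a, x a ∈ Set.Icc (0 : ℝ) 1) :
    (β / Real.pi) ^ ((Fintype.card ι : ℝ) / 2) * Real.exp (-β * Fintype.card ι) ≤
      gaussDensity β x := by
  have := Real.pi_pos
  have h := norm_sq_le_card hx
  refine mul_le_mul_of_nonneg_left (Real.exp_le_exp.2 ?_) (by positivity)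
  nlinarith

/-- Tests of sufficiently small level do not detect alternatives below the critical rate. -/
theorem exists_level_liminf_power_lt {k : ℕ} (hk : 2 ≤ k) {d : Fin k → ℕ} (hd : ∀ j, 1 ≤ d j)
    {s : ℝ} (hs : 0 < s) {M : Fin k → ℝ} (hM : ∀ j, 0 < M j) {Δ : ℕ → ℝ}
    (hΔ : liminf (fun n : ℕ =>
      (((n : ℝ) ^ (2 * s / ((∑ j, (d j : ℝ)) + 4 * s)) * Δ n : ℝ) : EReal)) atTop < ⊤) :
    ∃ α ∈ Set.Ioo (0 : ℝ) 1,
      ∀ φ : (n : ℕ) → (Fin n → Joint d) → ℝ≥0∞, (∀ n, IsTest (φ n)) →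
        HasAsymptoticLevel φ (nullHyp d s M) α →
        liminf (fun n : ℕ => power (φ n) (altHyp d s M (Δ n))) atTop < 1 := by
  have hcard : ∑ j, (d j : ℝ) = (Fintype.card ((j : Fin k) × Fin (d j)) : ℝ) := by
    rw [card_joint]
    push_cast
    rfl
  rw [hcard] at hΔ
  set D := Fintype.card ((j : Fin k) × Fin (d j)) with hD
  have hJ : Nonempty ((j : Fin k) × Fin (d j)) := ⟨⟨⟨0, by omega⟩, ⟨0, hd _⟩⟩⟩
  have hdj : ∀ j, Nonempty (Fin (d j)) := fun j => ⟨⟨0, hd j⟩⟩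
  obtain ⟨C₀, hC₀, -⟩ := EReal.lt_iff_exists_real_btwn.1 hΔ
  have hfreq := frequently_lt_of_liminf_lt (by isBoundedDefault) hC₀
  set N := ∏ j, M j with hN
  have hN0 : 0 < N := Finset.prod_pos fun j _ => hM j
  -- the null law is Gaussian, and flat enough to lie well inside the Sobolev balls
  obtain ⟨r, ⟨hr1, hrM⟩, hrN⟩ := (((eventually_gt_atTop (0 : ℝ)).and (eventually_all.2 fun j =>
    (tendsto_sobolevNormSq_gaussDensity (ι := Fin (d j)) hs.le).eventually_le_const
      (ENNReal.pow_pos (ENNReal.ofReal_pos.2 (hM j)) 2))).and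
    ((tendsto_sobolevNormSq_gaussDensity (ι := (j : Fin k) × Fin (d j)) hs.le).eventually_le_const
      (ENNReal.ofReal_pos.2 (by positivity : 0 < N ^ 2 / 4)))).exists
  set β : ℝ := 1 / (2 * r ^ 2) with hβdef
  have hβ : 0 < β := by positivity
  set P := lawOf (gaussDensity β : Joint d → ℝ) with hP
  have hnull : P ∈ nullHyp d s M := by
    rw [hP, ← tensor_gaussDensity hβ]
    exact lawOf_mem_nullHyp (fun j x => (gaussDensity_pos hβ x).le)
      (fun j => continuous_gaussDensity β) (fun j => integrable_gaussDensity hβ)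
      (fun j => integral_gaussDensity hβ) hrM
  set c : ℝ := (β / Real.pi) ^ ((D : ℝ) / 2) * Real.exp (-β * D) with hc
  have hc0 : 0 < c := by
    have := Real.pi_pos
    positivity
  set K := ∫ x : Joint d, wavelet x ^ 2 with hK
  have hK0 : 0 < K := integral_wavelet_sq_pos
  set W := sobolevNormSq s (wavelet : Joint d → ℝ) with hW
  have hWt : W ≠ ⊤ := (sobolevNormSq_lt_top hs.le contDiff_wavelet hasCompactSupport_wavelet).ne
  set C : ℝ := max C₀ 1 / √K with hC
  have hC0 : 0 < C := by positivity
  obtain ⟨E, b, hE, hb⟩ := exists_resolution hs D (K / c) hC0 hc0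
    (by positivity : 0 < N ^ 2 / 8) (ENNReal.toReal_nonneg (a := W))
  -- the level makes the mixture bound equal to `1 / 4 + 1 / 2`
  set α : ℝ := (32 * Real.exp E)⁻¹ with hα
  have hα0 : 0 < α := by positivity
  refine ⟨α, ⟨hα0, inv_lt_one_of_one_lt₀ (by linarith [Real.one_le_exp hE])⟩,
    fun φ hφ hlevel => ?_⟩
  have hlev : ∀ᶠ n in atTop, rejectProb (φ n) P < ENNReal.ofReal (2 * α) :=
    eventually_lt_of_limsup_lt ((hlevel P hnull).trans_lt
      ((ENNReal.ofReal_lt_ofReal_iff (by positivity)).2 (by linarith)))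
  have hpow : ∃ᶠ n in atTop, power (φ n) (altHyp d s M (Δ n)) ≤ ENNReal.ofReal (1 / 4) + 2⁻¹ := by
    refine (hfreq.and_eventually (hb.and (hlev.and (eventually_gt_atTop 0)))).mono ?_
    rintro n ⟨hn, ⟨hb0, hδc, hδs, hδE⟩, hrej, hn0⟩
    have hn0' : (0 : ℝ) < n := by exact_mod_cast hn0
    rw [EReal.coe_lt_coe_iff] at hn
    set θ : ℝ := 2 * s / (D + 4 * s) with hθ
    set δ : ℝ := C * (n : ℝ) ^ (-θ) with hδ
    have hδ0 : 0 < δ := by positivity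
    have hΔδ : Δ n ≤ δ * √K := by
      have h1 : (n : ℝ) ^ θ * Δ n ≤ max C₀ 1 := hn.le.trans (le_max_left _ _)
      have h2 : δ * √K = (max C₀ 1) / (n : ℝ) ^ θ := by
        have : √K ≠ 0 := (Real.sqrt_pos.2 hK0).ne'
        rw [hδ, hC, Real.rpow_neg hn0'.le]
        field_simp
      rw [h2, le_div_iff₀ (by positivity), mul_comm]
      exact h1
    have hψ : ENNReal.ofReal (δ ^ 2 * (b n : ℝ) ^ (2 * s)) * W ≤ ENNReal.ofReal (N ^ 2 / 8) := by
      rw [← ENNReal.ofReal_toReal hWt, ← ENNReal.ofReal_mul (by positivity)]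
      exact ENNReal.ofReal_le_ofReal hδs
    refine (power_altHyp_le hk hd hs.le hM hβ hrM hrN hc0 (gaussDensity_ge hβ) hδ0 hδc hb0 hψ hΔδ
      (hφ n)).trans (add_le_add_left (ENNReal.ofReal_le_ofReal ?_) _)
    rw [Real.sqrt_le_left (by norm_num)]
    have h3 : (rejectProb (φ n) P).toReal ≤ 2 * α :=
      ENNReal.toReal_le_of_le_ofReal (by positivity) hrej.le
    have h4 : δ ^ 2 / c * K = δ ^ 2 * (K / c) := by ring
    have h5 : Real.exp ((n * (δ ^ 2 / c * K)) ^ 2 / (2 * (b n : ℝ) ^ D)) ≤ Real.exp E := by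
      rw [h4]
      exact Real.exp_le_exp.2 hδE
    refine (mul_le_mul h3 h5 (Real.exp_pos _).le (by positivity)).trans (le_of_eq ?_)
    rw [hα]
    field_simp
    norm_num
  refine (liminf_le_of_frequently_le' hpow).trans_lt ?_
  rw [← ENNReal.ofReal_ofNat 2, ← ENNReal.ofReal_inv_of_pos (by norm_num),
    ← ENNReal.ofReal_add (by norm_num) (by norm_num), ← ENNReal.ofReal_one]
  exact (ENNReal.ofReal_lt_ofReal_iff one_pos).2 (by norm_num)

end Minimax

end IndepTest

end

theorem theorem7 (k : ℕ) (hk : 2 ≤ k) (d : Fin k → ℕ) (hd : ∀ j, 1 ≤ d j)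
    (s : ℝ) (hs : 0 < s) (M : Fin k → ℝ) (hM : ∀ j, 0 < M j) (Δ : ℕ → ℝ) :
    (Tendsto (fun n : ℕ => (n : ℝ) ^ (2 * s / ((∑ j, (d j : ℝ)) + 4 * s)) * Δ n) atTop atTop →
      ∀ ν : ℕ → ℝ, (∀ n, 0 < ν n) →
        (ν =Θ[atTop] fun n : ℕ => (n : ℝ) ^ (4 / ((∑ j, (d j : ℝ)) + 4 * s))) →
        ∀ α ∈ Set.Ioo (0 : ℝ) 1,
          Tendsto (fun n : ℕ => IndepTest.power (IndepTest.gaussTest d n (ν n) α)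
            (IndepTest.altHyp d s M (Δ n))) atTop (𝓝 1)) ∧
    (liminf (fun n : ℕ =>
        (((n : ℝ) ^ (2 * s / ((∑ j, (d j : ℝ)) + 4 * s)) * Δ n : ℝ) : EReal)) atTop < ⊤ →
      ∃ α ∈ Set.Ioo (0 : ℝ) 1,
        ∀ φ : (n : ℕ) → (Fin n → IndepTest.Joint d) → ℝ≥0∞,
          (∀ n, IndepTest.IsTest (φ n)) →
          IndepTest.HasAsymptoticLevel φ (IndepTest.nullHyp d s M) α →
          liminf (fun n : ℕ => IndepTest.power (φ n)
            (IndepTest.altHyp d s M (Δ n))) atTop < 1) := by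
  exact ⟨fun hΔ ν hν0 hν α _ => IndepTest.tendsto_power_gaussTest hs hM hΔ hν0 hν α,
    fun hΔ => IndepTest.exists_level_liminf_power_lt hk hd hs hM hΔ⟩
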